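/- **Setup.** Let $F$ be a CM number field with maximal totally real subfield $F_0$ and conjugation $a\mapsto\bar a$; let $n\ge 1$. Let $\Phi_F\subset\mathrm{Hom}(F,\overline{\mathbb Q})$ be a CM type, $\varphi_0\in\Phi_F$, and let $V$ be an $n$-dimensional $F/F_0$-hermitian space of signature $(n-1,1)$ at $\varphi_0$ and $(n,0)$ at the other $\varphi\in\Phi_F$. Put $r_\varphi=n-1$ for $\varphi=\varphi_0$, $r_\varphi=n$ for $\varphi\in\Phi_F\setminus\{\varphi_0\}$, $r_{\bar\varphi}=n-r_\varphi$, and let $E=E_{\Phi_F}E_r\subset\overline{\mathbb Q}$ be the composite of the reflex fields of $\Phi_F$ and $r$; it contains $F$ through $\varphi_0$. Let $G=\mathrm U(V)$ and $Z^{\mathbb Q}=\{z\in\mathrm{Res}_{F/\mathbb Q}\mathbb G_m : z\bar z\in\mathbb G_m\}$. Let $v_0$ be an archimedean place of $F_0$, let $w_0:F\to\mathbb C$ be an embedding above $v_0$, and let $V'$ be the hermitian space that is isomorphic to $V$ at all finite places (we fix an isometry over the finite adeles), has signature $(n-1,1)$ at $v_0$, and is positive definite at the other archimedean places. Let $G'=\mathrm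 U(V')$, and let $\mathcal D_{v_0}$ be the space of negative definite complex lines in $V'\otimes_{F,w_0}\mathbb C$. For $u\in V'(F_0)$ let $\mathcal D_{v_0,u}$ be the set of lines in $\mathcal D_{v_0}$ orthogonal to $u$. Let $K_Z\subset Z^{\mathbb Q}(\mathbb A_f)$ and $K_G\subset G(\mathbb A_{0,f})$ be compact open subgroups, small enough that $Z^{\mathbb Q}(\mathbb Q)\times G'(F_0)$ acts freely on $\mathcal D_{v_0}\times Z^{\mathbb Q}(\mathbb A_f)/K_Z\times G(\mathbb A_{0,f})/K_G$. For a place $\nu\mid v_0$ of $E$ the complex points of the Shimura variety of $Z^{\mathbb Q}\times\mathrm{Res}_{F_0/\mathbb Q}\,G$ are $$M_{\nu,\mathbb C}=(Z^{\mathbb Q}(\mathbb Q)\times G'(F_0))\backslash\bigl[\mathcal D_{v_0}\times Z^{\mathbb Q}(\mathbb A_f)/K_Z\times G(\mathbb A_{0,f})/K_G\bigr],$$ where the line component is formed with the embedding of $F$ induced by $\nu$. Let $\tau(Z^{\mathbb Q})=\#\,Z^{\mathbb Q}(\mathbb Q)\backslash Z^{\mathbb Q}(\mathbb A_f)/K_Z$.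 Let $\alpha\in F[T]$ be monic of degree $n$, conjugate self-reciprocal ($T^n\alpha(T^{-1})=\alpha(0)\bar\alpha(T)$) and irreducible, and let $F'=F[T]/(\alpha)$, with the involution that extends $a\mapsto\bar a$ and sends $T$ to $T^{-1}$, and fixed field $F_0'$; assume that $F'$ is a CM extension of $F_0'$. Let $G'(\alpha)$ be the set of elements of $G'$ with characteristic polynomial $\alpha$ and $V'_\xi$ the set of vectors $u$ of $V'$ with $\langle u,u\rangle=\xi$. Let $\Phi=\phi_0\otimes\phi$ with $\phi_0$ a real-valued bi-$K_G$-invariant Schwartz function on $G(\mathbb A_{0,f})$ and $\phi$ a real-valued $K_G$-invariant Schwartz function on $V(\mathbb A_{0,f})$. The complex points of the weighted CM cycle $\mathrm{CM}(\alpha,\phi_0)_{\nu,\mathbb C}$ on $M_{\nu,\mathbb C}$ are the orbits of tuples $(\delta,z,z',hK_G)$ with $\delta\in G'(\alpha)(F_0)$ and $\delta z=z$, where $(z,z',hK_G)$ represents the point of $M_{\nu,\mathbb C}$ and $\gamma$ acts on $\delta$ by $\gamma\delta\gamma^{-1}$; such a point has multiplicity $\phi_0(h^{-1}\delta h)$.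 For $h_\infty=(h_v)_{v\mid\infty}\in\prod_{v\mid\infty}\mathrm{SL}_2(\mathbb R)$ write $h_v=\begin{pmatrix}1&b_v\\&1\end{pmatrix}\begin{pmatrix}\sqrt{a_v}&\\&1/\sqrt{a_v}\end{pmatrix}\kappa_v$ with $a_v>0$, $\kappa_v\in\mathrm{SO}(2)$. With $\mathrm{Ei}(-r)=-\int_r^\infty e^{-t}\,dt/t$ ($r>0$) and $R(u,z)=|\langle u,\tilde z\rangle|^2/\langle\tilde z,\tilde z\rangle$, where $\tilde z$ is a basis of $z$, Kudla's Green function of $u\neq0$ is $\mathcal G^{K}(u,h_\infty)(z)=-\mathrm{Ei}(2\pi a_{v_0}R(u,z))$, and $\mathcal G^{K}_\nu(\xi,\phi)$ is the function on $M_{\nu,\mathbb C}$ with value $\sum_{u\in V'_\xi(F_0)}\phi(h^{-1}u)\,\mathcal G^{K}(u,h_\infty)(z)$ at $(z,z',hK_G)$. The pairing of a Green function $g$ with a zero-cycle $\sum m_PP$ is normalized as $\tfrac12\sum m_P\,g(P)$. Put $\log q_\nu=2$ (the places of $E$ above $v_0$ are complex), $$\mathrm{Int}_\nu^{\natural,K}(\xi,\Phi)=\langle\mathcal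 G^K_\nu(\xi,\phi),\mathrm{CM}(\alpha,\phi_0)_{\nu,\mathbb C}\rangle\log q_\nu,\qquad \mathrm{Int}^K_{v_0}(\xi,\Phi)=\frac1{\tau(Z^{\mathbb Q})[E:F]}\sum_{\nu\mid v_0}\mathrm{Int}_\nu^{\natural,K}(\xi,\Phi).$$ Let $\mathrm{Orb}((\delta,u),\Phi)=\int_{G(\mathbb A_{0,f})}\phi_0(h^{-1}\delta h)\,\phi(h^{-1}u)\,dh$, with the Haar measure giving $K_G$ volume $1$. For $\delta\in G'(\alpha)(F_0)$ let $F'$ act on $V'$ with $T$ acting by $\delta$, let $\langle\cdot,\cdot\rangle'$ be the $F'$-valued form on $V'$ with $\mathrm{tr}_{F'/F}(a\langle x,y\rangle')=\langle ax,y\rangle$ for all $a\in F'$, and for $(\delta,u)$ let $\xi'=\langle u,u\rangle'\in F_0'$ be the refined invariant. **Theorem.** Let $0\ne\xi\in F_0$. 1. Every $\delta\in G'(\alpha)(F_0)$ has a unique fixed point $z_\delta$ on $\mathcal D_{v_0}$, and $z_\delta$ does not lie on $\mathcal D_{v_0,u}$ for any nonzero $u\in V'(F_0)$. 2. For $(\delta,u)\in(G'(\alpha)\times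 V'_\xi)(F_0)$ one has $\mathrm{tr}_{F_0'/F_0}\xi'=\xi$; there is a unique archimedean place $v_0'$ of $F_0'$ at which $\xi'$ is negative; it lies over $v_0$, and $R(u,z_\delta)=-|\xi'|_{v_0'}$. 3. The weighted CM cycle has finite support, the series defining the Green function converges at its points, the orbital integrals converge absolutely, and $$\mathrm{Int}^K_{v_0}(\xi,\Phi)=\sum_{(\delta,u)}\mathcal G^K(u,h_\infty)(z_\delta)\cdot\mathrm{Orb}((\delta,u),\Phi)=-\sum_{(\delta,u)}\mathrm{Ei}(-2\pi a_{v_0}|\xi'|_{v_0'})\cdot\mathrm{Orb}((\delta,u),\Phi),$$ where the absolutely convergent sums run over the $G'(F_0)$-orbits $(\delta,u)$ in $(G'(\alpha)\times V'_\xi)(F_0)$. In particular, for $a_{v_0}=1$ one has $\mathrm{Int}^K_{v_0}(\xi,\Phi)=-\sum\mathrm{Ei}(-2\pi|\xi'|_{v_0'})\,\mathrm{Orb}((\delta,u),\Phi)$. Moreover, for each single place $\nu\mid v_0$, the sum $\sum_P m_P\,\mathcal G^K_\nu(\xi,\phi)(P)$ over the points $P$ of $\mathrm{CM}(\alpha,\phi_0)_{\nu,\mathbb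 C}$ with multiplicities $m_P$, divided by $\tau(Z^{\mathbb Q})$, is equal to the same sum over orbits. -/

import Mathlib

open NumberField IsDedekindDomain MeasureTheory
open scoped TensorProduct Matrix MatrixGroups

noncomputable section

namespace KudlaGreen

/-! ### Hermitian forms and unitary groups -/

/-- The sesquilinear form `⟨x, y⟩ = ∑ x_i J_ij c(y_j)` with Gram matrix `J` (linear in the first
variable, `c`-linear in the second). -/
def herm {n : ℕ} {R : Type*} [CommRing R] (c : R →+* R) (J : Matrix (Fin n) (Fin n) R)
    (x y : Fin n → R) : R :=
  x ⬝ᵥ (J *ᵥ (fun i => c (y i)))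

/-- The unitary group of the form with Gram matrix `J`: all `g` with `⟨g x, g y⟩ = ⟨x, y⟩`. -/
def UGroup {n : ℕ} {R : Type*} [CommRing R] (c : R →+* R) (J : Matrix (Fin n) (Fin n) R) :
    Subgroup (GL (Fin n) R) where
  carrier := {g | (g.val)ᵀ * J * g.val.map c = J}
  one_mem' := by simp
  mul_mem' := by
    intro a b ha hb
    simp only [Set.mem_ofPred_eq] at ha hb ⊢
    have : (a * b).val.map c = a.val.map c * b.val.map c := by
      rw [Units.val_mul, Matrix.map_mul]
    rw [this, Units.val_mul, Matrix.transpose_mul]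
    calc (b.val)ᵀ * (a.val)ᵀ * J * (a.val.map c * b.val.map c)
        = (b.val)ᵀ * ((a.val)ᵀ * J * a.val.map c) * b.val.map c := by
          simp only [Matrix.mul_assoc]
      _ = J := by rw [ha, hb]
  inv_mem' := by
    intro a ha
    simp only [Set.mem_ofPred_eq] at ha ⊢
    have h1 : ((a⁻¹ : GL (Fin n) R).val)ᵀ * (a.val)ᵀ = 1 := by
      rw [← Matrix.transpose_mul, ← Units.val_mul]; simp
    have h2 : a.val.map c * (a⁻¹ : GL (Fin n) R).val.map c = 1 := by
      rw [← Matrix.map_mul, ← Units.val_mul]; simp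
    calc ((a⁻¹ : GL (Fin n) R).val)ᵀ * J * (a⁻¹ : GL (Fin n) R).val.map c
        = ((a⁻¹ : GL (Fin n) R).val)ᵀ * ((a.val)ᵀ * J * a.val.map c) *
            (a⁻¹ : GL (Fin n) R).val.map c := by rw [ha]
      _ = (((a⁻¹ : GL (Fin n) R).val)ᵀ * (a.val)ᵀ) * J *
            (a.val.map c * (a⁻¹ : GL (Fin n) R).val.map c) := by
          simp only [Matrix.mul_assoc]
      _ = J := by rw [h1, h2, Matrix.one_mul, Matrix.mul_one]

theorem herm_unitary {n : ℕ} {R : Type*} [CommRing R] {c : R →+* R}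
    {J : Matrix (Fin n) (Fin n) R} (g : UGroup c J) (x y : Fin n → R) :
    herm c J (g.val.val *ᵥ x) (g.val.val *ᵥ y) = herm c J x y := by
  have hg : (g.val.val)ᵀ * J * g.val.val.map c = J := g.2
  have hm : (fun i => c ((g.val.val *ᵥ y) i)) = g.val.val.map c *ᵥ (fun i => c (y i)) := by
    funext i
    simp [Matrix.mulVec, dotProduct, map_sum, map_mul]
  unfold herm
  rw [hm, ← Matrix.vecMul_transpose, ← Matrix.dotProduct_mulVec, Matrix.mulVec_mulVec,
    Matrix.mulVec_mulVec, hg]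

/-- Base change of unitary groups along a ring homomorphism compatible with the involutions. -/
def UGroup.map {n : ℕ} {R S : Type*} [CommRing R] [CommRing S] {c : R →+* R} {c' : S →+* S}
    (f : R →+* S) (hf : ∀ x, f (c x) = c' (f x)) (J : Matrix (Fin n) (Fin n) R) :
    UGroup c J →* UGroup c' (J.map f) :=
  ((Matrix.GeneralLinearGroup.map f).comp (UGroup c J).subtype).codRestrict _ (by
    intro g
    have hg : (g.val.val)ᵀ * J * g.val.val.map c = J := g.2
    change ((g.val.val.map f))ᵀ * J.map f * (g.val.val.map f).map c' = J.map f
    have h1 : (g.val.val.map f).map c' = (g.val.val.map c).map f := by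
      ext i j; simp [hf]
    rw [h1, ← Matrix.transpose_map, ← Matrix.map_mul, ← Matrix.map_mul, hg])

/-- The hermitian form with Gram matrix `H` over `ℂ` has signature `(p, n - p)`: in a suitable basis
its Gram matrix is `diag(1, …, 1, -1, …, -1)` with `p` entries `1`. -/
def HasSignature {n : ℕ} (H : Matrix (Fin n) (Fin n) ℂ) (p : ℕ) : Prop :=
  ∃ A : GL (Fin n) ℂ, (A.val)ᵀ * H * A.val.map (starRingEnd ℂ) =
    Matrix.diagonal (fun i : Fin n => if (i : ℕ) < p then (1 : ℂ) else -1)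

/-! ### Negative lines and the function `R(u, z)` -/

/-- The Grassmannian of negative definite complex lines of the hermitian space `(ℂⁿ, H)`. -/
@[ext]
structure NegLine {n : ℕ} (H : Matrix (Fin n) (Fin n) ℂ) where
  /-- the underlying subspace of `ℂⁿ` -/
  line : Submodule ℂ (Fin n → ℂ)
  finrank_line : Module.finrank ℂ line = 1
  neg : ∀ x ∈ line, x ≠ 0 → (herm (starRingEnd ℂ) H x x).re < 0

theorem NegLine.exists_basis {n : ℕ} {H : Matrix (Fin n) (Fin n) ℂ} (z : NegLine H) :
    ∃ w ∈ z.line, w ≠ 0 ∧ ∀ x ∈ z.line, ∃ a : ℂ, x = a • w := by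
  obtain ⟨w, hw, hspan⟩ := finrank_eq_one_iff'.1 z.finrank_line
  refine ⟨w.1, w.2, fun h => hw (Subtype.ext h), fun x hx => ?_⟩
  obtain ⟨a, ha⟩ := hspan ⟨x, hx⟩
  exact ⟨a, by simpa using (congrArg Subtype.val ha).symm⟩

/-- A basis of the line `z`. -/
def NegLine.basis {n : ℕ} {H : Matrix (Fin n) (Fin n) ℂ} (z : NegLine H) : Fin n → ℂ :=
  z.exists_basis.choose

/-- The line `z` is orthogonal to `u`, i.e. `z` lies on the special divisor attached to `u`. -/
def NegLine.Perp {n : ℕ} {H : Matrix (Fin n) (Fin n) ℂ} (z : NegLine H) (u : Fin n → ℂ) : Prop :=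
  ∀ x ∈ z.line, herm (starRingEnd ℂ) H u x = 0

/-- `R(u, z) = ⟨u_z, u_z⟩ = |⟨u, w⟩|² / ⟨w, w⟩`, where `w` is a basis of `z` and `u_z` is the
orthogonal projection of `u` to `z`. -/
def RFun {n : ℕ} {H : Matrix (Fin n) (Fin n) ℂ} (u : Fin n → ℂ) (z : NegLine H) : ℝ :=
  ‖herm (starRingEnd ℂ) H u z.basis‖ ^ 2 / (herm (starRingEnd ℂ) H z.basis z.basis).re

theorem herm_smul_right {n : ℕ} (H : Matrix (Fin n) (Fin n) ℂ) (a : ℂ) (x y : Fin n → ℂ) :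
    herm (starRingEnd ℂ) H x (a • y) = starRingEnd ℂ a * herm (starRingEnd ℂ) H x y := by
  have : (fun i => starRingEnd ℂ ((a • y) i)) = starRingEnd ℂ a • (fun i => starRingEnd ℂ (y i)) := by
    funext i; simp
  unfold herm
  rw [this, Matrix.mulVec_smul, dotProduct_smul, smul_eq_mul]

theorem herm_smul_left {n : ℕ} (H : Matrix (Fin n) (Fin n) ℂ) (a : ℂ) (x y : Fin n → ℂ) :
    herm (starRingEnd ℂ) H (a • x) y = a * herm (starRingEnd ℂ) H x y := by
  unfold herm
  rw [smul_dotProduct, smul_eq_mul]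

/-- `R(u, z)` may be computed with any basis of the line. -/
theorem RFun_eq {n : ℕ} {H : Matrix (Fin n) (Fin n) ℂ} (u : Fin n → ℂ) (z : NegLine H)
    (w : Fin n → ℂ) (hw : w ∈ z.line) (hw0 : w ≠ 0) :
    RFun u z = ‖herm (starRingEnd ℂ) H u w‖ ^ 2 / (herm (starRingEnd ℂ) H w w).re := by
  obtain ⟨hb, hb0, hspan⟩ := z.exists_basis.choose_spec
  obtain ⟨a, ha⟩ := hspan w hw
  have ha0 : a ≠ 0 := by
    rintro rfl
    exact hw0 (by simpa using ha)
  have hre : (herm (starRingEnd ℂ) H w w).re =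
      ‖a‖ ^ 2 * (herm (starRingEnd ℂ) H z.basis z.basis).re := by
    rw [ha, herm_smul_right, herm_smul_left, ← mul_assoc, mul_comm (starRingEnd ℂ a) a,
      Complex.mul_conj, Complex.normSq_eq_norm_sq, Complex.re_ofReal_mul]
    rfl
  have hn : ‖herm (starRingEnd ℂ) H u w‖ = ‖a‖ * ‖herm (starRingEnd ℂ) H u z.basis‖ := by
    rw [ha, herm_smul_right, norm_mul, Complex.norm_conj]
    rfl
  have ha1 : ‖a‖ ^ 2 ≠ 0 := by positivity
  rw [hre, hn, mul_pow, mul_div_mul_left _ _ ha1]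
  rfl

instance {n : ℕ} (H : Matrix (Fin n) (Fin n) ℂ) :
    MulAction (UGroup (starRingEnd ℂ) H) (NegLine H) where
  smul g z :=
    have hinj : Function.Injective (Matrix.mulVecLin g.val.val) := by
      intro x y hxy
      simp only [Matrix.mulVecLin_apply] at hxy
      have := congrArg (fun v => (g.val⁻¹).val *ᵥ v) hxy
      simpa [Matrix.mulVec_mulVec, ← Units.val_mul] using this
    { line := z.line.map (Matrix.mulVecLin g.val.val)
      finrank_line :=
        (Submodule.equivMapOfInjective _ hinj z.line).finrank_eq.symm.trans z.finrank_line
      neg := by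
        rintro _ ⟨x, hx, rfl⟩ hx0
        rw [Matrix.mulVecLin_apply, herm_unitary]
        exact z.neg x hx (by rintro rfl; exact hx0 (by simp)) }
  one_smul z := by
    apply NegLine.ext
    change z.line.map (Matrix.mulVecLin (1 : Matrix (Fin n) (Fin n) ℂ)) = z.line
    rw [Matrix.mulVecLin_one, Submodule.map_id]
  mul_smul a b z := by
    apply NegLine.ext
    change z.line.map (Matrix.mulVecLin (a.val.val * b.val.val)) =
      (z.line.map (Matrix.mulVecLin b.val.val)).map (Matrix.mulVecLin a.val.val)
    rw [Matrix.mulVecLin_mul, Submodule.map_comp]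

theorem NegLine.coe_smul {n : ℕ} {H : Matrix (Fin n) (Fin n) ℂ} (g : UGroup (starRingEnd ℂ) H)
    (z : NegLine H) : (g • z).line = z.line.map (Matrix.mulVecLin g.val.val) := rfl

theorem RFun_smul {n : ℕ} {H : Matrix (Fin n) (Fin n) ℂ} (g : UGroup (starRingEnd ℂ) H)
    (u : Fin n → ℂ) (z : NegLine H) : RFun (g.val.val *ᵥ u) (g • z) = RFun u z := by
  obtain ⟨w, hw, hw0, -⟩ := z.exists_basis
  have hne : g.val.val *ᵥ w ≠ 0 := by
    intro h
    have := congrArg (fun v => (g.val⁻¹).val *ᵥ v) h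
    exact hw0 (by simpa [Matrix.mulVec_mulVec, ← Units.val_mul] using this)
  rw [RFun_eq _ (g • z) (g.val.val *ᵥ w) ⟨w, hw, rfl⟩ hne, RFun_eq u z w hw hw0, herm_unitary,
    herm_unitary]

/-! ### Finite adeles of a CM field -/

section Adeles

variable (F : Type*) [Field F] [NumberField F]

/-- The ring of finite adeles of the number field `F`, as `𝔸_f ⊗_ℚ F`. -/
def AdeleF : Type _ := FiniteAdeleRing ℤ ℚ ⊗[ℚ] F

instance : CommRing (AdeleF F) := inferInstanceAs (CommRing (FiniteAdeleRing ℤ ℚ ⊗[ℚ] F))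

instance : Algebra (FiniteAdeleRing ℤ ℚ) (AdeleF F) :=
  inferInstanceAs (Algebra (FiniteAdeleRing ℤ ℚ) (FiniteAdeleRing ℤ ℚ ⊗[ℚ] F))

/-- The adelic topology (that of a free `𝔸_f`-module of finite rank). -/
instance : TopologicalSpace (AdeleF F) := moduleTopology (FiniteAdeleRing ℤ ℚ) (AdeleF F)

/-- The diagonal embedding of `F` into its finite adeles. -/
def toAdele : F →+* AdeleF F :=
  (Algebra.TensorProduct.includeRight : F →ₐ[ℚ] FiniteAdeleRing ℤ ℚ ⊗[ℚ] F).toRingHom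

variable [IsCMField F]

/-- The nontrivial automorphism of `F` over its maximal totally real subfield. -/
def conjF : F →+* F := (IsCMField.complexConj F).toRingEquiv.toRingHom

/-- The involution of the finite adeles of `F` induced by complex conjugation on `F`. -/
def conjA : AdeleF F →+* AdeleF F :=
  (Algebra.TensorProduct.map (AlgHom.id ℚ (FiniteAdeleRing ℤ ℚ)) (conjF F).toRatAlgHom).toRingHom

theorem toAdele_conj (x : F) : toAdele F (conjF F x) = conjA F (toAdele F x) := by
  change (1 : FiniteAdeleRing ℤ ℚ) ⊗ₜ[ℚ] (conjF F x) =
    Algebra.TensorProduct.map (AlgHom.id ℚ (FiniteAdeleRing ℤ ℚ)) (conjF F).toRatAlgHom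
      (1 ⊗ₜ[ℚ] x)
  rw [Algebra.TensorProduct.map_tmul]
  rfl

theorem embedding_conj (w : F →+* ℂ) (x : F) : w (conjF F x) = starRingEnd ℂ (w x) :=
  IsCMField.complexEmbedding_complexConj F w x

end Adeles

/-! ### CM types and the reflex field -/

section Reflex

/-- A fixed algebraic closure of `ℚ`. -/
abbrev QBar : Type := AlgebraicClosure ℚ

theorem isAlgClosure_aux (a : Algebra ℚ QBar) :
    @IsAlgClosure ℚ QBar _ _ a _ := by
  have h : a = AlgebraicClosure.instAlgebra ℚ := Subsingleton.elim _ _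
  rw [h]
  infer_instance

instance : IsAlgClosure ℚ QBar := isAlgClosure_aux _

variable {F : Type*} [Field F] [NumberField F]

/-- The stabilizer in `Gal(ℚ̄/ℚ)` of a function `r` on `Hom(F, ℚ̄)`. -/
def typeStab (r : (F →+* QBar) → ℕ) : Subgroup (QBar ≃ₐ[ℚ] QBar) where
  carrier := {σ | ∀ φ, r ((σ : QBar →+* QBar).comp φ) = r φ}
  one_mem' := fun φ => rfl
  mul_mem' := by
    intro a b ha hb φ
    exact (ha ((b : QBar →+* QBar).comp φ)).trans (hb φ)
  inv_mem' := by
    intro a ha φ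
    have h := ha (((a⁻¹ : QBar ≃ₐ[ℚ] QBar) : QBar →+* QBar).comp φ)
    rw [← h]
    refine congrArg r (RingHom.ext fun x => ?_)
    change (a * a⁻¹) (φ x) = φ x
    rw [mul_inv_cancel]
    rfl

/-- The reflex field of a function `r` on `Hom(F, ℚ̄)`: the fixed field of its stabilizer. -/
def reflexField (r : (F →+* QBar) → ℕ) : IntermediateField ℚ QBar :=
  IntermediateField.fixedField (typeStab r)

theorem fixingSubgroup_reflexField (r : (F →+* QBar) → ℕ) :
    (reflexField r).fixingSubgroup = typeStab r := by
  let L : IntermediateField ℚ QBar := ⨆ φ : F →ₐ[ℚ] QBar, φ.fieldRange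
  have : FiniteDimensional ℚ L := by
    have : ∀ φ : F →ₐ[ℚ] QBar, FiniteDimensional ℚ φ.fieldRange := fun φ =>
      LinearMap.finiteDimensional_range φ.toLinearMap
    exact IntermediateField.finiteDimensional_iSup_of_finite
  have hle : L.fixingSubgroup ≤ typeStab r := by
    intro σ hσ φ
    congr 1
    ext x
    have hx : φ x ∈ L :=
      (le_iSup (fun φ : F →ₐ[ℚ] QBar => φ.fieldRange) φ.toRatAlgHom) ⟨x, rfl⟩
    exact (IntermediateField.mem_fixingSubgroup_iff _ _).1 hσ _ hx
  have hopen : IsOpen (typeStab r : Set (QBar ≃ₐ[ℚ] QBar)) :=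
    Subgroup.isOpen_mono hle L.fixingSubgroup_isOpen
  exact InfiniteGalois.fixingSubgroup_fixedField
    ⟨typeStab r, Subgroup.isClosed_of_isOpen _ hopen⟩

variable [IsCMField F]

/-- `Φ` is a CM type of `F`: a set of representatives of `Hom(F, ℚ̄)` modulo complex conjugation. -/
def IsCMType (Φ : Set (F →+* QBar)) : Prop :=
  ∀ φ : F →+* QBar, Xor (φ ∈ Φ) (φ.comp (conjF F) ∈ Φ)

open Classical in
/-- The indicator function of a CM type. -/
def typeOf (Φ : Set (F →+* QBar)) (φ : F →+* QBar) : ℕ := if φ ∈ Φ then 1 else 0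

open Classical in
/-- The generalized CM type `r` of rank `n` of strict fake Drinfeld type relative to `Φ` and `φ₀`:
`r = n - 1` at `φ₀`, `r = n` at the other elements of `Φ`, and `r_φ + r_φ̄ = n`. -/
def drinfeldType (n : ℕ) (Φ : Set (F →+* QBar)) (φ₀ φ : F →+* QBar) : ℕ :=
  if φ = φ₀ then n - 1 else if φ = φ₀.comp (conjF F) then 1 else if φ ∈ Φ then n else 0

/-- The reflex field `E = E_Φ E_r` of the Shimura datum. -/
def reflexE (n : ℕ) (Φ : Set (F →+* QBar)) (φ₀ : F →+* QBar) : IntermediateField ℚ QBar :=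
  reflexField (typeOf Φ) ⊔ reflexField (drinfeldType n Φ φ₀)

theorem mem_reflexE {n : ℕ} (hn : 0 < n) {Φ : Set (F →+* QBar)} (hΦ : IsCMType Φ)
    {φ₀ : F →+* QBar} (h₀ : φ₀ ∈ Φ) (x : F) : φ₀ x ∈ reflexE n Φ φ₀ := by
  rw [← InfiniteGalois.fixedField_fixingSubgroup (reflexE n Φ φ₀)]
  rintro ⟨σ, hσ⟩
  have h1 : σ ∈ typeStab (typeOf Φ) := by
    rw [← fixingSubgroup_reflexField]
    exact IntermediateField.fixingSubgroup_antitone le_sup_left hσ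
  have h2 : σ ∈ typeStab (drinfeldType n Φ φ₀) := by
    rw [← fixingSubgroup_reflexField]
    exact IntermediateField.fixingSubgroup_antitone le_sup_right hσ
  set ψ : F →+* QBar := (σ : QBar →+* QBar).comp φ₀ with hψ
  have e1 : typeOf Φ ψ = typeOf Φ φ₀ := h1 φ₀
  have e2 : drinfeldType n Φ φ₀ ψ = drinfeldType n Φ φ₀ φ₀ := h2 φ₀
  have hmem : ψ ∈ Φ := by
    by_contra hc
    simp [typeOf, h₀, hc] at e1
  have hne : ψ ≠ φ₀.comp (conjF F) := by
    intro hc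
    rw [hc] at hmem
    rcases hΦ φ₀ with ⟨_, hb⟩ | ⟨_, hb⟩
    · exact hb hmem
    · exact hb h₀
  have heq : ψ = φ₀ := by
    by_contra hc
    simp only [drinfeldType, hc, hne, hmem, if_true, if_false] at e2
    omega
  exact congrArg (fun f : F →+* QBar => f x) heq

/-- The embedding `F → E` induced by `φ₀`. -/
def toReflex {n : ℕ} (hn : 0 < n) {Φ : Set (F →+* QBar)} (hΦ : IsCMType Φ)
    {φ₀ : F →+* QBar} (h₀ : φ₀ ∈ Φ) : F →+* reflexE n Φ φ₀ :=
  φ₀.codRestrict (reflexE n Φ φ₀).toSubring (mem_reflexE hn hΦ h₀)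

/-- The places `ν ∣ v₀` of `E` above the archimedean place `v₀` of `F₀`. -/
def placesOver {n : ℕ} (hn : 0 < n) {Φ : Set (F →+* QBar)} (hΦ : IsCMType Φ)
    {φ₀ : F →+* QBar} (h₀ : φ₀ ∈ Φ) (v₀ : maximalRealSubfield F →+* ℝ) :
    Set (InfinitePlace (reflexE n Φ φ₀)) :=
  {ν | ∀ x : maximalRealSubfield F, ν.embedding (toReflex hn hΦ h₀ (x : F)) = (v₀ x : ℂ)}

/-- The degree `[E : F]`. -/
def degE {n : ℕ} (hn : 0 < n) {Φ : Set (F →+* QBar)} (hΦ : IsCMType Φ)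
    {φ₀ : F →+* QBar} (h₀ : φ₀ ∈ Φ) : ℕ :=
  letI := (toReflex hn hΦ h₀).toAlgebra
  Module.finrank F (reflexE n Φ φ₀)

end Reflex

/-! ### The hermitian spaces `V` and `V'` and the groups attached to them -/

section Groups

variable (F : Type*) [Field F] [NumberField F] [IsCMField F] (n : ℕ)

/-- Two `n`-dimensional hermitian spaces `V = (Fⁿ, J)` and `V' = (Fⁿ, J')` over the CM field `F`,
together with an isometry `V'(𝔸_f) ≃ V(𝔸_f)`. -/
structure HermPair where
  /-- Gram matrix of `V` -/
  J : Matrix (Fin n) (Fin n) F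
  /-- Gram matrix of `V'` -/
  J' : Matrix (Fin n) (Fin n) F
  herm_J : Jᵀ = J.map (conjF F)
  herm_J' : J'ᵀ = J'.map (conjF F)
  /-- matrix of the adelic isometry -/
  iso : GL (Fin n) (AdeleF F)
  iso_spec : (iso.val)ᵀ * J.map (toAdele F) * iso.val.map (conjA F) = J'.map (toAdele F)

/-- The group `Z^ℚ(ℚ)` of all `z ∈ Fˣ` with `z z̄ ∈ ℚˣ`. -/
def ZQ : Subgroup Fˣ where
  carrier := {z | ∃ q : ℚˣ, (z : F) * conjF F z = algebraMap ℚ F q}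
  one_mem' := ⟨1, by simp⟩
  mul_mem' := by
    rintro a b ⟨p, hp⟩ ⟨q, hq⟩
    refine ⟨p * q, ?_⟩
    rw [Units.val_mul, Units.val_mul, map_mul, map_mul, ← hp, ← hq]
    ring
  inv_mem' := by
    rintro a ⟨p, hp⟩
    refine ⟨p⁻¹, ?_⟩
    rw [Units.val_inv_eq_inv_val, Units.val_inv_eq_inv_val, map_inv₀, map_inv₀, ← hp, mul_inv]

/-- The group `Z^ℚ(𝔸_f)` of all finite ideles `z` of `F` with `z z̄` a finite idele of `ℚ`. -/
def ZA : Subgroup (AdeleF F)ˣ where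
  carrier := {z | ∃ q : (FiniteAdeleRing ℤ ℚ)ˣ,
    (z : AdeleF F) * conjA F z = algebraMap (FiniteAdeleRing ℤ ℚ) (AdeleF F) q}
  one_mem' := ⟨1, by simp⟩
  mul_mem' := by
    rintro a b ⟨p, hp⟩ ⟨q, hq⟩
    refine ⟨p * q, ?_⟩
    rw [Units.val_mul, Units.val_mul, map_mul, map_mul, ← hp, ← hq]
    ring
  inv_mem' := by
    rintro a ⟨p, hp⟩
    refine ⟨p⁻¹, ?_⟩
    have h1 : (a : AdeleF F) * ((a⁻¹ : (AdeleF F)ˣ) : AdeleF F) = 1 := by simp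
    have h2 : conjA F a * conjA F ((a⁻¹ : (AdeleF F)ˣ) : AdeleF F) = 1 := by
      rw [← map_mul, h1, map_one]
    have h3 : algebraMap (FiniteAdeleRing ℤ ℚ) (AdeleF F) p *
        algebraMap (FiniteAdeleRing ℤ ℚ) (AdeleF F) ((p⁻¹ : (FiniteAdeleRing ℤ ℚ)ˣ) : _) = 1 := by
      rw [← map_mul]; simp
    calc _ = (((a⁻¹ : (AdeleF F)ˣ) : AdeleF F) * conjA F ((a⁻¹ : (AdeleF F)ˣ) : AdeleF F)) *
          (algebraMap (FiniteAdeleRing ℤ ℚ) (AdeleF F) p *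
        algebraMap (FiniteAdeleRing ℤ ℚ) (AdeleF F) ((p⁻¹ : (FiniteAdeleRing ℤ ℚ)ˣ) : _)) := by
          rw [h3, mul_one]
      _ = ((a : AdeleF F) * ((a⁻¹ : (AdeleF F)ˣ) : AdeleF F)) *
          (conjA F a * conjA F ((a⁻¹ : (AdeleF F)ˣ) : AdeleF F)) *
          algebraMap (FiniteAdeleRing ℤ ℚ) (AdeleF F) ((p⁻¹ : (FiniteAdeleRing ℤ ℚ)ˣ) : _) := by
          rw [← hp]; ring
      _ = _ := by rw [h1, h2]; ring

/-- The diagonal embedding `Z^ℚ(ℚ) → Z^ℚ(𝔸_f)`. -/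
def ZQ.toAdelic : ZQ F →* ZA F :=
  ((Units.map (toAdele F).toMonoidHom).comp (ZQ F).subtype).codRestrict _ (by
    rintro ⟨a, p, hp⟩
    refine ⟨Units.map (algebraMap ℚ (FiniteAdeleRing ℤ ℚ)).toMonoidHom p, ?_⟩
    change toAdele F a * conjA F (toAdele F a) = _
    rw [← toAdele_conj, ← map_mul, hp]
    change (1 : FiniteAdeleRing ℤ ℚ) ⊗ₜ[ℚ] (algebraMap ℚ F p) =
      (algebraMap ℚ (FiniteAdeleRing ℤ ℚ) p) ⊗ₜ[ℚ] (1 : F)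
    rw [Algebra.algebraMap_eq_smul_one, Algebra.algebraMap_eq_smul_one, TensorProduct.smul_tmul])

variable {F n}

namespace HermPair

variable (D : HermPair F n)

/-- `G'(F₀)`, the group of rational points of the unitary group of `V'`. -/
abbrev GQ : Type _ := UGroup (conjF F) D.J'

/-- `G(𝔸_{0,f})`, the group of finite adelic points of the unitary group of `V`. -/
abbrev GA : Type _ := UGroup (conjA F) (D.J.map (toAdele F))

/-- `V'(F₀) → V(𝔸_{0,f})`. -/
def vecA (u : Fin n → F) : Fin n → AdeleF F := D.iso.val *ᵥ (fun i => toAdele F (u i))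

/-- `G'(F₀) → G'(𝔸_{0,f}) ≃ G(𝔸_{0,f})`. -/
def toGA : D.GQ →* D.GA where
  toFun γ := ⟨D.iso * (UGroup.map (toAdele F) (toAdele_conj F) D.J' γ).val * D.iso⁻¹, by
    set g := (UGroup.map (toAdele F) (toAdele_conj F) D.J' γ) with hg
    set P := D.iso
    have h1 : (g.val.val)ᵀ * D.J'.map (toAdele F) * g.val.val.map (conjA F) =
      D.J'.map (toAdele F) := g.2
    have h2 : (P.val)ᵀ * D.J.map (toAdele F) * P.val.map (conjA F) = D.J'.map (toAdele F) :=
      D.iso_spec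
    have h3 : ((P⁻¹ : GL (Fin n) (AdeleF F)).val)ᵀ * (P.val)ᵀ = 1 := by
      rw [← Matrix.transpose_mul, ← Units.val_mul]; simp
    have h4 : P.val.map (conjA F) * (P⁻¹ : GL (Fin n) (AdeleF F)).val.map (conjA F) = 1 := by
      rw [← Matrix.map_mul, ← Units.val_mul]; simp
    change ((P * g.val * P⁻¹).val)ᵀ * D.J.map (toAdele F) * (P * g.val * P⁻¹).val.map (conjA F) =
      D.J.map (toAdele F)
    rw [Units.val_mul, Units.val_mul, Matrix.map_mul, Matrix.map_mul, Matrix.transpose_mul,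
      Matrix.transpose_mul]
    calc _ = ((P⁻¹ : GL (Fin n) (AdeleF F)).val)ᵀ * ((g.val.val)ᵀ *
          ((P.val)ᵀ * D.J.map (toAdele F) * P.val.map (conjA F)) * g.val.val.map (conjA F)) *
          (P⁻¹ : GL (Fin n) (AdeleF F)).val.map (conjA F) := by simp only [Matrix.mul_assoc]
      _ = (((P⁻¹ : GL (Fin n) (AdeleF F)).val)ᵀ * (P.val)ᵀ) * D.J.map (toAdele F) *
          (P.val.map (conjA F) * (P⁻¹ : GL (Fin n) (AdeleF F)).val.map (conjA F)) := by
        rw [h2, h1, ← h2]; simp only [Matrix.mul_assoc]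
      _ = _ := by rw [h3, h4, Matrix.one_mul, Matrix.mul_one]⟩
  map_one' := by
    apply Subtype.ext
    simp
  map_mul' a b := by
    apply Subtype.ext
    simp [mul_assoc]

theorem toGA_vecA (γ : D.GQ) (u : Fin n → F) :
    (D.toGA γ).val.val *ᵥ D.vecA u = D.vecA (γ.val.val *ᵥ u) := by
  change (D.iso.val * γ.val.val.map (toAdele F) * (D.iso⁻¹ : GL (Fin n) (AdeleF F)).val) *ᵥ
    (D.iso.val *ᵥ _) = D.iso.val *ᵥ _
  rw [Matrix.mulVec_mulVec, Matrix.mul_assoc, ← Units.val_mul, inv_mul_cancel, Units.val_one,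
    Matrix.mul_one, ← Matrix.mulVec_mulVec]
  congr 1
  funext i
  simp [Matrix.mulVec, dotProduct, map_sum, map_mul]

/-- The action of `G'(F₀)` on the negative lines of `V' ⊗_{F,w} ℂ`. -/
def actLine (w : F →+* ℂ) (γ : D.GQ) (z : NegLine (D.J'.map w)) : NegLine (D.J'.map w) :=
  UGroup.map w (embedding_conj F w) D.J' γ • z

theorem RFun_actLine (w : F →+* ℂ) (γ : D.GQ) (u : Fin n → F) (z : NegLine (D.J'.map w)) :
    RFun (fun i => w ((γ.val.val *ᵥ u) i)) (D.actLine w γ z) = RFun (fun i => w (u i)) z := by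
  rw [actLine, ← RFun_smul (UGroup.map w (embedding_conj F w) D.J' γ) (fun i => w (u i)) z]
  congr 1
  funext i
  change w ((γ.val.val *ᵥ u) i) = (γ.val.val.map w *ᵥ fun i => w (u i)) i
  simp [Matrix.mulVec, dotProduct, map_sum, map_mul]

/-! ### Test functions -/

/-- `ℝ`-valued Schwartz functions on `G(𝔸_{0,f})` that are bi-invariant under `K`. -/
structure HeckeFun (K : Subgroup D.GA) where
  /-- the function -/
  toFun : D.GA → ℝ
  locConst : IsLocallyConstant toFun
  compactSupp : HasCompactSupport toFun
  biinv : ∀ k₁ ∈ K, ∀ k₂ ∈ K, ∀ g, toFun (k₁ * g * k₂) = toFun g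

/-- `ℝ`-valued Schwartz functions on `V(𝔸_{0,f})` that are invariant under `K`. -/
structure VecFun (K : Subgroup D.GA) where
  /-- the function -/
  toFun : (Fin n → AdeleF F) → ℝ
  locConst : IsLocallyConstant toFun
  compactSupp : HasCompactSupport toFun
  inv : ∀ k ∈ K, ∀ x, toFun (k.val.val *ᵥ x) = toFun x

/-! ### The complex points of the Shimura variety -/

/-- The product `𝒟 × Z^ℚ(𝔸_f)/K_Z × G(𝔸_{0,f})/K_G`, where `𝒟` is the space of negative lines of
`V' ⊗_{F,w} ℂ`. -/
@[ext]
structure Cover (w : F →+* ℂ) (KZ : Subgroup (ZA F)) (KG : Subgroup D.GA) where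
  /-- the component in `𝒟` -/
  line : NegLine (D.J'.map w)
  /-- the component in `Z^ℚ(𝔸_f)/K_Z` -/
  zc : ZA F ⧸ KZ
  /-- the component in `G(𝔸_{0,f})/K_G` -/
  gc : D.GA ⧸ KG

variable {D} {w : F →+* ℂ} {KZ : Subgroup (ZA F)} {KG : Subgroup D.GA}

/-- The action of `Z^ℚ(ℚ) × G'(F₀)` on the product. -/
instance : MulAction (ZQ F × D.GQ) (D.Cover w KZ KG) where
  smul p x := ⟨D.actLine w p.2 x.line, ZQ.toAdelic F p.1 • x.zc, D.toGA p.2 • x.gc⟩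
  one_smul x := by
    change Cover.mk _ _ _ = _
    ext1
    · change UGroup.map w (embedding_conj F w) D.J' 1 • x.line = x.line
      rw [map_one, one_smul]
    · change ZQ.toAdelic F 1 • x.zc = x.zc
      rw [map_one, one_smul]
    · change D.toGA 1 • x.gc = x.gc
      rw [map_one, one_smul]
  mul_smul p q x := by
    change Cover.mk _ _ _ = Cover.mk _ _ _
    ext1
    · change UGroup.map w (embedding_conj F w) D.J' (p.2 * q.2) • x.line = _ • _ • x.line
      rw [map_mul, mul_smul]
    · change ZQ.toAdelic F (p.1 * q.1) • x.zc = _ • _ • x.zc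
      rw [map_mul, mul_smul]
    · change D.toGA (p.2 * q.2) • x.gc = _ • _ • x.gc
      rw [map_mul, mul_smul]

variable (D w KZ KG)

/-- The complex points of the Shimura variety of `Z^ℚ × Res G` of level `K_Z × K_G`, at a complex
place inducing the embedding `w` of `F`:
`(Z^ℚ(ℚ) × G'(F₀)) \ (𝒟 × Z^ℚ(𝔸_f)/K_Z × G(𝔸_{0,f})/K_G)`. -/
abbrev ShPoints : Type _ := MulAction.orbitRel.Quotient (ZQ F × D.GQ) (D.Cover w KZ KG)

/-- `τ(Z^ℚ)`, the cardinality of `Z^ℚ(ℚ) \ Z^ℚ(𝔸_f) / K_Z`. -/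
def tau (KZ : Subgroup (ZA F)) : ℕ :=
  Nat.card (DoubleCoset.Quotient ((ZQ.toAdelic F).range : Set (ZA F)) (KZ : Set (ZA F)))

/-! ### Kudla's Green function -/

/-- The vectors of `V'(F₀)` of norm `ξ`. -/
abbrev VecNorm (ξ : maximalRealSubfield F) : Type _ :=
  {u : Fin n → F // herm (conjF F) D.J' u u = ξ}

end HermPair

/-- The exponential integral `Ei(x) = - ∫_{-x}^∞ e^{-t}/t dt` for `x < 0`. -/
def Ei (x : ℝ) : ℝ := -∫ t in Set.Ioi (-x), Real.exp (-t) / t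

/-- The number `a > 0` in the Iwasawa decomposition `h = (1 b; 0 1) diag(√a, 1/√a) κ` of
`h ∈ SL₂(ℝ)`, `κ ∈ SO(2)`, see `iwasawaA_eq`. -/
def iwasawaA (h : SL(2, ℝ)) : ℝ := ((h 1 0) ^ 2 + (h 1 1) ^ 2)⁻¹

theorem iwasawaA_eq (h : SL(2, ℝ)) (a b θ : ℝ) (ha : 0 < a)
    (hh : (h : Matrix (Fin 2) (Fin 2) ℝ) = !![1, b; 0, 1] * !![√a, 0; 0, (√a)⁻¹] *
      !![Real.cos θ, Real.sin θ; -Real.sin θ, Real.cos θ]) : iwasawaA h = a := by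
  have h0 : h 1 0 = -(√a)⁻¹ * Real.sin θ := by
    rw [hh]; simp [Matrix.mul_apply, Fin.sum_univ_two]
  have h1 : h 1 1 = (√a)⁻¹ * Real.cos θ := by
    rw [hh]; simp [Matrix.mul_apply, Fin.sum_univ_two]
  have h2 : ((√a)⁻¹) ^ 2 = a⁻¹ := by rw [inv_pow, Real.sq_sqrt ha.le]
  rw [iwasawaA, h0, h1]
  have : (-(√a)⁻¹ * Real.sin θ) ^ 2 + ((√a)⁻¹ * Real.cos θ) ^ 2 = a⁻¹ := by
    rw [← h2]; linear_combination ((√a)⁻¹) ^ 2 * Real.sin_sq_add_cos_sq θ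
  rw [this, inv_inv]

namespace HermPair

variable (D : HermPair F n) (w : F →+* ℂ) (KZ : Subgroup (ZA F)) (KG : Subgroup D.GA)

/-- Kudla's Green function `𝒢^K(u, h_∞)(z) = -Ei(2π a R(u, z))` of a nonzero vector `u ∈ V'(F₀)`. -/
def kudlaGreen (a : ℝ) (u : Fin n → F) (z : NegLine (D.J'.map w)) : ℝ :=
  -Ei (2 * Real.pi * a * RFun (fun i => w (u i)) z)

variable {KG}

/-- The value `φ(h⁻¹ x)`, which depends only on the coset `h K`. -/
def VecFun.atCoset {D : HermPair F n} {KG : Subgroup D.GA} (φ : D.VecFun KG) (x : Fin n → AdeleF F) :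
    D.GA ⧸ KG → ℝ :=
  Quotient.lift (fun h : D.GA => φ.toFun ((h⁻¹).val.val *ᵥ x)) (by
    intro a b hab
    have hk : a⁻¹ * b ∈ KG := QuotientGroup.leftRel_apply.1 hab
    have hmul : (a⁻¹).val.val *ᵥ x = (a⁻¹ * b).val.val *ᵥ ((b⁻¹).val.val *ᵥ x) := by
      rw [Matrix.mulVec_mulVec]
      congr 1
      change (a⁻¹).val.val = ((a⁻¹ * b).val * (b⁻¹).val).val
      rw [← Subgroup.coe_mul, mul_assoc, mul_inv_cancel, mul_one]
    change φ.toFun ((a⁻¹).val.val *ᵥ x) = φ.toFun ((b⁻¹).val.val *ᵥ x)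
    rw [hmul, φ.inv _ hk])

/-- The value `φ₀(h⁻¹ g h)`, which depends only on the coset `h K`. -/
def HeckeFun.atCoset {D : HermPair F n} {KG : Subgroup D.GA} (φ₀ : D.HeckeFun KG) (g : D.GA) :
    D.GA ⧸ KG → ℝ :=
  Quotient.lift (fun h : D.GA => φ₀.toFun (h⁻¹ * g * h)) (by
    intro a b hab
    have hk : a⁻¹ * b ∈ KG := QuotientGroup.leftRel_apply.1 hab
    have : a⁻¹ * g * a = (a⁻¹ * b) * (b⁻¹ * g * b) * (a⁻¹ * b)⁻¹ := by group
    change φ₀.toFun (a⁻¹ * g * a) = φ₀.toFun (b⁻¹ * g * b)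
    rw [this, φ₀.biinv _ hk _ (KG.inv_mem hk)])

theorem VecFun.atCoset_smul {D : HermPair F n} {KG : Subgroup D.GA} (φ : D.VecFun KG) (γ : D.GA)
    (x : Fin n → AdeleF F) (q : D.GA ⧸ KG) :
    φ.atCoset (γ.val.val *ᵥ x) (γ • q) = φ.atCoset x q := by
  induction q using QuotientGroup.induction_on with
  | H h =>
    change φ.toFun (((γ * h)⁻¹).val.val *ᵥ (γ.val.val *ᵥ x)) = φ.toFun ((h⁻¹).val.val *ᵥ x)
    rw [Matrix.mulVec_mulVec]
    congr 2
    change (((γ * h)⁻¹).val * γ.val).val = (h⁻¹).val.val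
    rw [← Subgroup.coe_mul, mul_inv_rev, mul_assoc, inv_mul_cancel, mul_one]

theorem HeckeFun.atCoset_smul {D : HermPair F n} {KG : Subgroup D.GA} (φ₀ : D.HeckeFun KG)
    (γ g : D.GA) (q : D.GA ⧸ KG) :
    φ₀.atCoset (γ * g * γ⁻¹) (γ • q) = φ₀.atCoset g q := by
  induction q using QuotientGroup.induction_on with
  | H h =>
    change φ₀.toFun ((γ * h)⁻¹ * (γ * g * γ⁻¹) * (γ * h)) = φ₀.toFun (h⁻¹ * g * h)
    congr 1
    group

/-- The `u`-term of the Green function `𝒢^K(ξ, h_∞, φ)` at a point of the cover. -/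
def greenTerm {D : HermPair F n} {w : F →+* ℂ} {KZ : Subgroup (ZA F)} {KG : Subgroup D.GA}
    (φ : D.VecFun KG) (a : ℝ) (x : D.Cover w KZ KG) (u : Fin n → F) : ℝ :=
  φ.atCoset (D.vecA u) x.gc * D.kudlaGreen w a u x.line

/-- The Green function `𝒢^K(ξ, h_∞, φ)` on the cover: its value at `(z, z', g K_G)` is
`∑_{u ∈ V'_ξ(F₀)} φ(g⁻¹ u) 𝒢^K(u, h_∞)(z)`. -/
def greenCover {D : HermPair F n} {w : F →+* ℂ} {KZ : Subgroup (ZA F)} {KG : Subgroup D.GA}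
    (φ : D.VecFun KG) (a : ℝ) (ξ : maximalRealSubfield F) (x : D.Cover w KZ KG) : ℝ :=
  ∑' u : D.VecNorm ξ, greenTerm φ a x u.1

theorem greenTerm_smul {D : HermPair F n} {w : F →+* ℂ} {KZ : Subgroup (ZA F)}
    {KG : Subgroup D.GA} (φ : D.VecFun KG) (a : ℝ) (p : ZQ F × D.GQ) (x : D.Cover w KZ KG)
    (u : Fin n → F) : greenTerm φ a (p • x) (p.2.val.val *ᵥ u) = greenTerm φ a x u := by
  change φ.atCoset (D.vecA (p.2.val.val *ᵥ u)) (D.toGA p.2 • x.gc) *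
    -Ei (2 * Real.pi * a * RFun (fun i => w ((p.2.val.val *ᵥ u) i)) (D.actLine w p.2 x.line)) = _
  rw [← toGA_vecA, VecFun.atCoset_smul, RFun_actLine]
  rfl

/-- The action of `G'(F₀)` on `V'_ξ(F₀)`, as a permutation. -/
def vecPerm (D : HermPair F n) (γ : D.GQ) (ξ : maximalRealSubfield F) :
    D.VecNorm ξ ≃ D.VecNorm ξ where
  toFun u := ⟨γ.val.val *ᵥ u.1, by rw [herm_unitary]; exact u.2⟩
  invFun u := ⟨(γ⁻¹).val.val *ᵥ u.1, by rw [herm_unitary]; exact u.2⟩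
  left_inv u := by
    apply Subtype.ext
    change (γ⁻¹).val.val *ᵥ (γ.val.val *ᵥ u.1) = u.1
    rw [Matrix.mulVec_mulVec]
    change ((γ⁻¹ * γ).val.val) *ᵥ u.1 = u.1
    simp
  right_inv u := by
    apply Subtype.ext
    change γ.val.val *ᵥ ((γ⁻¹).val.val *ᵥ u.1) = u.1
    rw [Matrix.mulVec_mulVec]
    change ((γ * γ⁻¹).val.val) *ᵥ u.1 = u.1
    simp

theorem greenCover_smul {D : HermPair F n} {w : F →+* ℂ} {KZ : Subgroup (ZA F)}
    {KG : Subgroup D.GA} (φ : D.VecFun KG) (a : ℝ) (ξ : maximalRealSubfield F)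
    (p : ZQ F × D.GQ) (x : D.Cover w KZ KG) :
    greenCover φ a ξ (p • x) = greenCover φ a ξ x := by
  unfold greenCover
  rw [← (D.vecPerm p.2 ξ).tsum_eq]
  exact tsum_congr fun u => greenTerm_smul φ a p x u.1

/-- The Green function `𝒢^K(ξ, h_∞, φ)` on the complex points of the Shimura variety. -/
def green {D : HermPair F n} {w : F →+* ℂ} {KZ : Subgroup (ZA F)} {KG : Subgroup D.GA}
    (φ : D.VecFun KG) (a : ℝ) (ξ : maximalRealSubfield F) : D.ShPoints w KZ KG → ℝ :=
  Quotient.lift (greenCover φ a ξ) (by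
    rintro x y ⟨p, rfl⟩
    exact greenCover_smul φ a ξ p y)

/-! ### The complex points of the CM cycle -/

/-- The points `(x, δ)` of the cover of the fixed point loci of the Hecke correspondences: `x` is a
point of the cover of the Shimura variety and `δ ∈ G'(F₀)`, with characteristic polynomial `α`,
fixes the line of `x`. If `x = (z, z', h K_G)`, the pair belongs to the Hecke correspondence of the
double coset of `h⁻¹ δ h`. -/
@[ext]
structure CMCover (D : HermPair F n) (w : F →+* ℂ) (KZ : Subgroup (ZA F)) (KG : Subgroup D.GA)
    (α : Polynomial F) where
  /-- the automorphism -/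
  δ : D.GQ
  /-- the point of the cover of the Shimura variety -/
  pt : D.Cover w KZ KG
  charpoly_eq : δ.val.val.charpoly = α
  fixed : D.actLine w δ pt.line = pt.line

/-- The action of `Z^ℚ(ℚ) × G'(F₀)`, by conjugation on `δ`. -/
instance {D : HermPair F n} {w : F →+* ℂ} {KZ : Subgroup (ZA F)} {KG : Subgroup D.GA}
    {α : Polynomial F} : MulAction (ZQ F × D.GQ) (D.CMCover w KZ KG α) where
  smul p x :=
    { δ := p.2 * x.δ * p.2⁻¹
      pt := p • x.pt
      charpoly_eq := by
        have h := (Matrix.charpoly_units_conj p.2.val x.δ.val.val).trans x.charpoly_eq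
        rw [← Matrix.coe_units_inv] at h
        exact h
      fixed := by
        have h := x.fixed
        change UGroup.map w (embedding_conj F w) D.J' (p.2 * x.δ * p.2⁻¹) •
          UGroup.map w (embedding_conj F w) D.J' p.2 • x.pt.line =
          UGroup.map w (embedding_conj F w) D.J' p.2 • x.pt.line
        change UGroup.map w (embedding_conj F w) D.J' x.δ • x.pt.line = x.pt.line at h
        rw [← mul_smul, ← map_mul, inv_mul_cancel_right, map_mul, mul_smul, h] }
  one_smul x := by
    apply CMCover.ext
    · change (1 : D.GQ) * x.δ * (1 : D.GQ)⁻¹ = x.δ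
      group
    · exact one_smul _ x.pt
  mul_smul p q x := by
    apply CMCover.ext
    · change (p.2 * q.2) * x.δ * (p.2 * q.2)⁻¹ = p.2 * (q.2 * x.δ * q.2⁻¹) * p.2⁻¹
      group
    · exact mul_smul p q x.pt

/-- The complex points of the CM cycle attached to `α`. -/
abbrev CMPoints (D : HermPair F n) (w : F →+* ℂ) (KZ : Subgroup (ZA F)) (KG : Subgroup D.GA)
    (α : Polynomial F) : Type _ :=
  MulAction.orbitRel.Quotient (ZQ F × D.GQ) (D.CMCover w KZ KG α)

/-- The natural map from the CM cycle to the Shimura variety. -/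
def CMPoints.toSh {D : HermPair F n} {w : F →+* ℂ} {KZ : Subgroup (ZA F)} {KG : Subgroup D.GA}
    {α : Polynomial F} : D.CMPoints w KZ KG α → D.ShPoints w KZ KG :=
  Quotient.lift (fun x => (⟦x.pt⟧ : Quotient (MulAction.orbitRel (ZQ F × D.GQ) _))) (by
    rintro x y ⟨p, rfl⟩
    exact Quotient.sound ⟨p, rfl⟩)

/-- The multiplicity in the weighted CM cycle `CM(α, φ₀) = ∑_g φ₀(g) CM(α, g)`
(`g ∈ K_G \ G(𝔸_{0,f}) / K_G`) of a point represented by `δ` and `(z, z', h K_G)`: this is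
`φ₀(h⁻¹ δ h)`, since the point lies on `CM(α, g)` for the double coset of `g = h⁻¹ δ h`. -/
def CMPoints.mult {D : HermPair F n} {w : F →+* ℂ} {KZ : Subgroup (ZA F)} {KG : Subgroup D.GA}
    {α : Polynomial F} (φ₀ : D.HeckeFun KG) : D.CMPoints w KZ KG α → ℝ :=
  Quotient.lift (fun x => φ₀.atCoset (D.toGA x.δ) x.pt.gc) (by
    rintro x y ⟨p, rfl⟩
    change φ₀.atCoset (D.toGA (p.2 * y.δ * p.2⁻¹)) (D.toGA p.2 • y.pt.gc) = _
    rw [map_mul, map_mul, map_inv, HeckeFun.atCoset_smul])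

/-! ### The refined invariant -/

section Refined

variable (α : Polynomial F) [Fact (Irreducible α)]

instance adjoinRoot_charZero : CharZero (AdjoinRoot α) :=
  charZero_of_injective_algebraMap (algebraMap F (AdjoinRoot α)).injective

instance adjoinRoot_finite : Module.Finite F (AdjoinRoot α) :=
  (AdjoinRoot.powerBasis (Fact.out : Irreducible α).ne_zero).finite

instance adjoinRoot_numberField : NumberField (AdjoinRoot α) where
  to_charZero := inferInstance
  to_finiteDimensional := Module.Finite.trans F (AdjoinRoot α)

/-- The inclusion `F₀ → F₀'` of the maximal totally real subfields of `F` and `F' = F[T]/(α)`. -/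
def realMap : maximalRealSubfield F →+* maximalRealSubfield (AdjoinRoot α) :=
  ((algebraMap F (AdjoinRoot α)).comp (maximalRealSubfield F).subtype).codRestrict _ (by
    intro x φ
    exact x.2 (φ.comp (algebraMap F (AdjoinRoot α))))

/-- The trace of `F₀' / F₀`. -/
def traceReal (x : maximalRealSubfield (AdjoinRoot α)) : maximalRealSubfield F :=
  letI := (realMap α).toAlgebra
  Algebra.trace (maximalRealSubfield F) (maximalRealSubfield (AdjoinRoot α)) x

variable {α}

/-- The action of `F' = F[T]/(α)` on `V'` for which `T` acts by `δ`, where `δ` has characteristic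
polynomial `α`. -/
def actF' (D : HermPair F n) (δ : D.GQ) (h : δ.val.val.charpoly = α) :
    AdjoinRoot α →+* Matrix (Fin n) (Fin n) F :=
  Ideal.Quotient.lift (Ideal.span {α}) (Polynomial.aeval δ.val.val).toRingHom (by
    intro a ha
    obtain ⟨b, rfl⟩ := Ideal.mem_span_singleton.1 ha
    change Polynomial.aeval δ.val.val (α * b) = 0
    rw [map_mul, ← h, Matrix.aeval_self_charpoly, zero_mul])

theorem actF'_root (D : HermPair F n) (δ : D.GQ) (h : δ.val.val.charpoly = α) :
    D.actF' δ h (AdjoinRoot.root α) = δ.val.val := by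
  change Polynomial.aeval δ.val.val Polynomial.X = _
  simp

theorem actF'_algebraMap (D : HermPair F n) (δ : D.GQ) (h : δ.val.val.charpoly = α) (c : F) :
    D.actF' δ h (algebraMap F _ c) = algebraMap F _ c := by
  change Polynomial.aeval δ.val.val (Polynomial.C c) = _
  simp

/-- The linear form `a ↦ ⟨a x, y⟩` on `F'`. -/
def pairF' (D : HermPair F n) (δ : D.GQ) (h : δ.val.val.charpoly = α) (x y : Fin n → F) :
    Module.Dual F (AdjoinRoot α) where
  toFun a := herm (conjF F) D.J' (D.actF' δ h a *ᵥ x) y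
  map_add' a b := by
    simp only [herm, map_add, Matrix.add_mulVec, add_dotProduct]
  map_smul' c a := by
    rw [Algebra.smul_def, map_mul, actF'_algebraMap, ← Algebra.smul_def, Matrix.smul_mulVec]
    simp only [herm, smul_dotProduct, RingHom.id_apply]

/-- The `F'`-hermitian form `⟨x, y⟩'` on `V'` with `tr_{F'/F} (a ⟨x, y⟩') = ⟨a x, y⟩` for all
`a ∈ F'`. -/
def refinedForm (D : HermPair F n) (δ : D.GQ) (h : δ.val.val.charpoly = α) (x y : Fin n → F) :
    AdjoinRoot α :=
  ((Algebra.traceForm F (AdjoinRoot α)).toDual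
    (traceForm_nondegenerate F (AdjoinRoot α))).symm (D.pairF' δ h x y)

theorem trace_mul_refinedForm (D : HermPair F n) (δ : D.GQ) (h : δ.val.val.charpoly = α)
    (x y : Fin n → F) (a : AdjoinRoot α) :
    Algebra.trace F (AdjoinRoot α) (a * D.refinedForm δ h x y) =
      herm (conjF F) D.J' (D.actF' δ h a *ᵥ x) y := by
  rw [mul_comm]
  exact LinearMap.BilinForm.apply_toDual_symm_apply
    (hB := traceForm_nondegenerate F (AdjoinRoot α)) (D.pairF' δ h x y) a

variable [IsCMField (AdjoinRoot α)]

theorem conj_algebraMap (x : F) : conjF (AdjoinRoot α) (algebraMap F _ x) =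
    algebraMap F (AdjoinRoot α) (conjF F x) := by
  obtain ⟨w⟩ : Nonempty (AdjoinRoot α →+* ℂ) := inferInstance
  apply w.injective
  rw [embedding_conj]
  exact (embedding_conj F (w.comp (algebraMap F _)) x).symm

theorem trace_conj (x : AdjoinRoot α) : Algebra.trace F (AdjoinRoot α) (conjF (AdjoinRoot α) x) =
    conjF F (Algebra.trace F (AdjoinRoot α) x) := by
  have := Algebra.trace_eq_of_equiv_equiv (IsCMField.complexConj F).toRingEquiv
    (IsCMField.complexConj (AdjoinRoot α)).toRingEquiv (by
      ext y
      exact (conj_algebraMap (α := α) y).symm) x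
  rw [this]
  exact ((IsCMField.complexConj F).toRingEquiv.apply_symm_apply _).symm

theorem herm_conj (D : HermPair F n) (x y : Fin n → F) :
    conjF F (herm (conjF F) D.J' x y) = herm (conjF F) D.J' y x := by
  have hcc : ∀ a : F, conjF F (conjF F a) = a := IsCMField.complexConj_apply_apply F
  have hJ : ∀ i j, conjF F (D.J' i j) = D.J' j i := fun i j =>
    (congrFun (congrFun D.herm_J' i) j).symm
  simp only [herm, Matrix.mulVec, dotProduct, map_sum, map_mul, hcc, hJ, Finset.mul_sum]
  rw [Finset.sum_comm]
  exact Finset.sum_congr rfl fun i _ => Finset.sum_congr rfl fun j _ => by ring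

theorem herm_actF' (D : HermPair F n) (δ : D.GQ) (h : δ.val.val.charpoly = α)
    (hroot : conjF (AdjoinRoot α) (AdjoinRoot.root α) = (AdjoinRoot.root α)⁻¹)
    (a : AdjoinRoot α) (x y : Fin n → F) :
    herm (conjF F) D.J' (D.actF' δ h (conjF _ a) *ᵥ x) y =
      herm (conjF F) D.J' x (D.actF' δ h a *ᵥ y) := by
  have hadd : ∀ a b x y,
      herm (conjF F) D.J' (D.actF' δ h (conjF _ a) *ᵥ x) y =
        herm (conjF F) D.J' x (D.actF' δ h a *ᵥ y) →
      herm (conjF F) D.J' (D.actF' δ h (conjF _ b) *ᵥ x) y =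
        herm (conjF F) D.J' x (D.actF' δ h b *ᵥ y) →
      herm (conjF F) D.J' (D.actF' δ h (conjF _ (a + b)) *ᵥ x) y =
        herm (conjF F) D.J' x (D.actF' δ h (a + b) *ᵥ y) := by
    intro a b x y ha hb
    have e : ∀ v w : Fin n → F, herm (conjF F) D.J' x (v + w) =
        herm (conjF F) D.J' x v + herm (conjF F) D.J' x w := by
      intro v w
      have : (fun i => conjF F ((v + w) i)) = (fun i => conjF F (v i)) + fun i => conjF F (w i) := by
        funext i; simp
      rw [herm, this, Matrix.mulVec_add, dotProduct_add]
      rfl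
    rw [map_add, map_add, map_add, Matrix.add_mulVec, Matrix.add_mulVec, e, ← ha, ← hb]
    simp only [herm, add_dotProduct]
  have hpow : ∀ (k : ℕ) (c : F) (x y : Fin n → F),
      herm (conjF F) D.J' (D.actF' δ h (conjF _ (AdjoinRoot.root α ^ k * algebraMap F _ c)) *ᵥ x) y =
        herm (conjF F) D.J' x (D.actF' δ h (AdjoinRoot.root α ^ k * algebraMap F _ c) *ᵥ y) := by
    intro k
    induction k with
    | zero =>
      intro c x y
      have e : (fun i => conjF F ((c • y) i)) = conjF F c • fun i => conjF F (y i) := by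
        funext i; simp
      rw [pow_zero, one_mul, conj_algebraMap, actF'_algebraMap, actF'_algebraMap,
        Algebra.algebraMap_eq_smul_one, Algebra.algebraMap_eq_smul_one, Matrix.smul_mulVec,
        Matrix.smul_mulVec, Matrix.one_mulVec, Matrix.one_mulVec, herm, herm, e,
        Matrix.mulVec_smul, smul_dotProduct, dotProduct_smul]
    | succ k ih =>
      intro c x y
      have hr0 : AdjoinRoot.root α ≠ 0 := by
        intro h0
        have h1 := D.actF'_root δ h
        rw [h0, map_zero] at h1
        have h2 : Subsingleton (AdjoinRoot α) := by
          have hn : IsEmpty (Fin n) := by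
            by_contra hne
            rw [not_isEmpty_iff] at hne
            exact δ.val.ne_zero h1.symm
          have h3 : α = 1 := by rw [← h, Matrix.charpoly_isEmpty]
          exact absurd (Fact.out : Irreducible α) (h3 ▸ not_irreducible_one)
        exact absurd (Subsingleton.elim (0 : AdjoinRoot α) 1) zero_ne_one
      have key : ∀ v : Fin n → F,
          herm (conjF F) D.J' (D.actF' δ h (AdjoinRoot.root α)⁻¹ *ᵥ v) y =
            herm (conjF F) D.J' v (δ.val.val *ᵥ y) := by
        intro v
        rw [← herm_unitary δ (D.actF' δ h _ *ᵥ v) y, Matrix.mulVec_mulVec]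
        nth_rw 1 [← D.actF'_root δ h]
        rw [← map_mul, mul_inv_cancel₀ hr0, map_one, Matrix.one_mulVec]
      rw [pow_succ', mul_assoc, map_mul (conjF _) (AdjoinRoot.root α), hroot,
        map_mul (D.actF' δ h) (AdjoinRoot.root α)⁻¹, ← Matrix.mulVec_mulVec, key, ih,
        mul_comm (AdjoinRoot.root α), map_mul (D.actF' δ h) _ (AdjoinRoot.root α),
        ← Matrix.mulVec_mulVec, actF'_root]
  induction a using AdjoinRoot.induction_on with
  | ih p =>
    induction p using Polynomial.induction_on' generalizing x y with
    | add p q hp hq => 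
      rw [map_add]
      exact hadd _ _ _ _ (hp x y) (hq x y)
    | monomial k c =>
      rw [← Polynomial.C_mul_X_pow_eq_monomial, mul_comm, map_mul, map_pow]
      exact hpow k c x y

theorem refinedForm_self_mem (D : HermPair F n) (δ : D.GQ) (h : δ.val.val.charpoly = α)
    (hroot : conjF (AdjoinRoot α) (AdjoinRoot.root α) = (AdjoinRoot.root α)⁻¹) (u : Fin n → F) :
    D.refinedForm δ h u u ∈ maximalRealSubfield (AdjoinRoot α) := by
  rw [← IsCMField.complexConj_eq_self_iff]
  change conjF (AdjoinRoot α) _ = _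
  have hcc : ∀ a : AdjoinRoot α, conjF _ (conjF _ a) = a :=
    IsCMField.complexConj_apply_apply (AdjoinRoot α)
  apply ((Algebra.traceForm F (AdjoinRoot α)).toDual
    (traceForm_nondegenerate F (AdjoinRoot α))).injective
  ext a
  change Algebra.trace F (AdjoinRoot α) (conjF _ _ * a) = Algebra.trace F (AdjoinRoot α) (_ * a)
  rw [mul_comm _ a, mul_comm _ a, trace_mul_refinedForm]
  nth_rw 1 [← hcc a]
  rw [← map_mul, trace_conj, trace_mul_refinedForm, herm_actF' D δ h hroot, herm_conj]

/-- The refined invariant `ξ' = 𝔮'(u) = ⟨u, u⟩'`, an element of `F₀'`. -/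
def refinedInv (D : HermPair F n) (δ : D.GQ) (h : δ.val.val.charpoly = α)
    (hroot : conjF (AdjoinRoot α) (AdjoinRoot.root α) = (AdjoinRoot.root α)⁻¹) (u : Fin n → F) :
    maximalRealSubfield (AdjoinRoot α) :=
  ⟨D.refinedForm δ h u u, D.refinedForm_self_mem δ h hroot u⟩

end Refined

/-! ### Orbits and orbital integrals -/

section Orbits

/-- The set `(G'(α) × V'_ξ)(F₀)` of pairs `(δ, u)` with `δ ∈ G'(F₀)` of characteristic polynomial
`α` and `u ∈ V'(F₀)` of norm `⟨u, u⟩ = ξ`. -/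
@[ext]
structure Pair (D : HermPair F n) (α : Polynomial F) (ξ : maximalRealSubfield F) where
  /-- the group element -/
  δ : D.GQ
  /-- the vector -/
  u : Fin n → F
  charpoly_eq : δ.val.val.charpoly = α
  norm_eq : herm (conjF F) D.J' u u = ξ

/-- The action `γ (δ, u) = (γ δ γ⁻¹, γ u)` of `G'(F₀)`. -/
instance {D : HermPair F n} {α : Polynomial F} {ξ : maximalRealSubfield F} :
    MulAction D.GQ (D.Pair α ξ) where
  smul γ x :=
    { δ := γ * x.δ * γ⁻¹
      u := γ.val.val *ᵥ x.u
      charpoly_eq := by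
        have h := (Matrix.charpoly_units_conj γ.val x.δ.val.val).trans x.charpoly_eq
        rw [← Matrix.coe_units_inv] at h
        exact h
      norm_eq := by rw [herm_unitary]; exact x.norm_eq }
  one_smul x := by
    apply Pair.ext
    · change (1 : D.GQ) * x.δ * (1 : D.GQ)⁻¹ = x.δ
      group
    · exact Matrix.one_mulVec x.u
  mul_smul p q x := by
    apply Pair.ext
    · change (p * q) * x.δ * (p * q)⁻¹ = p * (q * x.δ * q⁻¹) * p⁻¹
      group
    · exact (Matrix.mulVec_mulVec x.u p.val.val q.val.val).symm

/-- The set `[(G'(α) × V'_ξ)(F₀)]` of `G'(F₀)`-orbits. -/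
abbrev PairOrbits (D : HermPair F n) (α : Polynomial F) (ξ : maximalRealSubfield F) : Type _ :=
  MulAction.orbitRel.Quotient D.GQ (D.Pair α ξ)

/-- `Φ(h⁻¹ (δ, u)) = φ₀(h⁻¹ δ h) φ(h⁻¹ u)` for `Φ = φ₀ ⊗ φ`. -/
def orbIntegrand {D : HermPair F n} {KG : Subgroup D.GA} {α : Polynomial F}
    {ξ : maximalRealSubfield F} (f₀ : D.HeckeFun KG) (f : D.VecFun KG) (x : D.Pair α ξ)
    (h : D.GA) : ℝ :=
  f₀.toFun (h⁻¹ * D.toGA x.δ * h) * f.toFun ((h⁻¹).val.val *ᵥ D.vecA x.u)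

/-- The orbital integral `Orb((δ, u), Φ)` of `Φ = φ₀ ⊗ φ` over `G(𝔸_{0,f})`. -/
def orb {D : HermPair F n} {KG : Subgroup D.GA} {α : Polynomial F} {ξ : maximalRealSubfield F}
    [MeasurableSpace D.GA] (μ : Measure D.GA) (f₀ : D.HeckeFun KG) (f : D.VecFun KG)
    (x : D.Pair α ξ) : ℝ :=
  ∫ h, orbIntegrand f₀ f x h ∂μ

end Orbits

/-! ### The local intersection numbers -/

section Intersection

/-- The sum of the values of the Green function `𝒢^K(ξ, h_∞, φ)` at the complex points of the CM
cycle `CM(α, φ₀)`, counted with multiplicity. -/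
def greenSum {D : HermPair F n} (w : F →+* ℂ) (KZ : Subgroup (ZA F)) {KG : Subgroup D.GA}
    (α : Polynomial F) (ξ : maximalRealSubfield F) (a : ℝ) (f₀ : D.HeckeFun KG)
    (f : D.VecFun KG) : ℝ :=
  ∑' P : D.CMPoints w KZ KG α, P.mult f₀ * green f a ξ P.toSh

variable {Φ : Set (F →+* QBar)} {φ₀ : F →+* QBar}

/-- `Int_ν^♮(ξ, Φ) = ⟨𝒢^K(ξ, φ), CM(α, φ₀)⟩ · log q_ν` at an archimedean place `ν` of `E`, with
`log q_ν = 2` if `ν` is complex and `1` if `ν` is real. The pairing of a Green function `g`,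
normalized by `g ∼ -log |f|²` along a divisor with local equation `f`, with a zero-cycle `∑ m_P P` is
`½ ∑ m_P g(P)`, as in the archimedean part of the arithmetic degree. -/
def intNatural (hn : 0 < n) (hΦ : IsCMType Φ) (h₀ : φ₀ ∈ Φ) {D : HermPair F n}
    (KZ : Subgroup (ZA F)) {KG : Subgroup D.GA} (α : Polynomial F) (ξ : maximalRealSubfield F)
    (a : ℝ) (f₀ : D.HeckeFun KG) (f : D.VecFun KG) (ν : InfinitePlace (reflexE n Φ φ₀)) : ℝ :=
  (1 / 2 * greenSum (ν.embedding.comp (toReflex hn hΦ h₀)) KZ α ξ a f₀ f) * ν.mult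

/-- `Int_{v₀}^K(ξ, Φ) = 1 / (τ(Z^ℚ) [E : F]) ∑_{ν ∣ v₀} Int_ν^♮(ξ, Φ)`. -/
def intK (hn : 0 < n) (hΦ : IsCMType Φ) (h₀ : φ₀ ∈ Φ) {D : HermPair F n}
    (KZ : Subgroup (ZA F)) {KG : Subgroup D.GA} (α : Polynomial F) (ξ : maximalRealSubfield F)
    (a : ℝ) (f₀ : D.HeckeFun KG) (f : D.VecFun KG) (v₀ : maximalRealSubfield F →+* ℝ) : ℝ :=
  1 / (tau KZ * degE hn hΦ h₀) *
    ∑ᶠ ν ∈ placesOver hn hΦ h₀ v₀, intNatural hn hΦ h₀ KZ α ξ a f₀ f ν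

end Intersection

end HermPair

end Groups

end KudlaGreen

end

/-!
The statement is proved by comparing `V'` with a hermitian line over the CM field `F' = F[T]/(α)`.

*The fixed line and the refined invariant.* An element `δ` with characteristic polynomial `α` makes
`V'` a one-dimensional `F'`-vector space (`vecEquiv`), with the hermitian form `(a, b) ↦ a b̄ ⟨x₀,
x₀⟩'` for any basis `x₀`. After an embedding `w` of `F`, the eigenlines of `δ` are orthogonal to
each other and correspond to the embeddings `τ` of `F'` over `w`; the form on them has the diagonal
entries `τ(⟨x₀, x₀⟩')` (`herm_eq_sum_coordAt`). The signature of `V'` therefore prescribes the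
signs of these entries: exactly one is negative over a place above `v₀`
(`exists_re_refinedForm_neg`), and none over the other places. A line that is fixed by `δ` is an
eigenline, so that the line of the negative entry is the only negative one
(`existsUnique_fixed_line`). The coordinate of a rational vector `u = a x₀` on it is the conjugate
`τ₀(a)`, which does not vanish unless `u = 0`, and `R(u, z_δ)` is the contribution `τ₀(⟨u, u⟩')` of
this eigenline to `⟨u, u⟩` (`RFun_eq_re_refinedForm`).

*Convergence of the Green function.* The sum `∑_τ |τ(⟨u, u⟩')|` is the trace of `⟨u, u⟩` up to a
multiple of `R(u, z_δ)`, because only one pair of conjugate terms has the wrong sign. For fixed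
`⟨u, u⟩ = ξ`, hence, `|R(u, z_δ)|` grows quadratically in the coordinates of `u`
(`exists_coordinate_bound`), and the exponential decay of `Ei` gives convergence over a lattice
(`summable_greenTerm`).

*Finiteness of the CM cycle.* This is reduction theory. If `φ₀(h⁻¹ δ h) ≠ 0`, then by Minkowski's
theorem the lattice of rational vectors `v` with `h⁻¹ v` integral contains a nonzero one that is
short for the majorant `∑_τ |τ(⟨v, v⟩')|` (`exists_short_integral_vector`); here the covolume does
not depend on `h`, as `h` is unitary. The elements `⟨δⁱ v, v⟩` of `F`, which determine `⟨v, v⟩'`,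
are bounded at the infinite places and lie in a compact set of finite adeles, so that `⟨v, v⟩'`
takes finitely many values. Pairs `(δ, v)` with the same refined invariant are conjugate under
`G'(F₀)` (`exists_conj_of_refinedForm_eq`), since both identify `V'` with the same hermitian
`F'`-line. For a fixed pair, only finitely many cosets `h K_G` send the cyclic basis `δⁱ v` into a
given compact set (`finite_cosets_of_cyclic`). This proves `finite_orbits_heckeFun`; the same
method applied to the lattices `z 𝒪_F`, for `z ∈ Z^ℚ(𝔸_f)`, shows that `τ(Z^ℚ)` is finite
(`finite_doubleCoset_ZA`).

*The formula.* The Green function at the CM cycle is a sum over a vector `u` and an orbit of tuples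
`(δ, z, z', h K_G)`, in which `z = z_δ`. As the level is small, the stabilizers are trivial, and
such data correspond bijectively to a `G'(F₀)`-orbit of pairs `(δ, u)`, a double coset of
`Z^ℚ(𝔸_f)` and a coset of `K_G` (`unfold_injective`, `unfold_surjective`). The sum over double
cosets is the factor `τ(Z^ℚ)`, and the sum over cosets of `K_G` is the orbital integral
(`orb_eq_tsum`); this gives `hasSum_kudlaGreen_mul_orb`. The value `-Ei(2π a R(u, z_δ))` depends on
`ξ'` and `v₀` only and not on the embedding of `F` above `v₀` (`kudlaGreen_fixed`), so that all
places `ν` of the reflex field above `v₀` contribute the same. There are `[E : F]` of them, because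
the embeddings of `E` that extend `w₀` represent them without repetition (`ncard_placesOver`), and
`½ log q_ν = 1`; hence their normalized sum is the contribution of one place divided by `τ(Z^ℚ)`
(`intK_eq`).
-/

noncomputable section

namespace KudlaGreen

/-! ### The finite adeles of `ℚ` -/

section LocalRing

open Rat.HeightOneSpectrum

variable {R : Type*} [CommRing R] [Algebra R ℚ] [IsIntegralClosure R ℤ ℚ] [IsDedekindDomain R]
  [IsFractionRing R ℚ] (v : HeightOneSpectrum R)

theorem compactSpace_adicCompletionIntegers : CompactSpace (v.adicCompletionIntegers ℚ) :=
  have : Fact (primesEquiv v : ℕ).Prime := ⟨(primesEquiv v).2⟩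
  (adicCompletionIntegers.padicIntEquiv v).toHomeomorph.symm.compactSpace

/-- `ℤ` is dense in `ℤ_p`: every `p`-adic integer is a natural number modulo `p`. -/
theorem exists_nat_sub_eq_mul (x : v.adicCompletionIntegers ℚ) :
    ∃ (m : ℕ) (y : v.adicCompletionIntegers ℚ), x - m = (primesEquiv v : ℕ) * y := by
  have : Fact (primesEquiv v : ℕ).Prime := ⟨(primesEquiv v).2⟩
  set e := (adicCompletionIntegers.padicIntEquiv v).toRingEquiv
  obtain ⟨m, -, hm⟩ := PadicInt.exists_mem_range (e x)
  rw [PadicInt.maximalIdeal_eq_span_p, Ideal.mem_span_singleton] at hm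
  obtain ⟨y, hy⟩ := hm
  refine ⟨m, e.symm y, e.injective ?_⟩
  rw [map_sub, map_natCast, map_mul, map_natCast, e.apply_symm_apply, hy]

/-- A prime number other than `p` is a unit of `ℤ_p`. -/
theorem exists_mul_eq_one_of_ne (q : Nat.Primes) (hq : q ≠ primesEquiv v) :
    ∃ y : v.adicCompletionIntegers ℚ, (q : ℕ) * y = 1 := by
  have : Fact (primesEquiv v : ℕ).Prime := ⟨(primesEquiv v).2⟩
  set e := (adicCompletionIntegers.padicIntEquiv v).toRingEquiv
  have h : IsUnit ((q : ℕ) : ℤ_[primesEquiv v]) := by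
    rw [PadicInt.isUnit_iff]
    refine le_antisymm (PadicInt.norm_le_one _) (not_lt.1 fun h => hq ?_)
    have h2 : ((primesEquiv v : ℕ) : ℤ) ∣ ((q : ℕ) : ℤ) := by
      rw [← PadicInt.norm_int_lt_one_iff_dvd]
      simpa using h
    exact Subtype.ext ((Nat.prime_dvd_prime_iff_eq (primesEquiv v).2 q.2).1
      (by exact_mod_cast h2)).symm
  obtain ⟨y, hy⟩ := h.exists_right_inv
  refine ⟨e.symm y, e.injective ?_⟩
  rw [map_mul, map_natCast, e.apply_symm_apply, hy, map_one]

end LocalRing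

/-- The ring of finite adeles of `ℚ`. -/
abbrev AQ : Type := FiniteAdeleRing ℤ ℚ

/-- The ring `Ẑ` of integral finite adeles. -/
def Zhat : Subring AQ where
  carrier := {a | ∀ v, a v ∈ v.adicCompletionIntegers ℚ}
  mul_mem' ha hb v := mul_mem (ha v) (hb v)
  one_mem' v := one_mem (v.adicCompletionIntegers ℚ)
  add_mem' ha hb v := add_mem (ha v) (hb v)
  zero_mem' v := zero_mem (v.adicCompletionIntegers ℚ)
  neg_mem' ha v := neg_mem (ha v)

instance : T2Space AQ :=
  inferInstanceAs (T2Space (RestrictedProduct (fun v : HeightOneSpectrum ℤ => v.adicCompletion ℚ)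
    (fun v => (v.adicCompletionIntegers ℚ : Set (v.adicCompletion ℚ))) Filter.cofinite))

theorem isOpen_Zhat : IsOpen (Zhat : Set AQ) :=
  RestrictedProduct.isOpen_forall_mem
    (R := fun v : HeightOneSpectrum ℤ => v.adicCompletion ℚ)
    (A := fun v => (v.adicCompletionIntegers ℚ : Set (v.adicCompletion ℚ)))
    (fun _ => Valued.isOpen_valuationSubring _)

theorem isCompact_Zhat : IsCompact (Zhat : Set AQ) := by
  have : ∀ v : HeightOneSpectrum ℤ, CompactSpace (v.adicCompletionIntegers ℚ) := fun v =>
    compactSpace_adicCompletionIntegers v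
  have h := RestrictedProduct.range_structureMap
    (R := fun v : HeightOneSpectrum ℤ => v.adicCompletion ℚ)
    (A := fun v => (v.adicCompletionIntegers ℚ : Set (v.adicCompletion ℚ))) (𝓕 := Filter.cofinite)
  have h2 : (Zhat : Set AQ) = Set.range (RestrictedProduct.structureMap
    (fun v : HeightOneSpectrum ℤ => v.adicCompletion ℚ)
    (fun v => (v.adicCompletionIntegers ℚ : Set (v.adicCompletion ℚ))) Filter.cofinite) := by
    rw [h]; rfl
  rw [h2]
  have : ∀ v : HeightOneSpectrum ℤ,
    CompactSpace ((v.adicCompletionIntegers ℚ : Set (v.adicCompletion ℚ))) := this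
  exact isCompact_range RestrictedProduct.isEmbedding_structureMap.continuous

instance : Nontrivial AQ := by
  refine ⟨0, 1, fun h => ?_⟩
  let v : HeightOneSpectrum ℤ :=
    (Rat.HeightOneSpectrum.primesEquiv (R := ℤ)).symm ⟨2, Nat.prime_two⟩
  have : (0 : v.adicCompletion ℚ) = 1 := congrArg (fun a : AQ => a v) h
  exact zero_ne_one this

theorem algebraMap_AQ_injective : Function.Injective (algebraMap ℚ AQ) :=
  (algebraMap ℚ AQ).injective

theorem intCast_mem_Zhat (m : ℤ) : ((m : ℤ) : AQ) ∈ Zhat := intCast_mem _ m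

/-- `ℚ ∩ Ẑ = ℤ`. -/
theorem algebraMap_mem_Zhat {q : ℚ} (h : algebraMap ℚ AQ q ∈ Zhat) : ∃ m : ℤ, q = m := by
  have h1 : ∀ v : HeightOneSpectrum ℤ, (q.den : ℤ) ∉ v.asIdeal := by
    intro v
    have := h v
    rw [FiniteAdeleRing.algebraMap_apply, HeightOneSpectrum.mem_adicCompletionIntegers,
      HeightOneSpectrum.valuedAdicCompletion_eq_valuation'] at this
    have := Rat.valuation_le_one_iff_den.1 this
    simpa using this
  refine ⟨q.num, (Rat.den_eq_one_iff q).1 ?_ |>.symm⟩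
  by_contra hd
  obtain ⟨p, hp, hpd⟩ := Nat.exists_prime_and_dvd hd
  let v := HeightOneSpectrum.ofPrime
    (Ideal.prime_span_singleton_iff.2 (Nat.prime_iff_prime_int.1 hp))
  refine h1 v ?_
  change _ ∈ Ideal.span _
  rw [Ideal.mem_span_singleton]
  exact_mod_cast hpd

/-- A finite adele has a common denominator. -/
theorem exists_nat_mul_mem_Zhat (a : AQ) : ∃ N : ℕ, 0 < N ∧ (N : AQ) * a ∈ Zhat := by
  classical
  have hfin : {v : HeightOneSpectrum ℤ | a v ∉ v.adicCompletionIntegers ℚ}.Finite := a.2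
  have hloc : ∀ v : HeightOneSpectrum ℤ, ∃ N : ℕ, 0 < N ∧
      (N : v.adicCompletion ℚ) * a v ∈ v.adicCompletionIntegers ℚ := by
    intro v
    obtain ⟨b, hb, hb'⟩ :=
      HeightOneSpectrum.adicCompletion.mul_nonZeroDivisor_mem_adicCompletionIntegers v (a v)
    refine ⟨b.natAbs, Int.natAbs_pos.2 (nonZeroDivisors.ne_zero hb), ?_⟩
    have hb2 : ((b : ℤ) : v.adicCompletion ℚ) * a v ∈ v.adicCompletionIntegers ℚ := by
      rw [mul_comm]; convert hb' using 2; simp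
    rcases Int.natAbs_eq b with h | h
    · rw [h] at hb2; simpa using hb2
    · rw [h] at hb2
      have := neg_mem hb2
      simpa using this
  choose N hN hN' using hloc
  refine ⟨∏ v ∈ hfin.toFinset, N v, Finset.prod_pos fun v _ => hN v, fun v => ?_⟩
  have hcoe : ∀ k : ℕ, ((k : AQ) * a) v = (k : v.adicCompletion ℚ) * a v := by
    intro k; rfl
  rw [hcoe]
  by_cases hv : a v ∈ v.adicCompletionIntegers ℚ
  · exact mul_mem (natCast_mem _ _) hv
  · rw [← Finset.mul_prod_erase _ _ (hfin.mem_toFinset.2 hv), mul_comm (N v), Nat.cast_mul,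
      mul_assoc]
    exact mul_mem (natCast_mem _ _) (hN' v)

/-- `Ẑ = ℤ + M Ẑ`, by induction on the prime factorization of `M`. -/
theorem exists_int_sub_eq_mul {M : ℕ} (hM : 0 < M) {a : AQ} (ha : a ∈ Zhat) :
    ∃ (m : ℤ) (b : AQ), b ∈ Zhat ∧ a - m = M * b := by
  induction M using Nat.recOnMul generalizing a with
  | zero => exact absurd hM (lt_irrefl 0)
  | one => exact ⟨0, a, ha, by simp⟩
  | prime p hp =>
    let v : HeightOneSpectrum ℤ := (Rat.HeightOneSpectrum.primesEquiv (R := ℤ)).symm ⟨p, hp⟩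
    have hv : Rat.HeightOneSpectrum.primesEquiv v = ⟨p, hp⟩ := Equiv.apply_symm_apply _ _
    obtain ⟨m, y, hy⟩ := exists_nat_sub_eq_mul v ⟨a v, ha v⟩
    rw [hv] at hy
    have hp0 : (algebraMap ℚ AQ (p : ℚ)) * algebraMap ℚ AQ (p : ℚ)⁻¹ = 1 := by
      rw [← map_mul, mul_inv_cancel₀ (by exact_mod_cast hp.ne_zero), map_one]
    rw [map_natCast] at hp0
    -- the integer `m` approximates `a` at `p`; at the other places, `p` is a unit
    refine ⟨m, algebraMap ℚ AQ (p : ℚ)⁻¹ * (a - m), fun w => ?_, ?_⟩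
    · have hcoe : ∀ b : AQ, ∀ k : ℕ, ((k : AQ) * b) w = (k : w.adicCompletion ℚ) * b w := by
        intro _ k; rfl
      set b : AQ := algebraMap ℚ AQ (p : ℚ)⁻¹ * (a - m) with hb
      have h1 : ((p : AQ) * b) w = a w - m := by
        rw [hb, ← mul_assoc, hp0, one_mul]; rfl
      rw [hcoe] at h1
      by_cases hw : w = v
      · subst hw
        have hy' : a v - m = (p : v.adicCompletion ℚ) * y := by
          have := congrArg Subtype.val hy
          exact this
        have hp1 : (p : v.adicCompletion ℚ) ≠ 0 := by
          rw [← map_natCast (algebraMap ℚ (v.adicCompletion ℚ)), map_ne_zero]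
          exact_mod_cast hp.ne_zero
        rw [hy'] at h1
        rw [mul_left_cancel₀ hp1 h1]
        exact y.2
      · obtain ⟨y', hy'⟩ := exists_mul_eq_one_of_ne w ⟨p, hp⟩
          (fun h => hw ((Equiv.symm_apply_eq _).2 h).symm)
        have hy2 : (p : w.adicCompletion ℚ) * y' = 1 := congrArg Subtype.val hy'
        have : b w = y' * (a w - m) := by
          rw [← h1, ← mul_assoc, mul_comm (y' : w.adicCompletion ℚ), hy2, one_mul]
        rw [this]
        exact mul_mem y'.2 (sub_mem (ha w) (natCast_mem _ _))
    · rw [← mul_assoc, hp0, one_mul]; simp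
  | mul x y ihx ihy =>
    have hx : 0 < x := Nat.pos_of_mul_pos_right hM
    have hy : 0 < y := Nat.pos_of_mul_pos_left hM
    obtain ⟨m, b, hb, hab⟩ := ihx hx ha
    obtain ⟨m', c, hc, hbc⟩ := ihy hy hb
    refine ⟨m + x * m', c, hc, ?_⟩
    push_cast
    linear_combination hab + (x : AQ) * hbc

/-- Strong approximation: `𝔸_f = ℚ + M Ẑ`. -/
theorem exists_rat_sub_eq_mul {M : ℕ} (hM : 0 < M) (a : AQ) :
    ∃ (q : ℚ) (b : AQ), b ∈ Zhat ∧ a - algebraMap ℚ AQ q = M * b := by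
  obtain ⟨N, hN, hNa⟩ := exists_nat_mul_mem_Zhat a
  obtain ⟨m, b, hb, h⟩ := exists_int_sub_eq_mul (Nat.mul_pos hN hM) hNa
  have h0 : (N : AQ) * algebraMap ℚ AQ (N : ℚ)⁻¹ = 1 := by
    rw [← map_natCast (algebraMap ℚ AQ), ← map_mul,
      mul_inv_cancel₀ (by exact_mod_cast hN.ne'), map_one]
  refine ⟨m * (N : ℚ)⁻¹, b, hb, ?_⟩
  rw [map_mul, map_intCast]
  push_cast at h
  linear_combination algebraMap ℚ AQ (N : ℚ)⁻¹ * h + (-a + M * b) * h0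

/-- Compact sets of finite adeles have bounded denominators. -/
theorem exists_nat_mul_mem_Zhat_of_isCompact {C : Set AQ} (hC : IsCompact C) :
    ∃ N : ℕ, 0 < N ∧ ∀ a ∈ C, (N : AQ) * a ∈ Zhat := by
  have hopen : ∀ N : ℕ, IsOpen {a : AQ | ((N + 1 : ℕ) : AQ) * a ∈ Zhat} := fun N =>
    isOpen_Zhat.preimage (continuous_const.mul continuous_id)
  obtain ⟨t, ht⟩ := hC.elim_finite_subcover _ hopen (fun a _ => by
    obtain ⟨N, hN, h⟩ := exists_nat_mul_mem_Zhat a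
    obtain ⟨k, rfl⟩ : ∃ k, N = k + 1 := ⟨N - 1, by omega⟩
    exact Set.mem_iUnion.2 ⟨k, h⟩)
  refine ⟨∏ k ∈ t, (k + 1), Finset.prod_pos fun k _ => k.succ_pos, fun a ha => ?_⟩
  obtain ⟨k, hk, hka⟩ : ∃ k ∈ t, ((k + 1 : ℕ) : AQ) * a ∈ Zhat := by
    simpa using ht ha
  rw [← Finset.mul_prod_erase t _ hk, mul_comm (k + 1), Nat.cast_mul, mul_assoc]
  exact mul_mem (natCast_mem _ _) hka

/-! ### Lattices and adelic matrices -/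

/-- `GL_d` over `ℚ` has class number one: `GL_d(𝔸_f) = GL_d(Ẑ) GL_d(ℚ)`. The columns of `g` form a
basis of the lattice of all `x ∈ ℚ^d` with `B x` integral. -/
theorem exists_rat_matrix_mul_integral {ι : Type*} [Fintype ι] [DecidableEq ι]
    (B B' : Matrix ι ι AQ) (hB : B * B' = 1) :
    ∃ (g : Matrix ι ι ℚ) (k' : Matrix ι ι AQ), g.det ≠ 0 ∧
      (∀ i j, (B * g.map (algebraMap ℚ AQ)) i j ∈ Zhat) ∧ (∀ i j, k' i j ∈ Zhat) ∧
      B * g.map (algebraMap ℚ AQ) * k' = 1 := by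
  have hB' : B' * B = 1 := mul_eq_one_comm.1 hB
  obtain ⟨N, hN, hNB, hNB'⟩ : ∃ N : ℕ, 0 < N ∧ (∀ i j, (N : AQ) * B i j ∈ Zhat) ∧
      ∀ i j, (N : AQ) * B' i j ∈ Zhat := by
    obtain ⟨N, hN, h⟩ := exists_nat_mul_mem_Zhat_of_isCompact
      (Set.toFinite (Set.range fun p : ι × ι => B p.1 p.2)).isCompact
    obtain ⟨N', hN', h'⟩ := exists_nat_mul_mem_Zhat_of_isCompact
      (Set.toFinite (Set.range fun p : ι × ι => B' p.1 p.2)).isCompact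
    refine ⟨N * N', Nat.mul_pos hN hN', fun i j => ?_, fun i j => ?_⟩
    · rw [mul_comm N, Nat.cast_mul, mul_assoc]
      exact mul_mem (natCast_mem _ _) (h _ ⟨(i, j), rfl⟩)
    · rw [Nat.cast_mul, mul_assoc]
      exact mul_mem (natCast_mem _ _) (h' _ ⟨(i, j), rfl⟩)
  have hN0 : (N : ℚ) ≠ 0 := by exact_mod_cast hN.ne'
  have hNinv : (N : AQ) * algebraMap ℚ AQ (N : ℚ)⁻¹ = 1 := by
    rw [← map_natCast (algebraMap ℚ AQ), ← map_mul, mul_inv_cancel₀ hN0, map_one]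
  -- `L` is the lattice `{x | B x ∈ Ẑ^d}`, multiplied by `N` so that it lies in `ℤ^d`.
  obtain ⟨emb, hemb⟩ : ∃ emb : (ι → ℤ) →+ (ι → AQ), ∀ x i, emb x i = ((x i : ℤ) : AQ) :=
    ⟨{ toFun := fun x i => (x i : AQ)
       map_zero' := by ext; simp
       map_add' := fun x y => by ext; simp }, fun _ _ => rfl⟩
  obtain ⟨L, hmemL⟩ : ∃ L : Submodule ℤ (ι → ℤ), ∀ x, x ∈ L ↔
      ∀ i, algebraMap ℚ AQ (N : ℚ)⁻¹ * (B *ᵥ emb x) i ∈ Zhat :=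
    ⟨AddSubgroup.toIntSubmodule
      { carrier := {x | ∀ i, algebraMap ℚ AQ (N : ℚ)⁻¹ * (B *ᵥ emb x) i ∈ Zhat}
        add_mem' := by
          intro x y hx hy i
          rw [map_add, Matrix.mulVec_add, Pi.add_apply, mul_add]
          exact add_mem (hx i) (hy i)
        zero_mem' := by intro i; simp
        neg_mem' := by
          intro x hx i
          rw [map_neg, Matrix.mulVec_neg, Pi.neg_apply, mul_neg]
          exact neg_mem (hx i) }, fun _ => Iff.rfl⟩
  -- the factor `N * N` absorbs the scaling of `L` and the denominators of `B`
  have hNL : ∀ x : ι → ℤ, (N * N : ℤ) • x ∈ L := by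
    intro x
    refine (hmemL _).2 fun i => ?_
    have h1 : emb ((N * N : ℤ) • x) = (N : AQ) • (N : AQ) • emb x := by
      funext j; simp [hemb, mul_assoc]
    rw [h1, Matrix.mulVec_smul, Matrix.mulVec_smul, Pi.smul_apply, Pi.smul_apply, smul_eq_mul,
      smul_eq_mul, ← mul_assoc, mul_comm (algebraMap _ _ _), hNinv, one_mul, Matrix.mulVec,
      dotProduct, Finset.mul_sum]
    refine sum_mem fun j _ => ?_
    rw [← mul_assoc]
    exact mul_mem (hNB i j) (by rw [hemb]; exact intCast_mem _ _)
  have hrank : Module.finrank ℤ L = Fintype.card ι := by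
    refine le_antisymm ((Submodule.finrank_le L).trans (by simp)) ?_
    let m : (ι → ℤ) →ₗ[ℤ] L :=
      LinearMap.codRestrict L ((N * N : ℤ) • LinearMap.id) fun x => by
        simpa [mul_assoc] using hNL x
    have hm : Function.Injective m := by
      intro x y hxy
      have h1 : (N * N : ℤ) • x = (N * N : ℤ) • y := congrArg Subtype.val hxy
      have h2 : (N * N : ℤ) ≠ 0 := by positivity
      exact smul_right_injective _ h2 h1
    simpa using LinearMap.finrank_le_finrank_of_injective hm
  let b : Module.Basis ι ℤ L := (Module.finBasis ℤ L).reindex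
    (Fintype.equivOfCardEq (by rw [Fintype.card_fin, hrank]))
  let g : Matrix ι ι ℚ := fun i j => (N : ℚ)⁻¹ * ((b j : ι → ℤ) i : ℚ)
  have hgmap : ∀ i j, g.map (algebraMap ℚ AQ) i j =
      algebraMap ℚ AQ (N : ℚ)⁻¹ * (((b j : ι → ℤ) i : ℤ) : AQ) := by
    intro i j
    rw [Matrix.map_apply]
    change algebraMap ℚ AQ (_ * _) = _
    rw [map_mul, map_intCast]
  -- every element of `L` is, up to the factor `N`, an integral combination of the columns of `g`
  have hspan : ∀ x ∈ L, ∃ c : ι → AQ, (∀ i, c i ∈ Zhat) ∧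
      g.map (algebraMap ℚ AQ) *ᵥ c = algebraMap ℚ AQ (N : ℚ)⁻¹ • emb x := by
    intro x hx
    refine ⟨fun i => ((b.repr ⟨x, hx⟩ i : ℤ) : AQ), fun i => intCast_mem _ _, ?_⟩
    have h1 : x = ∑ j, b.repr ⟨x, hx⟩ j • (b j : ι → ℤ) := by
      calc x = ((∑ j, b.repr ⟨x, hx⟩ j • b j : L) : ι → ℤ) := by rw [b.sum_repr]
        _ = _ := by simp only [Submodule.coe_sum, Submodule.coe_smul]
    funext i
    rw [Pi.smul_apply, smul_eq_mul, hemb]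
    conv_rhs => rw [h1]
    simp only [Matrix.mulVec, dotProduct, hgmap, Finset.sum_apply, Pi.smul_apply,
      smul_eq_mul, Int.cast_sum, Int.cast_mul, Finset.mul_sum]
    exact Finset.sum_congr rfl fun j _ => by ring
  -- the columns of `B'` are integral combinations of the columns of `g`: modulo `N Ẑ^d`, which such
  -- combinations exhaust by `hNL`, a column is rational, and then it lies in the lattice
  have hcol : ∀ j, ∃ c : ι → AQ, (∀ i, c i ∈ Zhat) ∧
      g.map (algebraMap ℚ AQ) *ᵥ c = fun i => B' i j := by
    intro j
    choose q t ht hq using fun i => exists_rat_sub_eq_mul hN (B' i j)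
    have hdec : (fun i => B' i j) = (fun i => algebraMap ℚ AQ (q i)) + (N : AQ) • t := by
      funext i
      simp only [Pi.add_apply, Pi.smul_apply, smul_eq_mul]
      rw [← hq i]; ring
    have hBj : B *ᵥ (fun i => B' i j) = fun i => (1 : Matrix ι ι AQ) i j := by
      funext i
      rw [← hB]; rfl
    have hBq : ∀ i, (B *ᵥ (fun i => algebraMap ℚ AQ (q i))) i ∈ Zhat := by
      intro i
      have h1 : (fun i => algebraMap ℚ AQ (q i)) = (fun i => B' i j) - (N : AQ) • t := by
        rw [hdec]; simp
      rw [h1, Matrix.mulVec_sub, hBj, Matrix.mulVec_smul, Pi.sub_apply, Pi.smul_apply, smul_eq_mul,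
        Matrix.mulVec, dotProduct, Finset.mul_sum]
      refine sub_mem ?_ (sum_mem fun l _ => ?_)
      · rw [Matrix.one_apply]; split_ifs
        · exact one_mem _
        · exact zero_mem _
      · rw [← mul_assoc]; exact mul_mem (hNB i l) (ht l)
    have hNq : ∀ i, ∃ m : ℤ, (N : ℚ) * q i = m := by
      intro i
      apply algebraMap_mem_Zhat
      have h1 : algebraMap ℚ AQ (q i) =
          (B' *ᵥ (B *ᵥ (fun i => algebraMap ℚ AQ (q i)))) i := by
        rw [Matrix.mulVec_mulVec, hB', Matrix.one_mulVec]
      rw [map_mul, map_natCast, h1, Matrix.mulVec, dotProduct, Finset.mul_sum]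
      refine sum_mem fun l _ => ?_
      rw [← mul_assoc]; exact mul_mem (hNB' i l) (hBq l)
    choose x hx using hNq
    have hxq : algebraMap ℚ AQ (N : ℚ)⁻¹ • emb x = fun i => algebraMap ℚ AQ (q i) := by
      funext i
      rw [Pi.smul_apply, smul_eq_mul, hemb, ← map_intCast (algebraMap ℚ AQ), ← hx i, ← map_mul,
          ← mul_assoc, inv_mul_cancel₀ hN0,
        one_mul]
    have hxL : x ∈ L := by
      refine (hmemL x).2 fun i => ?_
      have := hBq i
      rwa [← hxq, Matrix.mulVec_smul] at this
    obtain ⟨c, hc, hgc⟩ := hspan x hxL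
    have hT : ∀ l : ι, ∃ d : ι → AQ, (∀ i, d i ∈ Zhat) ∧
        g.map (algebraMap ℚ AQ) *ᵥ d = (N : AQ) • Pi.single l 1 := by
      intro l
      obtain ⟨d, hd, hgd⟩ := hspan _ (hNL (Pi.single l 1))
      refine ⟨d, hd, hgd.trans ?_⟩
      have h1 : emb ((N * N : ℤ) • Pi.single l 1) = (N : AQ) • (N : AQ) • Pi.single l (1 : AQ) := by
        funext j
        simp only [hemb, Pi.smul_apply, smul_eq_mul, Pi.single_apply]
        split_ifs <;> simp
      rw [h1, smul_smul, mul_comm, hNinv, one_smul]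
    choose d hd hgd using hT
    refine ⟨c + ∑ l, t l • d l, fun i => ?_, ?_⟩
    · rw [Pi.add_apply, Finset.sum_apply]
      exact add_mem (hc i) (sum_mem fun l _ => mul_mem (ht l) (hd l i))
    · rw [Matrix.mulVec_add, hgc, hxq, hdec, Matrix.mulVec_sum]
      congr 1
      simp only [Matrix.mulVec_smul, hgd]
      funext i
      simp [Finset.sum_apply, Pi.single_apply, mul_comm]
  choose c hc hgc using hcol
  have hmul : B * g.map (algebraMap ℚ AQ) * (Matrix.of fun i j => c j i) = 1 := by
    have : g.map (algebraMap ℚ AQ) * (Matrix.of fun i j => c j i) = B' := by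
      refine Matrix.ext fun i j => ?_
      exact congrFun (hgc j) i
    rw [Matrix.mul_assoc, this, hB]
  refine ⟨g, Matrix.of fun i j => c j i, ?_, fun i j => ?_, fun i j => hc j i, hmul⟩
  · intro h0
    have h1 := congrArg Matrix.det hmul
    have h2 : (g.map (algebraMap ℚ AQ)).det = 0 := by
      rw [← RingHom.mapMatrix_apply, ← RingHom.map_det, h0, map_zero]
    rw [Matrix.det_mul, Matrix.det_mul, h2, mul_zero, zero_mul, Matrix.det_one] at h1
    exact zero_ne_one h1
  · have h1 := (hmemL _).1 (b j).2 i
    rw [Matrix.mulVec, dotProduct, Finset.mul_sum] at h1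
    rw [Matrix.mul_apply]
    convert h1 using 2 with l
    rw [hgmap, hemb]
    ring

/-! ### The topology of the finite adeles of a number field -/

section AdeleTopology

variable (F : Type*) [Field F] [NumberField F]

instance : IsModuleTopology AQ (AdeleF F) := ⟨rfl⟩

instance : Module.Finite AQ (AdeleF F) :=
  inferInstanceAs (Module.Finite AQ (AQ ⊗[ℚ] F))

instance : IsTopologicalRing (AdeleF F) := IsModuleTopology.isTopologicalRing AQ (AdeleF F)

variable {F}

/-- The basis of `𝔸_f ⊗ F` over `𝔸_f` obtained from a basis of `F` over `ℚ`. -/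
def basisAdele {ι : Type*} (b : Module.Basis ι ℚ F) : Module.Basis ι AQ (AdeleF F) :=
  Algebra.TensorProduct.basis AQ b

theorem basisAdele_apply {ι : Type*} (b : Module.Basis ι ℚ F) (i : ι) :
    basisAdele b i = toAdele F (b i) :=
  Algebra.TensorProduct.basis_apply b i

theorem algebraMap_toAdele (q : ℚ) :
    algebraMap AQ (AdeleF F) (algebraMap ℚ AQ q) = toAdele F (algebraMap ℚ F q) := by
  change (algebraMap ℚ AQ q) ⊗ₜ[ℚ] (1 : F) = (1 : AQ) ⊗ₜ[ℚ] (algebraMap ℚ F q)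
  rw [Algebra.algebraMap_eq_smul_one, Algebra.algebraMap_eq_smul_one, TensorProduct.smul_tmul]

theorem basisAdele_repr_toAdele {ι : Type*} (b : Module.Basis ι ℚ F) (x : F) (i : ι) :
    (basisAdele b).repr (toAdele F x) i = algebraMap ℚ AQ (b.repr x i) := by
  have h := Algebra.TensorProduct.basis_repr_tmul (A := AQ) b (1 : AQ) x
  have h2 : (basisAdele b).repr (toAdele F x) =
      (1 : AQ) • Finsupp.mapRange (algebraMap ℚ AQ) (by simp) (b.repr x) := h
  rw [h2, one_smul, Finsupp.mapRange_apply]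

theorem continuous_repr {ι : Type*} (b : Module.Basis ι ℚ F) (i : ι) :
    Continuous fun x : AdeleF F => (basisAdele b).repr x i :=
  IsModuleTopology.continuous_of_linearMap ((basisAdele b).coord i)

instance : T2Space (AdeleF F) := by
  let b := Module.finBasis ℚ F
  refine .of_injective_continuous (f := fun x : AdeleF F => fun i => (basisAdele b).repr x i) ?_
    (continuous_pi fun i => continuous_repr b i)
  intro x y h
  exact (basisAdele b).repr.injective (Finsupp.ext fun i => congrFun h i)

/-- The lattice spanned by a basis over `Ẑ` is compact. -/
theorem isCompact_integral {ι : Type*} [Finite ι] (b : Module.Basis ι ℚ F) :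
    IsCompact {x : AdeleF F | ∀ i, (basisAdele b).repr x i ∈ Zhat} := by
  have := Fintype.ofFinite ι
  have h1 : IsCompact (Set.univ.pi fun _ : ι => (Zhat : Set AQ)) :=
    isCompact_univ_pi fun _ => isCompact_Zhat
  have h2 : Continuous (basisAdele b).equivFun.symm :=
    IsModuleTopology.continuous_of_linearMap (basisAdele b).equivFun.symm.toLinearMap
  refine (h1.image h2).of_isClosed_subset ?_ ?_
  · have : {x : AdeleF F | ∀ i, (basisAdele b).repr x i ∈ Zhat} =
        ⋂ i, (fun x : AdeleF F => (basisAdele b).repr x i) ⁻¹' (Zhat : Set AQ) := by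
      ext; simp
    rw [this]
    exact isClosed_iInter fun i => isCompact_Zhat.isClosed.preimage (continuous_repr b i)
  · intro x hx
    exact ⟨(basisAdele b).equivFun x, fun i _ => hx i, (basisAdele b).equivFun.symm_apply_apply x⟩

/-- The conjugation of the adeles as an `𝔸_f`-linear map. -/
def conjALinear (F : Type*) [Field F] [NumberField F] [IsCMField F] :
    AdeleF F →ₗ[AQ] AdeleF F :=
  (Algebra.TensorProduct.map (AlgHom.id AQ AQ) (conjF F).toRatAlgHom).toLinearMap

theorem conjALinear_apply [IsCMField F] (x : AdeleF F) : conjALinear F x = conjA F x := rfl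

theorem continuous_conjA [IsCMField F] : Continuous (conjA F) :=
  IsModuleTopology.continuous_of_linearMap (conjALinear F)

/-- An element of `F` that is bounded at all places lies in a finite set. -/
theorem finite_toAdele_mem_of_norm_le {C : Set (AdeleF F)} (hC : IsCompact C) (B : ℝ) :
    {y : F | toAdele F y ∈ C ∧ ∀ w : F →+* ℂ, ‖w y‖ ≤ B}.Finite := by
  -- after multiplication by a common denominator `M`, these elements are algebraic integers, of
  -- which only finitely many have bounded conjugates
  let b := NumberField.integralBasis F
  have h1 : ∀ i, ∃ N : ℕ, 0 < N ∧ ∀ x ∈ C, (N : AQ) * (basisAdele b).repr x i ∈ Zhat := by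
    intro i
    obtain ⟨N, hN, h⟩ := exists_nat_mul_mem_Zhat_of_isCompact (hC.image (continuous_repr b i))
    exact ⟨N, hN, fun x hx => h _ ⟨x, hx, rfl⟩⟩
  choose N hN hNC using h1
  set M := ∏ i, N i with hM
  have hM0 : 0 < M := Finset.prod_pos fun i _ => hN i
  refine ((NumberField.Embeddings.finite_of_norm_le F ℂ (M * B)).preimage
    (f := fun y : F => (M : F) * y) ?_).subset ?_
  · intro x _ y _ hxy
    exact mul_left_cancel₀ (by exact_mod_cast hM0.ne') hxy
  · rintro y ⟨hyC, hyB⟩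
    refine ⟨?_, fun w => ?_⟩
    · have h2 : ∀ i, ∃ m : ℤ, (M : ℚ) * b.repr y i = m := by
        intro i
        apply algebraMap_mem_Zhat
        have h3 := hNC i _ hyC
        rw [basisAdele_repr_toAdele] at h3
        classical
        rw [map_mul, map_natCast, hM, ← Finset.mul_prod_erase _ _ (Finset.mem_univ i),
          mul_comm (N i), Nat.cast_mul, mul_assoc]
        exact mul_mem (natCast_mem _ _) h3
      choose m hm using h2
      have h4 : (M : F) * y = ∑ i, (m i : F) * b i := by
        conv_lhs => rw [← b.sum_repr y]
        rw [Finset.mul_sum]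
        refine Finset.sum_congr rfl fun i _ => ?_
        have := congrArg (algebraMap ℚ F) (hm i)
        rw [map_mul, map_natCast, map_intCast] at this
        rw [Algebra.smul_def, ← mul_assoc, this]
      change IsIntegral ℤ ((M : F) * y)
      rw [h4]
      refine IsIntegral.sum _ fun i _ => ?_
      refine IsIntegral.mul (isIntegral_algebraMap (x := m i)) ?_
      rw [NumberField.integralBasis_apply]
      exact NumberField.RingOfIntegers.isIntegral_coe _
    · rw [map_mul, map_natCast, norm_mul, Complex.norm_natCast]
      exact mul_le_mul_of_nonneg_left (hyB w) (Nat.cast_nonneg _)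

end AdeleTopology

/-! ### Compactness and cosets -/

/-- Units are bounded if they and their inverses are: the topology of `Rˣ` is that of `R × R`. -/
theorem isCompact_units_of_mem {R : Type*} [Ring R] [TopologicalSpace R] [IsTopologicalRing R]
    [T2Space R] {C C' : Set R} (hC : IsCompact C) (hC' : IsCompact C') :
    IsCompact {u : Rˣ | (u : R) ∈ C ∧ ((u⁻¹ : Rˣ) : R) ∈ C'} := by
  have h := Units.isClosedEmbedding_embedProduct (α := R)
  have h2 : IsCompact (C ×ˢ (MulOpposite.op '' C')) :=
    hC.prod (hC'.image MulOpposite.continuous_op)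
  convert h.isCompact_preimage h2 using 1
  ext u
  simp [Units.embedProduct]

/-- A compact set meets only finitely many cosets of an open subgroup. -/
theorem finite_cosets_of_isCompact {G : Type*} [Group G] [TopologicalSpace G]
    [IsTopologicalGroup G] (H : Subgroup G) (K : Subgroup H) (hK : IsOpen (K : Set H))
    {B : Set G} (hB : IsCompact B) :
    {q : H ⧸ K | ∃ h : H, (h : G) ∈ B ∧ (h : H ⧸ K) = q}.Finite := by
  obtain ⟨U, hU, hUK⟩ := isOpen_induced_iff.1 hK
  have h1 : (1 : G) ∈ U := by
    have : (1 : H) ∈ Subtype.val ⁻¹' U := by rw [hUK]; exact K.one_mem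
    exact this
  obtain ⟨V, hV, hVU⟩ : ∃ V ∈ nhds (1 : G), ∀ x ∈ V, ∀ y ∈ V, x⁻¹ * y ∈ U := by
    have hc : Filter.Tendsto (fun p : G × G => p.1⁻¹ * p.2) (nhds (1, 1)) (nhds 1) := by
      have : Continuous fun p : G × G => p.1⁻¹ * p.2 := by fun_prop
      simpa using this.tendsto (1, 1)
    have := hc (hU.mem_nhds h1)
    rw [nhds_prod_eq, Filter.mem_map, Filter.mem_prod_same_iff] at this
    obtain ⟨V, hV, h⟩ := this
    exact ⟨V, hV, fun x hx y hy => h (Set.mk_mem_prod hx hy)⟩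
  -- translates `g V` of a small neighbourhood `V` of `1` meet at most one coset
  obtain ⟨t, -, ht⟩ := hB.elim_nhds_subcover (fun g => (fun x => g⁻¹ * x) ⁻¹' V) (fun g _ => by
    have hc : Continuous fun x : G => g⁻¹ * x := by fun_prop
    exact hc.continuousAt.preimage_mem_nhds (by simpa using hV))
  classical
  have key : ∀ g : G, {q : H ⧸ K | ∃ h : H, g⁻¹ * (h : G) ∈ V ∧ (h : H ⧸ K) = q}.Subsingleton := by
    rintro g _ ⟨a, ha, rfl⟩ _ ⟨b, hb, rfl⟩
    rw [QuotientGroup.eq]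
    have h2 := hVU _ ha _ hb
    have h3 : a⁻¹ * b ∈ Subtype.val ⁻¹' U := by
      change ((a⁻¹ * b : H) : G) ∈ U
      convert h2 using 1
      push_cast
      group
    rwa [hUK] at h3
  refine (Set.Finite.biUnion t.finite_toSet fun g _ => (key g).finite).subset ?_
  rintro q ⟨h, hh, rfl⟩
  obtain ⟨g, hg, hgh⟩ := Set.mem_iUnion₂.1 (ht hh)
  exact Set.mem_biUnion hg ⟨h, hgh, rfl⟩

/-! ### Short vectors -/

open scoped MatrixOrder in
/-- Hermite's bound: a positive definite real quadratic form of bounded determinant takes a bounded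
value at some nonzero integral vector. -/
theorem exists_int_vec_dotProduct_le (ι : Type*) [Fintype ι] [DecidableEq ι] [Nonempty ι] (Δ : ℝ) :
    ∃ C : ℝ, ∀ P : Matrix ι ι ℝ, P.PosDef → P.det ≤ Δ →
      ∃ m : ι → ℤ, m ≠ 0 ∧ (fun i => (m i : ℝ)) ⬝ᵥ (P *ᵥ fun i => (m i : ℝ)) ≤ C := by
  -- `|det B| ≤ √Δ < r ≤ r ^ d` makes the volume of the cube in Minkowski's theorem larger than `2 ^
  -- d`
  set r : ℝ := 1 + √Δ with hr
  have hr1 : 1 ≤ r := by rw [hr]; linarith [Real.sqrt_nonneg Δ]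
  refine ⟨Fintype.card ι * r ^ 2, fun P hP hdet => ?_⟩
  -- `P = Bᵀ B`, and the convex body is the cube `‖B x‖_∞ < r`
  obtain ⟨B, hB⟩ : ∃ B : Matrix ι ι ℝ, Bᵀ * B = P := by
    have h0 : 0 ≤ P := Matrix.nonneg_iff_posSemidef.2 hP.posSemidef
    refine ⟨CFC.sqrt P, ?_⟩
    have h1 : (CFC.sqrt P).IsHermitian :=
      (Matrix.nonneg_iff_posSemidef.1 (CFC.sqrt_nonneg P)).1
    have h2 : (CFC.sqrt P)ᵀ = CFC.sqrt P := by
      have := h1.eq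
      rwa [Matrix.conjTranspose_eq_transpose_of_trivial] at this
    rw [h2]
    exact CFC.sqrt_mul_sqrt_self P h0
  have hdetB : B.det ^ 2 = P.det := by rw [← hB, Matrix.det_mul, Matrix.det_transpose, sq]
  have hB0 : B.det ≠ 0 := by
    intro h
    rw [h] at hdetB
    exact hP.det_pos.ne (by simpa using hdetB)
  have hBr : |B.det| < r ^ Fintype.card ι := by
    have h1 : |B.det| ≤ √Δ := by
      apply Real.abs_le_sqrt
      rw [hdetB]; exact hdet
    calc |B.det| < r := by rw [hr]; linarith
      _ ≤ r ^ Fintype.card ι := le_self_pow₀ hr1 Fintype.card_ne_zero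
  let s : Set (ι → ℝ) := (Matrix.toLin' B) ⁻¹' (Set.univ.pi fun _ => Set.Ioo (-r) r)
  have hvol : volume s = ENNReal.ofReal |B.det|⁻¹ * ENNReal.ofReal (2 * r) ^ Fintype.card ι := by
    rw [Measure.addHaar_preimage_linearMap volume (by rwa [LinearMap.det_toLin']),
      LinearMap.det_toLin', volume_pi_pi]
    simp only [Real.volume_Ioo, Finset.prod_const, Finset.card_univ, abs_inv]
    congr 3
    ring
  have hfd := ZSpan.isAddFundamentalDomain (Pi.basisFun ℝ ι) volume
  have hF : volume (ZSpan.fundamentalDomain (Pi.basisFun ℝ ι)) = 1 := by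
    rw [ZSpan.fundamentalDomain_pi_basisFun, volume_pi_pi]
    simp
  have hcount : Countable (Submodule.span ℤ (Set.range (Pi.basisFun ℝ ι))).toAddSubgroup :=
    inferInstanceAs (Countable (Submodule.span ℤ (Set.range (Pi.basisFun ℝ ι))))
  obtain ⟨⟨x, hx⟩, hx0, hxs⟩ := exists_ne_zero_mem_lattice_of_measure_mul_two_pow_lt_measure
    (L := (Submodule.span ℤ (Set.range (Pi.basisFun ℝ ι))).toAddSubgroup) (s := s) hfd
    (by
      intro x hx i hi
      have := hx i hi
      simp only [map_neg, Pi.neg_apply, Set.mem_Ioo] at this ⊢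
      constructor <;> linarith [this.1, this.2])
    ((convex_pi fun i _ => convex_Ioo _ _).linear_preimage (Matrix.toLin' B)) (by
      rw [hF, hvol, one_mul, Module.finrank_fintype_fun_eq_card,
        ENNReal.ofReal_mul (by norm_num), mul_pow, ENNReal.ofReal_ofNat, mul_comm (2 ^ _),
        ← mul_assoc]
      have h1 : 1 < ENNReal.ofReal |B.det|⁻¹ * ENNReal.ofReal r ^ Fintype.card ι := by
        rw [← ENNReal.ofReal_pow (by linarith), ← ENNReal.ofReal_mul (by positivity),
          ENNReal.one_lt_ofReal, ← div_eq_inv_mul, one_lt_div (abs_pos.2 hB0)]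
        exact hBr
      calc (2 : ENNReal) ^ Fintype.card ι = 1 * 2 ^ Fintype.card ι := (one_mul _).symm
        _ < _ := ENNReal.mul_lt_mul_left (by simp) (by simp) h1)
  have hx' := ((Pi.basisFun ℝ ι).mem_span_iff_repr_mem ℤ x).1 hx
  choose m hm using hx'
  have hmx : (fun i => (m i : ℝ)) = x := by
    funext i
    simpa using hm i
  refine ⟨m, ?_, ?_⟩
  · rintro rfl
    apply hx0
    ext i
    simp [← hmx]
  · rw [hmx, ← hB, ← Matrix.mulVec_mulVec, Matrix.dotProduct_mulVec, Matrix.vecMul_transpose]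
    have h1 : ∀ i, (B *ᵥ x) i * (B *ᵥ x) i ≤ r ^ 2 := by
      intro i
      have := hxs i (Set.mem_univ i)
      simp only [Matrix.toLin'_apply, Set.mem_Ioo] at this
      rw [← sq]
      exact sq_le_sq' this.1.le this.2.le
    calc ∑ i, (B *ᵥ x) i * (B *ᵥ x) i ≤ ∑ _i : ι, r ^ 2 := Finset.sum_le_sum fun i _ => h1 i
      _ = _ := by simp

/-- The trace to `ℚ` is the sum over the complex embeddings. -/
theorem trace_eq_sum_complexEmbeddings (K : Type*) [Field K] [NumberField K] (x : K) :
    ((Algebra.trace ℚ K x : ℚ) : ℂ) = ∑ τ : K →+* ℂ, τ x := by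
  rw [← eq_ratCast (algebraMap ℚ ℂ), trace_eq_sum_embeddings ℂ]
  exact (Fintype.sum_equiv (RingHom.equivRatAlgHom K ℂ) (fun τ => τ x) (fun τ => τ x)
    fun _ => rfl).symm

/-- If the form `(x, y) ↦ tr_{K/ℚ}(ξ x ȳ)` has bounded determinant on the lattice spanned by the
`b i`, then this lattice has a nonzero vector that is short for the definite form
`∑_τ |τ ξ| |τ x|²`. The two forms have the same determinant up to sign. -/
theorem exists_short_vector (K ι : Type*) [Field K] [NumberField K] [IsCMField K] [Fintype ι]
    [DecidableEq ι] [Nonempty ι] (Δ : ℝ) :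
    ∃ C : ℝ, ∀ (ξ : K) (b : ι → K), Fintype.card ι = Module.finrank ℚ K →
      (Matrix.of fun i j => Algebra.trace ℚ K (ξ * b i * conjF K (b j))).det ≠ 0 →
      |(((Matrix.of fun i j => Algebra.trace ℚ K (ξ * b i * conjF K (b j))).det : ℚ) : ℝ)| ≤ Δ →
      ∃ m : ι → ℤ, m ≠ 0 ∧ ∑ τ : K →+* ℂ, ‖τ ξ‖ * ‖τ (∑ i, (m i : K) * b i)‖ ^ 2 ≤ C := by
  obtain ⟨C, hC⟩ := exists_int_vec_dotProduct_le ι Δ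
  refine ⟨C, fun ξ b hcard h0 hΔ => ?_⟩
  set S : Matrix ι ι ℚ := Matrix.of fun i j => Algebra.trace ℚ K (ξ * b i * conjF K (b j)) with hS
  have e : ι ≃ (K →+* ℂ) := Fintype.equivOfCardEq (by rw [hcard, NumberField.Embeddings.card])
  -- with `M` the matrix of conjugates, the Gram matrices of the two forms are `Mᵀ diag(τ ξ) M̄` and
  -- `Mᵀ diag(|τ ξ|) M̄`
  let M : Matrix ι ι ℂ := Matrix.of fun t i => e t (b i)
  have hconj : ∀ (τ : K →+* ℂ) (x : K), τ (conjF K x) = starRingEnd ℂ (τ x) :=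
    fun τ x => embedding_conj K τ x
  have hSM : S.map (algebraMap ℚ ℂ) =
      Mᵀ * Matrix.diagonal (fun t => e t ξ) * M.map (starRingEnd ℂ) := by
    ext i j
    rw [Matrix.map_apply, eq_ratCast, hS, Matrix.of_apply, trace_eq_sum_complexEmbeddings,
      ← e.sum_comp, Matrix.mul_apply]
    refine Finset.sum_congr rfl fun t _ => ?_
    rw [Matrix.mul_diagonal, map_mul, map_mul, hconj]
    simp only [M, Matrix.transpose_apply, Matrix.of_apply, Matrix.map_apply]
    ring
  have hMconj : (M.map (starRingEnd ℂ)).det = starRingEnd ℂ M.det := by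
    rw [← RingHom.mapMatrix_apply, ← RingHom.map_det]
  have hdetS : ((S.det : ℚ) : ℂ) = M.det * (∏ t, e t ξ) * starRingEnd ℂ M.det := by
    rw [← eq_ratCast (algebraMap ℚ ℂ), RingHom.map_det, RingHom.mapMatrix_apply, hSM,
      Matrix.det_mul, Matrix.det_mul, Matrix.det_transpose, Matrix.det_diagonal, hMconj]
  have hM0 : M.det ≠ 0 := by
    intro h
    rw [h, zero_mul, zero_mul] at hdetS
    exact h0 (by exact_mod_cast hdetS)
  have hξ0 : ξ ≠ 0 := by
    rintro rfl
    simp only [map_zero, Finset.prod_const, Finset.card_univ, zero_pow Fintype.card_ne_zero,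
      mul_zero, zero_mul] at hdetS
    exact h0 (by exact_mod_cast hdetS)
  let P : Matrix ι ι ℝ := Matrix.of fun i j =>
    (∑ τ : K →+* ℂ, (‖τ ξ‖ : ℂ) * τ (b i) * starRingEnd ℂ (τ (b j))).re
  have hPreal : ∀ i j, ((P i j : ℝ) : ℂ) =
      ∑ τ : K →+* ℂ, (‖τ ξ‖ : ℂ) * τ (b i) * starRingEnd ℂ (τ (b j)) := by
    intro i j
    refine Complex.conj_eq_iff_re.1 ?_
    rw [map_sum]
    refine Fintype.sum_equiv
      (Function.Involutive.toPerm _ (ComplexEmbedding.involutive_conjugate K)) _ _ fun τ => ?_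
    simp only [Function.Involutive.coe_toPerm, ComplexEmbedding.conjugate_coe_eq, map_mul,
      Complex.conj_ofReal, RCLike.norm_conj]
  have hPM : P.map (algebraMap ℝ ℂ) =
      Mᵀ * Matrix.diagonal (fun t => (‖e t ξ‖ : ℂ)) * M.map (starRingEnd ℂ) := by
    ext i j
    rw [Matrix.map_apply]
    refine (hPreal i j).trans ?_
    rw [← e.sum_comp, Matrix.mul_apply]
    refine Finset.sum_congr rfl fun t _ => ?_
    rw [Matrix.mul_diagonal]
    simp only [M, Matrix.transpose_apply, Matrix.of_apply, Matrix.map_apply]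
    ring
  have hdetP : ((P.det : ℝ) : ℂ) = M.det * (∏ t, (‖e t ξ‖ : ℂ)) * starRingEnd ℂ M.det := by
    have : ((P.det : ℝ) : ℂ) = algebraMap ℝ ℂ P.det := rfl
    rw [this, RingHom.map_det, RingHom.mapMatrix_apply, hPM,
      Matrix.det_mul, Matrix.det_mul, Matrix.det_transpose, Matrix.det_diagonal, hMconj]
  have hdetPS : P.det = |((S.det : ℚ) : ℝ)| := by
    have h1 : P.det = ‖M.det‖ ^ 2 * ∏ t, ‖e t ξ‖ := by
      have : ((P.det : ℝ) : ℂ) = ((‖M.det‖ ^ 2 * ∏ t, ‖e t ξ‖ : ℝ) : ℂ) := by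
        rw [hdetP, mul_right_comm, Complex.mul_conj, Complex.normSq_eq_norm_sq]
        push_cast; ring
      exact_mod_cast this
    have h2 : |((S.det : ℚ) : ℝ)| = ‖((S.det : ℚ) : ℂ)‖ := by
      rw [← Complex.ofReal_ratCast, Complex.norm_real, Real.norm_eq_abs]
    rw [h2, hdetS, norm_mul, norm_mul, norm_prod, Complex.norm_conj, h1]
    ring
  have hquad : ∀ x : ι → ℝ, x ⬝ᵥ (P *ᵥ x) =
      ∑ τ : K →+* ℂ, ‖τ ξ‖ * ‖∑ i, (x i : ℂ) * τ (b i)‖ ^ 2 := by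
    intro x
    have h1 : ((x ⬝ᵥ (P *ᵥ x) : ℝ) : ℂ) =
        ((∑ τ : K →+* ℂ, ‖τ ξ‖ * ‖∑ i, (x i : ℂ) * τ (b i)‖ ^ 2 : ℝ) : ℂ) := by
      have hl : ((x ⬝ᵥ (P *ᵥ x) : ℝ) : ℂ) = ∑ i, ∑ j, ∑ τ : K →+* ℂ,
          (x i : ℂ) * ((‖τ ξ‖ : ℂ) * τ (b i) * starRingEnd ℂ (τ (b j)) * x j) := by
        simp only [dotProduct, Matrix.mulVec, Complex.ofReal_sum, Complex.ofReal_mul, hPreal,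
          Finset.mul_sum, Finset.sum_mul]
      have hr : ∀ τ : K →+* ℂ, ((‖τ ξ‖ * ‖∑ i, (x i : ℂ) * τ (b i)‖ ^ 2 : ℝ) : ℂ) = ∑ i, ∑ j,
          (x i : ℂ) * ((‖τ ξ‖ : ℂ) * τ (b i) * starRingEnd ℂ (τ (b j)) * x j) := by
        intro τ
        rw [← Complex.normSq_eq_norm_sq, Complex.ofReal_mul, ← Complex.mul_conj, map_sum,
          Finset.sum_mul_sum, Finset.mul_sum]
        refine Finset.sum_congr rfl fun i _ => ?_
        rw [Finset.mul_sum]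
        refine Finset.sum_congr rfl fun j _ => ?_
        rw [map_mul, Complex.conj_ofReal]
        ring
      rw [hl, Complex.ofReal_sum, Finset.sum_congr rfl fun τ _ => hr τ]
      exact (Finset.sum_congr rfl fun i _ => Finset.sum_comm).trans Finset.sum_comm
    exact_mod_cast h1
  have hPpos : P.PosDef := by
    apply Matrix.PosDef.of_dotProduct_mulVec_pos
    · ext i j
      rw [Matrix.conjTranspose_apply, star_trivial]
      have h1 : ((P j i : ℝ) : ℂ) = ((P i j : ℝ) : ℂ) := by
        rw [← Complex.conj_ofReal, hPreal, hPreal, map_sum]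
        refine Finset.sum_congr rfl fun τ _ => ?_
        simp only [map_mul, Complex.conj_ofReal, Complex.conj_conj]
        ring
      exact_mod_cast h1
    · intro x hx
      rw [star_trivial, hquad]
      refine (Finset.sum_nonneg fun τ _ => by positivity).lt_of_ne' fun h => hx ?_
      rw [Finset.sum_eq_zero_iff_of_nonneg (fun τ _ => by positivity)] at h
      have h2 : M *ᵥ (fun i => (x i : ℂ)) = 0 := by
        funext t
        have h3 := h (e t) (Finset.mem_univ _)
        rw [mul_eq_zero, norm_eq_zero, map_eq_zero, or_iff_right hξ0, sq_eq_zero_iff,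
          norm_eq_zero] at h3
        rw [Pi.zero_apply, ← h3]
        exact Finset.sum_congr rfl fun i _ => mul_comm _ _
      have h4 := Matrix.eq_zero_of_mulVec_eq_zero hM0 h2
      funext i
      exact Complex.ofReal_eq_zero.1 (congrFun h4 i)
  obtain ⟨m, hm0, hm⟩ := hC P hPpos (by rw [hdetPS]; exact hΔ)
  refine ⟨m, hm0, ?_⟩
  rw [hquad] at hm
  refine le_of_eq_of_le (Finset.sum_congr rfl fun τ _ => ?_) hm
  simp only [map_sum, map_mul, map_intCast, Complex.ofReal_intCast]

/-! ### Hermitian spaces over `ℂ` -/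

theorem herm_single {n : ℕ} {R : Type*} [CommRing R] (c : R →+* R) (J : Matrix (Fin n) (Fin n) R)
    (i j : Fin n) : herm c J (Pi.single i 1) (Pi.single j 1) = J i j := by
  have h : (fun k => c ((Pi.single j 1 : Fin n → R) k)) = Pi.single j 1 := by
    funext k
    rw [Pi.single_apply]
    split_ifs with hk
    · subst hk; simp
    · simp
  rw [herm, h]
  simp

theorem herm_re_eq_sum {n : ℕ} {H : Matrix (Fin n) (Fin n) ℂ} {p : ℕ} {A : GL (Fin n) ℂ}
    (hA : (A.val)ᵀ * H * A.val.map (starRingEnd ℂ) =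
      Matrix.diagonal (fun i : Fin n => if (i : ℕ) < p then (1 : ℂ) else -1)) (y : Fin n → ℂ) :
    (herm (starRingEnd ℂ) H (A.val *ᵥ y) (A.val *ᵥ y)).re =
      ∑ i : Fin n, (if (i : ℕ) < p then (1 : ℝ) else -1) * ‖y i‖ ^ 2 := by
  have h1 : (fun i => starRingEnd ℂ ((A.val *ᵥ y) i)) =
      A.val.map (starRingEnd ℂ) *ᵥ (fun i => starRingEnd ℂ (y i)) := by
    funext i
    simp [Matrix.mulVec, dotProduct, map_sum, map_mul]
  unfold herm
  rw [h1, ← Matrix.vecMul_transpose, ← Matrix.dotProduct_mulVec, Matrix.mulVec_mulVec,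
    Matrix.mulVec_mulVec, hA]
  simp only [dotProduct, Matrix.mulVec_diagonal, Complex.re_sum]
  refine Finset.sum_congr rfl fun i _ => ?_
  have h2 : y i * ((if (i : ℕ) < p then (1 : ℂ) else -1) * starRingEnd ℂ (y i)) =
      (((if (i : ℕ) < p then (1 : ℝ) else -1) * ‖y i‖ ^ 2 : ℝ) : ℂ) := by
    rw [mul_left_comm, Complex.mul_conj, Complex.normSq_eq_norm_sq]
    split_ifs <;> simp
  rw [h2, Complex.ofReal_re]

theorem HasSignature.det_ne_zero {n : ℕ} {H : Matrix (Fin n) (Fin n) ℂ} {p : ℕ}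
    (h : HasSignature H p) : H.det ≠ 0 := by
  obtain ⟨A, hA⟩ := h
  intro h0
  have := congrArg Matrix.det hA
  rw [Matrix.det_mul, Matrix.det_mul, h0, mul_zero, zero_mul, Matrix.det_diagonal] at this
  refine Finset.prod_ne_zero_iff.2 (fun i _ => ?_) this.symm
  split_ifs <;> norm_num

theorem HasSignature.pos {n : ℕ} {H : Matrix (Fin n) (Fin n) ℂ} (h : HasSignature H n)
    {y : Fin n → ℂ} (hy : y ≠ 0) : 0 < (herm (starRingEnd ℂ) H y y).re := by
  obtain ⟨A, hA⟩ := h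
  obtain ⟨y, rfl⟩ : ∃ x, y = A.val *ᵥ x := ⟨(A⁻¹).val *ᵥ y, by
    rw [Matrix.mulVec_mulVec, ← Units.val_mul, mul_inv_cancel, Units.val_one, Matrix.one_mulVec]⟩
  rw [herm_re_eq_sum hA]
  have hy0 : ∃ i, y i ≠ 0 := by
    by_contra! hc
    exact hy (by rw [show y = 0 from funext hc, Matrix.mulVec_zero])
  obtain ⟨i, hi⟩ := hy0
  refine Finset.sum_pos' (fun j _ => ?_) ⟨i, Finset.mem_univ i, ?_⟩
  · rw [if_pos j.2]; positivity
  · rw [if_pos i.2]; positivity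

theorem HasSignature.exists_neg {n : ℕ} (hn : 0 < n) {H : Matrix (Fin n) (Fin n) ℂ}
    (h : HasSignature H (n - 1)) : ∃ y, (herm (starRingEnd ℂ) H y y).re < 0 := by
  obtain ⟨A, hA⟩ := h
  let i₀ : Fin n := ⟨n - 1, by omega⟩
  refine ⟨A.val *ᵥ Pi.single i₀ 1, ?_⟩
  rw [herm_re_eq_sum hA, Finset.sum_eq_single i₀]
  · simp [i₀]
  · intro j _ hj
    simp [hj]
  · simp

/-- Two vectors of a hermitian space of signature `(n - 1, 1)` have a nontrivial combination of
positive norm. -/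
theorem HasSignature.exists_pos_combination {n : ℕ} (hn : 0 < n) {H : Matrix (Fin n) (Fin n) ℂ}
    (h : HasSignature H (n - 1)) (x y : Fin n → ℂ)
    (hxy : ∀ a b : ℂ, a • x + b • y = 0 → a = 0 ∧ b = 0) :
    ∃ a b : ℂ, 0 < (herm (starRingEnd ℂ) H (a • x + b • y) (a • x + b • y)).re := by
  obtain ⟨A, hA⟩ := h
  let i₀ : Fin n := ⟨n - 1, by omega⟩
  have hAinv : ∀ x : Fin n → ℂ, A.val *ᵥ ((A⁻¹).val *ᵥ x) = x := fun x => by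
    rw [Matrix.mulVec_mulVec, ← Units.val_mul, mul_inv_cancel, Units.val_one, Matrix.one_mulVec]
  -- a combination whose last coordinate vanishes
  obtain ⟨a, b, hab, hne⟩ : ∃ a b : ℂ,
      ((A⁻¹).val *ᵥ (a • x + b • y)) i₀ = 0 ∧ ¬ (a = 0 ∧ b = 0) := by
    have hlin : ∀ a b : ℂ, ((A⁻¹).val *ᵥ (a • x + b • y)) i₀ =
        a * ((A⁻¹).val *ᵥ x) i₀ + b * ((A⁻¹).val *ᵥ y) i₀ := fun a b => by
      rw [Matrix.mulVec_add, Matrix.mulVec_smul, Matrix.mulVec_smul]; rfl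
    by_cases hx : ((A⁻¹).val *ᵥ x) i₀ = 0
    · exact ⟨1, 0, by rw [hlin, hx]; ring, by simp⟩
    · exact ⟨((A⁻¹).val *ᵥ y) i₀, -((A⁻¹).val *ᵥ x) i₀, by rw [hlin]; ring,
        fun h => hx (neg_eq_zero.1 h.2)⟩
  refine ⟨a, b, ?_⟩
  rw [← hAinv (a • x + b • y), herm_re_eq_sum hA]
  set t := (A⁻¹).val *ᵥ (a • x + b • y) with ht
  have ht0 : t ≠ 0 := by
    intro h0
    apply hne
    apply hxy
    rw [← hAinv (a • x + b • y), ← ht, h0, Matrix.mulVec_zero]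
  obtain ⟨i, hi⟩ := Function.ne_iff.1 ht0
  have hi' : i ≠ i₀ := by rintro rfl; exact hi hab
  refine Finset.sum_pos' (fun j _ => ?_) ⟨i, Finset.mem_univ i, ?_⟩
  · by_cases hj : j = i₀
    · rw [hj, hab]; simp
    · have : (j : ℕ) < n - 1 := by
        have h1 := j.2
        have h2 : (j : ℕ) ≠ n - 1 := fun h => hj (Fin.ext h)
        omega
      rw [if_pos this]; positivity
  · have : (i : ℕ) < n - 1 := by
      have h1 := i.2
      have h2 : (i : ℕ) ≠ n - 1 := fun h => hi' (Fin.ext h)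
      omega
    have h3 : t i ≠ 0 := hi
    rw [if_pos this]; positivity

/-! ### The `F'`-line `V'` -/

namespace HermPair

variable {F : Type*} [Field F] [NumberField F] [IsCMField F] {n : ℕ}
  {α : Polynomial F} [Fact (Irreducible α)]
  (D : HermPair F n) (δ : D.GQ) (h : δ.val.val.charpoly = α)

include h in
theorem finrank_adjoinRoot : Module.finrank F (AdjoinRoot α) = n := by
  have h0 : α ≠ 0 := (Fact.out : Irreducible α).ne_zero
  rw [(AdjoinRoot.powerBasis h0).finrank, AdjoinRoot.powerBasis_dim, ← h,
    Matrix.charpoly_natDegree_eq_dim, Fintype.card_fin]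

/-- The map `F' → V'`, `a ↦ a x₀`. -/
def actVec (x₀ : Fin n → F) : AdjoinRoot α →ₗ[F] (Fin n → F) where
  toFun a := D.actF' δ h a *ᵥ x₀
  map_add' a b := by rw [map_add, Matrix.add_mulVec]
  map_smul' c a := by
    rw [Algebra.smul_def, map_mul, actF'_algebraMap, ← Algebra.smul_def, Matrix.smul_mulVec]
    rfl

theorem actVec_injective {x₀ : Fin n → F} (hx₀ : x₀ ≠ 0) :
    Function.Injective (D.actVec δ h x₀) := by
  rw [← LinearMap.ker_eq_bot, LinearMap.ker_eq_bot']
  intro a ha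
  by_contra ha0
  apply hx₀
  have h1 : D.actF' δ h a⁻¹ *ᵥ (D.actF' δ h a *ᵥ x₀) = x₀ := by
    rw [Matrix.mulVec_mulVec, ← map_mul, inv_mul_cancel₀ ha0, map_one, Matrix.one_mulVec]
  have h2 : D.actF' δ h a *ᵥ x₀ = 0 := ha
  rw [← h1, h2, Matrix.mulVec_zero]

/-- A nonzero vector `x₀` identifies `V'` with `F'`. -/
def vecEquiv {x₀ : Fin n → F} (hx₀ : x₀ ≠ 0) : AdjoinRoot α ≃ₗ[F] (Fin n → F) :=
  LinearEquiv.ofInjectiveOfFinrankEq (D.actVec δ h x₀) (D.actVec_injective δ h hx₀)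
    (by rw [finrank_adjoinRoot D δ h]; simp)

theorem vecEquiv_apply {x₀ : Fin n → F} (hx₀ : x₀ ≠ 0) (a : AdjoinRoot α) :
    D.vecEquiv δ h hx₀ a = D.actF' δ h a *ᵥ x₀ := rfl

theorem vecEquiv_mul {x₀ : Fin n → F} (hx₀ : x₀ ≠ 0) (a b : AdjoinRoot α) :
    D.vecEquiv δ h hx₀ (a * b) = D.actF' δ h a *ᵥ D.vecEquiv δ h hx₀ b := by
  rw [vecEquiv_apply, vecEquiv_apply, Matrix.mulVec_mulVec, map_mul]

theorem vecEquiv_root_mul {x₀ : Fin n → F} (hx₀ : x₀ ≠ 0) (b : AdjoinRoot α) :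
    D.vecEquiv δ h hx₀ (AdjoinRoot.root α * b) = δ.val.val *ᵥ D.vecEquiv δ h hx₀ b := by
  rw [vecEquiv_mul, actF'_root]

section Hermitian

variable [IsCMField (AdjoinRoot α)]
  (hroot : conjF (AdjoinRoot α) (AdjoinRoot.root α) = (AdjoinRoot.root α)⁻¹)

include hroot in
theorem herm_vecEquiv {x₀ : Fin n → F} (hx₀ : x₀ ≠ 0) (a b : AdjoinRoot α) :
    herm (conjF F) D.J' (D.vecEquiv δ h hx₀ a) (D.vecEquiv δ h hx₀ b) =
      Algebra.trace F (AdjoinRoot α) (a * conjF _ b * D.refinedForm δ h x₀ x₀) := by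
  rw [trace_mul_refinedForm, mul_comm a, map_mul, ← Matrix.mulVec_mulVec,
    D.herm_actF' δ h hroot b]
  rfl

include hroot in
theorem refinedForm_vecEquiv {x₀ : Fin n → F} (hx₀ : x₀ ≠ 0) (a : AdjoinRoot α) :
    D.refinedForm δ h (D.vecEquiv δ h hx₀ a) (D.vecEquiv δ h hx₀ a) =
      a * conjF _ a * D.refinedForm δ h x₀ x₀ := by
  apply ((Algebra.traceForm F (AdjoinRoot α)).toDual
    (traceForm_nondegenerate F (AdjoinRoot α))).injective
  ext c
  change Algebra.trace F (AdjoinRoot α) (_ * c) = Algebra.trace F (AdjoinRoot α) (_ * c)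
  rw [mul_comm _ c, mul_comm _ c, trace_mul_refinedForm, ← vecEquiv_mul,
    D.herm_vecEquiv δ h hroot]
  congr 1
  ring

end Hermitian

/-! ### Diagonalization at a complex place -/

/-- The complex embeddings of `F'` that extend `w`. -/
abbrev EmbOver (α : Polynomial F) [Fact (Irreducible α)] (w : F →+* ℂ) : Type _ :=
  {τ : AdjoinRoot α →+* ℂ // τ.comp (algebraMap F (AdjoinRoot α)) = w}

instance (w : F →+* ℂ) : Fintype (EmbOver α w) := Fintype.ofFinite _

/-- Embeddings extending `w` as homomorphisms of `F`-algebras. -/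
def embOverEquiv (w : F →+* ℂ) :
    letI := w.toAlgebra
    EmbOver α w ≃ (AdjoinRoot α →ₐ[F] ℂ) :=
  letI := w.toAlgebra
  { toFun := fun τ => { τ.1 with commutes' := fun x => congrArg (fun f : F →+* ℂ => f x) τ.2 }
    invFun := fun σ => ⟨σ.toRingHom, RingHom.ext fun x => σ.commutes x⟩
    left_inv := fun _ => rfl
    right_inv := fun _ => rfl }

include h in
theorem card_embOver (w : F →+* ℂ) : Fintype.card (EmbOver α w) = n := by
  let := w.toAlgebra
  rw [Fintype.card_congr (embOverEquiv (α := α) w), AlgHom.card, finrank_adjoinRoot D δ h]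

omit [IsCMField F] in
theorem map_trace_eq_sum (w : F →+* ℂ) (x : AdjoinRoot α) :
    w (Algebra.trace F (AdjoinRoot α) x) = ∑ τ : EmbOver α w, τ.1 x := by
  let := w.toAlgebra
  have h1 := trace_eq_sum_embeddings (K := F) (L := AdjoinRoot α) ℂ (x := x)
  refine h1.trans ?_
  exact (Fintype.sum_equiv (embOverEquiv (α := α) w) (fun τ => τ.1 x) (fun σ => σ x)
    fun _ => rfl).symm

/-- The coordinate of `V' ⊗_{F,w} ℂ = ∏_τ ℂ` at the embedding `τ` of `F'`. -/
def coordAt {x₀ : Fin n → F} (hx₀ : x₀ ≠ 0) (τ : AdjoinRoot α →+* ℂ) : (Fin n → ℂ) →ₗ[ℂ] ℂ :=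
  Fintype.linearCombination ℂ fun i => τ ((D.vecEquiv δ h hx₀).symm (Pi.single i 1))

theorem coordAt_apply {x₀ : Fin n → F} (hx₀ : x₀ ≠ 0) (τ : AdjoinRoot α →+* ℂ) (y : Fin n → ℂ) :
    D.coordAt δ h hx₀ τ y = ∑ i, y i * τ ((D.vecEquiv δ h hx₀).symm (Pi.single i 1)) := by
  simp [coordAt, Fintype.linearCombination_apply]

theorem coordAt_map {x₀ : Fin n → F} (hx₀ : x₀ ≠ 0) {w : F →+* ℂ} (τ : EmbOver α w)
    (x : Fin n → F) :
    D.coordAt δ h hx₀ τ.1 (fun i => w (x i)) = τ.1 ((D.vecEquiv δ h hx₀).symm x) := by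
  conv_rhs => rw [pi_eq_sum_univ' x]
  rw [coordAt_apply, map_sum, map_sum]
  refine Finset.sum_congr rfl fun i _ => ?_
  rw [map_smul, Algebra.smul_def, map_mul]
  have h2 : τ.1 (algebraMap F _ (x i)) = w (x i) := congrArg (fun f : F →+* ℂ => f (x i)) τ.2
  rw [h2]

theorem coordAt_mulVec {x₀ : Fin n → F} (hx₀ : x₀ ≠ 0) {w : F →+* ℂ} (τ : EmbOver α w)
    (y : Fin n → ℂ) :
    D.coordAt δ h hx₀ τ.1 (δ.val.val.map w *ᵥ y) =
      τ.1 (AdjoinRoot.root α) * D.coordAt δ h hx₀ τ.1 y := by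
  have h1 : (D.coordAt δ h hx₀ τ.1).comp (Matrix.mulVecLin (δ.val.val.map w)) =
      τ.1 (AdjoinRoot.root α) • D.coordAt δ h hx₀ τ.1 := by
    refine (Pi.basisFun ℂ (Fin n)).ext fun i => ?_
    have h2 : (Pi.basisFun ℂ (Fin n)) i = fun j => w ((Pi.single i 1 : Fin n → F) j) := by
      funext j
      rw [Pi.basisFun_apply, Pi.single_apply, Pi.single_apply]
      split_ifs <;> simp
    have h3 : δ.val.val.map w *ᵥ (fun j => w ((Pi.single i 1 : Fin n → F) j)) =
        fun j => w ((δ.val.val *ᵥ Pi.single i 1) j) := by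
      funext j
      simp [Matrix.mulVec, dotProduct, map_sum, map_mul]
    rw [h2, LinearMap.comp_apply, Matrix.mulVecLin_apply, h3, coordAt_map, LinearMap.smul_apply,
      coordAt_map, smul_eq_mul, ← map_mul]
    congr 1
    rw [LinearEquiv.symm_apply_eq, vecEquiv_root_mul, LinearEquiv.apply_symm_apply]
  exact congrArg (fun f : (Fin n → ℂ) →ₗ[ℂ] ℂ => f y) h1

theorem herm_eq_sum_coordAt [IsCMField (AdjoinRoot α)]
    (hroot : conjF (AdjoinRoot α) (AdjoinRoot.root α) = (AdjoinRoot.root α)⁻¹)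
    {x₀ : Fin n → F} (hx₀ : x₀ ≠ 0) (w : F →+* ℂ) (y y' : Fin n → ℂ) :
    herm (starRingEnd ℂ) (D.J'.map w) y y' = ∑ τ : EmbOver α w, τ.1 (D.refinedForm δ h x₀ x₀) *
      D.coordAt δ h hx₀ τ.1 y * starRingEnd ℂ (D.coordAt δ h hx₀ τ.1 y') := by
  have hJ : ∀ i j, w (D.J' i j) = ∑ τ : EmbOver α w, τ.1 (D.refinedForm δ h x₀ x₀) *
      τ.1 ((D.vecEquiv δ h hx₀).symm (Pi.single i 1)) *
        starRingEnd ℂ (τ.1 ((D.vecEquiv δ h hx₀).symm (Pi.single j 1))) := by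
    intro i j
    rw [← herm_single (conjF F) D.J' i j, ← (D.vecEquiv δ h hx₀).apply_symm_apply (Pi.single i 1),
      ← (D.vecEquiv δ h hx₀).apply_symm_apply (Pi.single j 1), D.herm_vecEquiv δ h hroot,
      map_trace_eq_sum]
    simp only [LinearEquiv.apply_symm_apply]
    refine Finset.sum_congr rfl fun τ _ => ?_
    rw [map_mul, map_mul, embedding_conj]
    ring
  simp only [herm, dotProduct, Matrix.mulVec, Matrix.map_apply, hJ, coordAt_apply]
  have hr : ∀ τ : EmbOver α w, τ.1 (D.refinedForm δ h x₀ x₀) *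
      (∑ i, y i * τ.1 ((D.vecEquiv δ h hx₀).symm (Pi.single i 1))) *
      starRingEnd ℂ (∑ j, y' j * τ.1 ((D.vecEquiv δ h hx₀).symm (Pi.single j 1))) =
      ∑ i, ∑ j, y i * (τ.1 (D.refinedForm δ h x₀ x₀) *
      τ.1 ((D.vecEquiv δ h hx₀).symm (Pi.single i 1)) *
        starRingEnd ℂ (τ.1 ((D.vecEquiv δ h hx₀).symm (Pi.single j 1))) *
          starRingEnd ℂ (y' j)) := by
    intro τ
    rw [map_sum, mul_assoc, Finset.sum_mul_sum, Finset.mul_sum]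
    refine Finset.sum_congr rfl fun i _ => ?_
    rw [Finset.mul_sum]
    refine Finset.sum_congr rfl fun j _ => ?_
    rw [map_mul]
    ring
  rw [Finset.sum_congr rfl fun τ _ => hr τ]
  simp only [Finset.mul_sum, Finset.sum_mul]
  exact (Finset.sum_congr rfl fun i _ => Finset.sum_comm).trans Finset.sum_comm

end HermPair

/-! ### The signature and the fixed line -/

theorem NegLine.line_eq_span {n : ℕ} {H : Matrix (Fin n) (Fin n) ℂ} (z : NegLine H)
    {e : Fin n → ℂ} (he : e ∈ z.line) (he0 : e ≠ 0) : z.line = Submodule.span ℂ {e} := by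
  obtain ⟨w, hw, hw0, hspan⟩ := z.exists_basis
  obtain ⟨a, ha⟩ := hspan e he
  have ha0 : a ≠ 0 := by rintro rfl; exact he0 (by rw [ha, zero_smul])
  refine le_antisymm (fun x hx => ?_) ((Submodule.span_singleton_le_iff_mem _ _).2 he)
  obtain ⟨b, hb⟩ := hspan x hx
  rw [Submodule.mem_span_singleton]
  exact ⟨b / a, by rw [ha, smul_smul, div_mul_cancel₀ _ ha0, hb]⟩

namespace HermPair

variable {F : Type*} [Field F] [NumberField F] [IsCMField F] {n : ℕ}
  {α : Polynomial F} [Fact (Irreducible α)] [IsCMField (AdjoinRoot α)]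
  (hroot : conjF (AdjoinRoot α) (AdjoinRoot.root α) = (AdjoinRoot.root α)⁻¹)
  (D : HermPair F n) (δ : D.GQ) (h : δ.val.val.charpoly = α) {x₀ : Fin n → F} (hx₀ : x₀ ≠ 0)
  {w : F →+* ℂ}

include hroot

/-- The refined invariant is real at all complex embeddings. -/
theorem embedding_refinedForm (τ : AdjoinRoot α →+* ℂ) (u : Fin n → F) :
    τ (D.refinedForm δ h u u) = ((τ (D.refinedForm δ h u u)).re : ℂ) := by
  have h1 := D.refinedForm_self_mem δ h hroot u
  rw [← IsCMField.complexConj_eq_self_iff] at h1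
  have h2 := embedding_conj (AdjoinRoot α) τ (D.refinedForm δ h u u)
  have h3 : conjF (AdjoinRoot α) (D.refinedForm δ h u u) = D.refinedForm δ h u u := h1
  rw [h3] at h2
  exact (Complex.conj_eq_iff_re.1 h2.symm).symm

theorem herm_self_re_eq_sum (y : Fin n → ℂ) :
    (herm (starRingEnd ℂ) (D.J'.map w) y y).re = ∑ τ : EmbOver α w,
      (τ.1 (D.refinedForm δ h x₀ x₀)).re * ‖D.coordAt δ h hx₀ τ.1 y‖ ^ 2 := by
  rw [D.herm_eq_sum_coordAt δ h hroot hx₀, Complex.re_sum]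
  refine Finset.sum_congr rfl fun τ _ => ?_
  rw [mul_assoc, Complex.mul_conj, Complex.normSq_eq_norm_sq, D.embedding_refinedForm hroot,
    ← Complex.ofReal_mul, Complex.ofReal_re, Complex.ofReal_re]

theorem eq_zero_of_coordAt_eq_zero (hdet : (D.J'.map w).det ≠ 0) {y : Fin n → ℂ}
    (hy : ∀ τ : EmbOver α w, D.coordAt δ h hx₀ τ.1 y = 0) : y = 0 := by
  apply Matrix.eq_zero_of_vecMul_eq_zero hdet
  funext i
  have h1 : herm (starRingEnd ℂ) (D.J'.map w) y (Pi.single i 1) = 0 := by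
    rw [D.herm_eq_sum_coordAt δ h hroot hx₀]
    exact Finset.sum_eq_zero fun τ _ => by rw [hy]; ring
  have h2 : (fun k => starRingEnd ℂ ((Pi.single i 1 : Fin n → ℂ) k)) = Pi.single i 1 := by
    funext k
    rw [Pi.single_apply]
    split_ifs with hk
    · subst hk; simp
    · simp
  rw [herm, h2, Matrix.dotProduct_mulVec] at h1
  simpa using h1

theorem exists_coordAt_eq (hdet : (D.J'.map w).det ≠ 0) (c : EmbOver α w → ℂ) :
    ∃ y, ∀ τ : EmbOver α w, D.coordAt δ h hx₀ τ.1 y = c τ := by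
  let L : (Fin n → ℂ) →ₗ[ℂ] (EmbOver α w → ℂ) := LinearMap.pi fun τ => D.coordAt δ h hx₀ τ.1
  have hinj : Function.Injective L := by
    rw [← LinearMap.ker_eq_bot, LinearMap.ker_eq_bot']
    intro y hy
    exact D.eq_zero_of_coordAt_eq_zero hroot δ h hx₀ hdet fun τ => congrFun hy τ
  have hsurj : Function.Surjective L :=
    (LinearMap.injective_iff_surjective_of_finrank_eq_finrank
      (by simp [card_embOver D δ h])).1 hinj
  obtain ⟨y, hy⟩ := hsurj c
  exact ⟨y, fun τ => congrFun hy τ⟩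

include hx₀ in
theorem refinedForm_self_ne_zero (hdet : (D.J'.map w).det ≠ 0) :
    D.refinedForm δ h x₀ x₀ ≠ 0 := by
  intro h0
  apply hdet
  have h1 : D.J'.map w = 0 := by
    ext i j
    rw [Matrix.map_apply, ← herm_single (conjF F) D.J' i j,
      ← (D.vecEquiv δ h hx₀).apply_symm_apply (Pi.single i 1),
      ← (D.vecEquiv δ h hx₀).apply_symm_apply (Pi.single j 1), D.herm_vecEquiv δ h hroot, h0,
      mul_zero, map_zero, map_zero]
    rfl
  have hn : n ≠ 0 := by
    rintro rfl
    exact hx₀ (Subsingleton.elim _ _)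
  have : Nonempty (Fin n) := ⟨⟨0, Nat.pos_of_ne_zero hn⟩⟩
  rw [h1, Matrix.det_zero]

include hx₀ in
theorem re_refinedForm_pos (hsig : HasSignature (D.J'.map w) n) (τ : EmbOver α w) :
    0 < (τ.1 (D.refinedForm δ h x₀ x₀)).re := by
  classical
  obtain ⟨y, hy⟩ := D.exists_coordAt_eq hroot δ h hx₀ hsig.det_ne_zero (Pi.single τ 1)
  have hy0 : y ≠ 0 := by
    rintro rfl
    have := hy τ
    simp at this
  have h1 := hsig.pos hy0
  rw [D.herm_self_re_eq_sum hroot δ h hx₀, Finset.sum_eq_single τ] at h1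
  · simpa [hy] using h1
  · intro σ _ hσ
    simp [hy, hσ]
  · simp

include hx₀ in
/-- Over the place `v₀`, exactly one of the `n` diagonal entries `τ(⟨x₀, x₀⟩')` is negative. -/
theorem exists_re_refinedForm_neg (hn : 0 < n) (hsig : HasSignature (D.J'.map w) (n - 1)) :
    ∃ τ₀ : EmbOver α w, (τ₀.1 (D.refinedForm δ h x₀ x₀)).re < 0 ∧
      ∀ τ : EmbOver α w, τ ≠ τ₀ → 0 < (τ.1 (D.refinedForm δ h x₀ x₀)).re := by
  classical
  have hdet := hsig.det_ne_zero
  have hne : ∀ τ : EmbOver α w, (τ.1 (D.refinedForm δ h x₀ x₀)).re ≠ 0 := by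
    intro τ h0
    have h1 := D.embedding_refinedForm hroot δ h τ.1 x₀
    rw [h0, Complex.ofReal_zero, map_eq_zero] at h1
    exact D.refinedForm_self_ne_zero hroot δ h hx₀ hdet h1
  obtain ⟨y, hy⟩ := hsig.exists_neg hn
  rw [D.herm_self_re_eq_sum hroot δ h hx₀] at hy
  obtain ⟨τ₀, hτ₀⟩ : ∃ τ₀ : EmbOver α w, (τ₀.1 (D.refinedForm δ h x₀ x₀)).re < 0 := by
    by_contra! hc
    exact absurd hy (not_lt.2 (Finset.sum_nonneg fun τ _ => mul_nonneg (hc τ) (by positivity)))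
  refine ⟨τ₀, hτ₀, fun τ hτ => ?_⟩
  by_contra hneg
  have hneg' : (τ.1 (D.refinedForm δ h x₀ x₀)).re < 0 := lt_of_le_of_ne (not_lt.1 hneg) (hne τ)
  -- two negative entries would give a negative definite plane
  obtain ⟨x, hx⟩ := D.exists_coordAt_eq hroot δ h hx₀ hdet (Pi.single τ₀ 1)
  obtain ⟨x', hx'⟩ := D.exists_coordAt_eq hroot δ h hx₀ hdet (Pi.single τ 1)
  have hcomb : ∀ (a b : ℂ) (σ : EmbOver α w), D.coordAt δ h hx₀ σ.1 (a • x + b • x') =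
      a * (Pi.single τ₀ 1 : EmbOver α w → ℂ) σ + b * (Pi.single τ 1 : EmbOver α w → ℂ) σ := by
    intro a b σ
    rw [map_add, map_smul, map_smul, hx, hx', smul_eq_mul, smul_eq_mul]
  obtain ⟨a, b, hab⟩ := hsig.exists_pos_combination hn x x' (fun a b hab => by
    have h1 := hcomb a b τ₀
    have h2 := hcomb a b τ
    rw [hab, map_zero] at h1 h2
    simp [hτ, hτ.symm] at h1 h2
    exact ⟨h1.symm ▸ rfl, h2.symm ▸ rfl⟩)
  rw [D.herm_self_re_eq_sum hroot δ h hx₀] at hab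
  refine absurd hab (not_lt.2 (Finset.sum_nonpos fun σ _ => ?_))
  by_cases h1 : σ = τ₀
  · subst h1
    exact mul_nonpos_of_nonpos_of_nonneg hτ₀.le (by positivity)
  · by_cases h2 : σ = τ
    · subst h2
      exact mul_nonpos_of_nonpos_of_nonneg hneg'.le (by positivity)
    · rw [hcomb]
      simp [h1, h2]

omit hroot [IsCMField (AdjoinRoot α)] [IsCMField F] [NumberField F] in
/-- The eigenvalues `τ(T)` of `δ` are distinct. -/
theorem EmbOver.eq_of_root {w : F →+* ℂ} {τ σ : EmbOver α w}
    (hτσ : τ.1 (AdjoinRoot.root α) = σ.1 (AdjoinRoot.root α)) : τ = σ := by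
  apply Subtype.ext
  apply AdjoinRoot.ringHom_ext
  · exact τ.2.trans σ.2.symm
  · exact hτσ

/-- A line fixed by `δ` is the eigenline of the embedding at which the form is negative. -/
theorem exists_mem_line_of_fixed {τ₀ : EmbOver α w}
    (hτ₀ : ∀ τ : EmbOver α w, τ ≠ τ₀ → 0 < (τ.1 (D.refinedForm δ h x₀ x₀)).re)
    (hdet : (D.J'.map w).det ≠ 0) (z : NegLine (D.J'.map w)) (hz : D.actLine w δ z = z) :
    ∃ e ∈ z.line, e ≠ 0 ∧ D.coordAt δ h hx₀ τ₀.1 e ≠ 0 ∧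
      ∀ τ : EmbOver α w, τ ≠ τ₀ → D.coordAt δ h hx₀ τ.1 e = 0 := by
  obtain ⟨e, he, he0, hspan⟩ := z.exists_basis
  have h1 : δ.val.val.map w *ᵥ e ∈ z.line := by
    have h2 : δ.val.val.map w *ᵥ e ∈ (D.actLine w δ z).line := ⟨e, he, rfl⟩
    rwa [hz] at h2
  obtain ⟨c, hc⟩ := hspan _ h1
  -- the eigenvalues `τ(T)` of `δ` are distinct, so that only one coordinate of `e` is nonzero
  have hev : ∀ τ : EmbOver α w, D.coordAt δ h hx₀ τ.1 e ≠ 0 → τ.1 (AdjoinRoot.root α) = c := by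
    intro τ hτ
    have h2 := D.coordAt_mulVec δ h hx₀ τ e
    rw [hc, map_smul, smul_eq_mul] at h2
    exact (mul_right_cancel₀ hτ h2).symm
  obtain ⟨σ, hσ⟩ : ∃ σ : EmbOver α w, D.coordAt δ h hx₀ σ.1 e ≠ 0 := by
    by_contra! hcon
    exact he0 (D.eq_zero_of_coordAt_eq_zero hroot δ h hx₀ hdet hcon)
  have hother : ∀ τ : EmbOver α w, τ ≠ σ → D.coordAt δ h hx₀ τ.1 e = 0 := by
    intro τ hτ
    by_contra hcon
    exact hτ (EmbOver.eq_of_root ((hev τ hcon).trans (hev σ hσ).symm))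
  -- the other eigenlines are positive
  have hστ : σ = τ₀ := by
    by_contra hcon
    have h2 := z.neg e he he0
    rw [D.herm_self_re_eq_sum hroot δ h hx₀, Finset.sum_eq_single σ
      (fun τ _ hτ => by rw [hother τ hτ]; simp) (by simp)] at h2
    exact absurd h2 (not_lt.2 (mul_nonneg (hτ₀ σ hcon).le (by positivity)))
  subst hστ
  exact ⟨e, he, he0, hσ, hother⟩

include h in
/-- `δ` has a unique fixed point on the space of negative lines. -/
theorem existsUnique_fixed_line (hn : 0 < n) (hsig : HasSignature (D.J'.map w) (n - 1)) :
    ∃! z : NegLine (D.J'.map w), D.actLine w δ z = z := by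
  classical
  have hx₀ : (Pi.single ⟨0, hn⟩ 1 : Fin n → F) ≠ 0 := by simp
  have hdet := hsig.det_ne_zero
  obtain ⟨τ₀, hneg, hpos⟩ := D.exists_re_refinedForm_neg hroot δ h hx₀ hn hsig
  -- `e` spans the eigenline of `τ₀`
  obtain ⟨e, he⟩ := D.exists_coordAt_eq hroot δ h hx₀ hdet (Pi.single τ₀ 1)
  have he0 : e ≠ 0 := by
    rintro rfl
    have := he τ₀
    simp at this
  have hδe : δ.val.val.map w *ᵥ e = τ₀.1 (AdjoinRoot.root α) • e := by
    rw [← sub_eq_zero]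
    apply D.eq_zero_of_coordAt_eq_zero hroot δ h hx₀ hdet
    intro τ
    rw [map_sub, coordAt_mulVec, map_smul, he, smul_eq_mul]
    by_cases hτ : τ = τ₀
    · subst hτ; ring
    · simp [hτ]
  have hr0 : τ₀.1 (AdjoinRoot.root α) ≠ 0 := by
    intro h0
    rw [h0, zero_smul] at hδe
    have h1 := congrArg (fun v => ((δ.val⁻¹).val.map w) *ᵥ v) hδe
    simp only [Matrix.mulVec_mulVec, ← Matrix.map_mul, ← Units.val_mul, inv_mul_cancel,
      Units.val_one, Matrix.mulVec_zero] at h1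
    rw [Matrix.map_one _ (map_zero w) (map_one w), Matrix.one_mulVec] at h1
    exact he0 h1
  refine ⟨⟨Submodule.span ℂ {e}, finrank_span_singleton he0, ?_⟩, ?_, ?_⟩
  · intro x hx hx0
    obtain ⟨c, rfl⟩ := Submodule.mem_span_singleton.1 hx
    have hc : c ≠ 0 := by rintro rfl; exact hx0 (zero_smul _ _)
    rw [D.herm_self_re_eq_sum hroot δ h hx₀, Finset.sum_eq_single τ₀
      (fun τ _ hτ => by simp [he, hτ]) (by simp), map_smul, he]
    have : 0 < ‖c • (Pi.single τ₀ 1 : EmbOver α w → ℂ) τ₀‖ ^ 2 := by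
      simp only [Pi.single_eq_same, smul_eq_mul, mul_one]
      positivity
    exact mul_neg_of_neg_of_pos hneg this
  · apply NegLine.ext
    change (Submodule.span ℂ {e}).map (Matrix.mulVecLin (δ.val.val.map w)) = Submodule.span ℂ {e}
    rw [Submodule.map_span, Set.image_singleton, Matrix.mulVecLin_apply, hδe]
    exact Submodule.span_singleton_smul_eq (IsUnit.mk0 _ hr0) e
  · intro z hz
    obtain ⟨e', he', he'0, -, hother⟩ :=
      D.exists_mem_line_of_fixed hroot δ h hx₀ hpos hdet z hz
    apply NegLine.ext
    have h1 : e' = D.coordAt δ h hx₀ τ₀.1 e' • e := by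
      rw [← sub_eq_zero]
      apply D.eq_zero_of_coordAt_eq_zero hroot δ h hx₀ hdet
      intro τ
      rw [map_sub, map_smul, he, smul_eq_mul]
      by_cases hτ : τ = τ₀
      · subst hτ; simp
      · simp [hτ, hother τ hτ]
    change z.line = Submodule.span ℂ {e}
    rw [z.line_eq_span he' he'0, h1]
    refine Submodule.span_singleton_smul_eq (IsUnit.mk0 _ fun h0 => he'0 ?_) e
    rw [h1, h0, zero_smul]

include h in
/-- The fixed line of `δ` is not orthogonal to any nonzero rational vector `u`: in the coordinates
given by `u` itself, `u` is `(1, …, 1)`. -/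
theorem not_perp_of_fixed (hn : 0 < n) (hsig : HasSignature (D.J'.map w) (n - 1))
    (z : NegLine (D.J'.map w)) (hz : D.actLine w δ z = z) (u : Fin n → F) (hu : u ≠ 0) :
    ¬ z.Perp (fun i => w (u i)) := by
  have hdet := hsig.det_ne_zero
  obtain ⟨τ₀, hneg, hpos⟩ := D.exists_re_refinedForm_neg hroot δ h hu hn hsig
  obtain ⟨e, he, he0, hc, hother⟩ := D.exists_mem_line_of_fixed hroot δ h hu hpos hdet z hz
  intro hperp
  have h1 := hperp e he
  rw [D.herm_eq_sum_coordAt δ h hroot hu, Finset.sum_eq_single τ₀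
    (fun τ _ hτ => by rw [hother τ hτ]; simp) (by simp), coordAt_map] at h1
  have h2 : (D.vecEquiv δ h hu).symm u ≠ 0 := by simpa using hu
  have h3 : D.refinedForm δ h u u ≠ 0 := D.refinedForm_self_ne_zero hroot δ h hu hdet
  rcases mul_eq_zero.1 h1 with h4 | h4
  · rcases mul_eq_zero.1 h4 with h5 | h5
    · exact h3 ((map_eq_zero _).1 h5)
    · exact h2 ((map_eq_zero _).1 h5)
  · exact hc ((map_eq_zero _).1 h4)

include hx₀ in
/-- `R(u, z_δ)` is the value of the refined invariant at the negative embedding. -/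
theorem RFun_eq_re_refinedForm {τ₀ : EmbOver α w}
    (hneg : (τ₀.1 (D.refinedForm δ h x₀ x₀)).re < 0)
    (hpos : ∀ τ : EmbOver α w, τ ≠ τ₀ → 0 < (τ.1 (D.refinedForm δ h x₀ x₀)).re)
    (hdet : (D.J'.map w).det ≠ 0) (z : NegLine (D.J'.map w)) (hz : D.actLine w δ z = z)
    (u : Fin n → F) :
    RFun (fun i => w (u i)) z = (τ₀.1 (D.refinedForm δ h u u)).re := by
  obtain ⟨e, he, he0, hc, hother⟩ := D.exists_mem_line_of_fixed hroot δ h hx₀ hpos hdet z hz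
  rw [RFun_eq _ z e he he0, D.herm_self_re_eq_sum hroot δ h hx₀ e,
    D.herm_eq_sum_coordAt δ h hroot hx₀, Finset.sum_eq_single τ₀
    (fun τ _ hτ => by rw [hother τ hτ]; simp) (by simp), Finset.sum_eq_single τ₀
    (fun τ _ hτ => by rw [hother τ hτ]; simp) (by simp), coordAt_map, norm_mul, norm_mul,
    Complex.norm_conj]
  obtain ⟨a, rfl⟩ := (D.vecEquiv δ h hx₀).surjective u
  rw [LinearEquiv.symm_apply_apply, D.refinedForm_vecEquiv δ h hroot, map_mul, map_mul,
    embedding_conj, Complex.mul_conj, Complex.normSq_eq_norm_sq,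
    D.embedding_refinedForm hroot δ h τ₀.1 x₀, Complex.norm_real, Real.norm_eq_abs,
    Complex.ofReal_re, ← Complex.ofReal_mul, Complex.ofReal_re, mul_pow, mul_pow, sq_abs]
  have hc2 : ‖D.coordAt δ h hx₀ τ₀.1 e‖ ^ 2 ≠ 0 := by positivity
  field_simp [hneg.ne]

end HermPair

/-! ### The refined invariant -/

/-- A complex embedding of a CM field is determined up to conjugation by its restriction to the
maximal totally real subfield. -/
theorem embedding_eq_or_conj {F : Type*} [Field F] [NumberField F] [IsCMField F]
    {v₀ : maximalRealSubfield F →+* ℝ} {w w₀ : F →+* ℂ}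
    (hw : ∀ x : maximalRealSubfield F, w (x : F) = (v₀ x : ℂ))
    (hw₀ : ∀ x : maximalRealSubfield F, w₀ (x : F) = (v₀ x : ℂ)) :
    w = w₀ ∨ ComplexEmbedding.conjugate w = w₀ := by
  rw [← InfinitePlace.mk_eq_iff]
  apply (IsCMField.equivInfinitePlace F).injective
  ext x
  rw [IsCMField.equivInfinitePlace_apply, IsCMField.equivInfinitePlace_apply,
    InfinitePlace.comap_apply, InfinitePlace.comap_apply, InfinitePlace.apply, InfinitePlace.apply]
  exact congrArg norm ((hw x).trans (hw₀ x).symm)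

theorem conjugate_over {F : Type*} [Field F] [NumberField F] [IsCMField F]
    {v₀ : maximalRealSubfield F →+* ℝ} {w₀ : F →+* ℂ}
    (hw₀ : ∀ x : maximalRealSubfield F, w₀ (x : F) = (v₀ x : ℂ)) (x : maximalRealSubfield F) :
    ComplexEmbedding.conjugate w₀ (x : F) = (v₀ x : ℂ) := by
  rw [ComplexEmbedding.conjugate_coe_eq, hw₀, Complex.conj_ofReal]

namespace HermPair

variable {F : Type*} [Field F] [NumberField F] [IsCMField F] {n : ℕ}
  {α : Polynomial F} [Fact (Irreducible α)] [IsCMField (AdjoinRoot α)]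
  (hroot : conjF (AdjoinRoot α) (AdjoinRoot.root α) = (AdjoinRoot.root α)⁻¹)
  (D : HermPair F n) (hn : 0 < n) {v₀ : maximalRealSubfield F →+* ℝ}
  (hV'₀ : ∀ w : F →+* ℂ, (∀ x : maximalRealSubfield F, w (x : F) = (v₀ x : ℂ)) →
    HasSignature (D.J'.map w) (n - 1))
  (hV' : ∀ w : F →+* ℂ, ¬ (∀ x : maximalRealSubfield F, w (x : F) = (v₀ x : ℂ)) →
    HasSignature (D.J'.map w) n)
  {w₀ : F →+* ℂ} (hw₀ : ∀ x : maximalRealSubfield F, w₀ (x : F) = (v₀ x : ℂ))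
  (δ : D.GQ) (h : δ.val.val.charpoly = α) {u : Fin n → F} (hu : u ≠ 0)

include hroot hn hV'₀ hV' hw₀ hu

/-- The refined invariant is negative at exactly one pair of conjugate embeddings of `F'`. -/
theorem exists_negative_embedding :
    ∃ τ₀ : EmbOver α w₀, (τ₀.1 (D.refinedForm δ h u u)).re < 0 ∧
      (∀ τ : EmbOver α w₀, τ ≠ τ₀ → 0 < (τ.1 (D.refinedForm δ h u u)).re) ∧
      ∀ τ : AdjoinRoot α →+* ℂ, (τ (D.refinedForm δ h u u)).re ≤ 0 →
        τ = τ₀.1 ∨ τ = ComplexEmbedding.conjugate τ₀.1 := by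
  obtain ⟨τ₀, hneg, hpos⟩ := D.exists_re_refinedForm_neg hroot δ h hu hn (hV'₀ w₀ hw₀)
  refine ⟨τ₀, hneg, hpos, fun τ hτ => ?_⟩
  by_cases hover : ∀ x : maximalRealSubfield F,
      (τ.comp (algebraMap F (AdjoinRoot α))) (x : F) = (v₀ x : ℂ)
  · rcases embedding_eq_or_conj hover hw₀ with h1 | h1
    · left
      by_contra hne
      exact absurd (hpos ⟨τ, h1⟩ fun h2 => hne (congrArg Subtype.val h2)) (not_lt.2 hτ)
    · right
      have h2 : (⟨ComplexEmbedding.conjugate τ, h1⟩ : EmbOver α w₀) = τ₀ := by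
        by_contra hne
        have h3 := hpos _ hne
        rw [ComplexEmbedding.conjugate_coe_eq, Complex.conj_re] at h3
        exact absurd h3 (not_lt.2 hτ)
      rw [← h2, ComplexEmbedding.involutive_conjugate]
  · exact absurd (D.re_refinedForm_pos hroot δ h hu (hV' _ hover) ⟨τ, rfl⟩) (not_lt.2 hτ)

/-- The refined invariant is negative at a unique archimedean place of `F₀'`; it lies over `v₀`, and
there the absolute value of the invariant is `-R(u, z_δ)`. -/
theorem existsUnique_negative_place :
    (∃! v' : maximalRealSubfield (AdjoinRoot α) →+* ℝ, v' (D.refinedInv δ h hroot u) < 0) ∧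
      ∀ v' : maximalRealSubfield (AdjoinRoot α) →+* ℝ, v' (D.refinedInv δ h hroot u) < 0 →
        v'.comp (realMap α) = v₀ ∧
        ∀ z : NegLine (D.J'.map w₀), D.actLine w₀ δ z = z →
          RFun (fun i => w₀ (u i)) z = -|v' (D.refinedInv δ h hroot u)| := by
  obtain ⟨τ₀, hneg, hpos, huniq⟩ :=
    D.exists_negative_embedding hroot hn hV'₀ hV' hw₀ δ h hu
  have hreal : ComplexEmbedding.IsReal
      (τ₀.1.comp (maximalRealSubfield (AdjoinRoot α)).subtype) := by
    ext x
    exact x.2 τ₀.1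
  -- a place at which `ξ'` is negative extends to a complex embedding of `F'`, which must be `τ₀` or
  -- its conjugate
  have key : ∀ v' : maximalRealSubfield (AdjoinRoot α) →+* ℝ,
      v' (D.refinedInv δ h hroot u) < 0 →
      ∀ x : maximalRealSubfield (AdjoinRoot α), τ₀.1 (x : AdjoinRoot α) = (v' x : ℂ) := by
    intro v' hv'
    let := ((Complex.ofRealHom).comp v').toAlgebra
    let τ : AdjoinRoot α →ₐ[maximalRealSubfield (AdjoinRoot α)] ℂ := IsAlgClosed.lift
    have hτ : ∀ x : maximalRealSubfield (AdjoinRoot α), τ (x : AdjoinRoot α) = (v' x : ℂ) :=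
      fun x => τ.commutes x
    intro x
    have h1 : ((τ : AdjoinRoot α →+* ℂ) (D.refinedForm δ h u u)).re ≤ 0 := by
      have h2 := hτ (D.refinedInv δ h hroot u)
      change (τ (D.refinedForm δ h u u)).re ≤ 0
      change τ (D.refinedForm δ h u u) = _ at h2
      rw [h2, Complex.ofReal_re]
      exact hv'.le
    rcases huniq _ h1 with h2 | h2
    · rw [← h2]; exact hτ x
    · have h3 : τ₀.1 = ComplexEmbedding.conjugate (τ : AdjoinRoot α →+* ℂ) := by
        rw [h2, ComplexEmbedding.involutive_conjugate]
      rw [h3, ComplexEmbedding.conjugate_coe_eq]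
      change starRingEnd ℂ (τ (x : AdjoinRoot α)) = _
      rw [hτ x, Complex.conj_ofReal]
  have hemb : hreal.embedding (D.refinedInv δ h hroot u) < 0 := by
    have h1 := hreal.coe_embedding_apply (D.refinedInv δ h hroot u)
    change _ = τ₀.1 (D.refinedForm δ h u u) at h1
    rw [← h1, Complex.ofReal_re] at hneg
    exact hneg
  refine ⟨⟨hreal.embedding, hemb, fun v' hv' => ?_⟩, fun v' hv' => ⟨?_, fun z hz => ?_⟩⟩
  · ext x
    have h1 := key v' hv' x
    have h2 := key _ hemb x
    exact_mod_cast h1.symm.trans h2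
  · ext x
    have h1 := key v' hv' (realMap α x)
    have h2 : τ₀.1 (algebraMap F (AdjoinRoot α) x) = w₀ (x : F) :=
      congrArg (fun f : F →+* ℂ => f x) τ₀.2
    have h3 : τ₀.1 (algebraMap F (AdjoinRoot α) x) = ((v'.comp (realMap α)) x : ℂ) := h1
    rw [h2, hw₀] at h3
    exact_mod_cast h3.symm
  · rw [D.RFun_eq_re_refinedForm hroot δ h hu hneg hpos (hV'₀ w₀ hw₀).det_ne_zero z hz u,
      abs_of_neg hv', neg_neg]
    have h1 := key v' hv' (D.refinedInv δ h hroot u)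
    change τ₀.1 (D.refinedForm δ h u u) = _ at h1
    rw [h1, Complex.ofReal_re]

omit hn hV'₀ hV' hw₀ hu in
/-- `tr_{F₀'/F₀} ξ' = ⟨u, u⟩`, since both become `tr_{F'/F₀} ξ' / 2` after the quadratic extensions
`F'/F₀'` and `F/F₀`. -/
theorem traceReal_refinedInv {ξ : maximalRealSubfield F}
    (hξ : herm (conjF F) D.J' u u = ξ) : traceReal α (D.refinedInv δ h hroot u) = ξ := by
  let := (realMap α).toAlgebra
  have : IsScalarTower (maximalRealSubfield F) F (AdjoinRoot α) := inferInstance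
  have : @IsScalarTower (maximalRealSubfield F) (maximalRealSubfield (AdjoinRoot α))
      (AdjoinRoot α) Algebra.toSMul Algebra.toSMul Algebra.toSMul :=
    IsScalarTower.of_algebraMap_eq fun _ => rfl
  have : Module.Finite (maximalRealSubfield F) (AdjoinRoot α) := Module.Finite.trans F _
  have : Module.Finite (maximalRealSubfield F) (maximalRealSubfield (AdjoinRoot α)) :=
    Module.Finite.of_injective
      (IsScalarTower.toAlgHom (maximalRealSubfield F) (maximalRealSubfield (AdjoinRoot α))
        (AdjoinRoot α)).toLinearMap Subtype.val_injective
  have h1 := Algebra.trace_trace (R := maximalRealSubfield F)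
    (S := maximalRealSubfield (AdjoinRoot α)) (D.refinedForm δ h u u)
  have h2 := Algebra.trace_trace (R := maximalRealSubfield F) (S := F) (D.refinedForm δ h u u)
  have h3 : D.refinedForm δ h u u = algebraMap (maximalRealSubfield (AdjoinRoot α)) _
    (D.refinedInv δ h hroot u) := rfl
  have h4 : Algebra.trace F (AdjoinRoot α) (D.refinedForm δ h u u) =
      algebraMap (maximalRealSubfield F) F ξ := by
    have := D.trace_mul_refinedForm δ h u u 1
    rw [one_mul, map_one, Matrix.one_mulVec, hξ] at this
    exact this
  rw [h4, Algebra.trace_algebraMap, Algebra.IsQuadraticExtension.finrank_eq_two] at h2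
  nth_rw 1 [h3] at h1
  rw [Algebra.trace_algebraMap, Algebra.IsQuadraticExtension.finrank_eq_two, map_nsmul, ← h2,
    nsmul_eq_mul, nsmul_eq_mul] at h1
  exact mul_left_cancel₀ (by norm_num) h1

end HermPair

/-! ### Short integral vectors in adelic lattices -/

/-- The form `tr(ξ x ȳ)` is nondegenerate. -/
theorem det_trace_mul_conj_ne_zero {K ι : Type*} [Field K] [NumberField K] [IsCMField K] [Fintype ι]
    [DecidableEq ι] {ξ : K} (hξ : ξ ≠ 0) (b : Module.Basis ι ℚ K) :
    (Matrix.of fun i j => Algebra.trace ℚ K (ξ * b i * conjF K (b j))).det ≠ 0 := by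
  intro h0
  obtain ⟨v, hv, hv0⟩ := Matrix.exists_mulVec_eq_zero_iff.2 h0
  set y := ∑ j, v j • b j with hy
  have hy0 : y ≠ 0 := fun h1 => hv <| funext
    (Fintype.linearIndependent_iff.1 b.linearIndependent v h1)
  have h1 : ∀ i, Algebra.trace ℚ K (ξ * b i * conjF K y) = 0 := by
    intro i
    have h2 := congrFun hv0 i
    rw [hy, map_sum, Finset.mul_sum, map_sum]
    refine Eq.trans ?_ h2
    simp only [Matrix.mulVec, dotProduct, Matrix.of_apply]
    refine Finset.sum_congr rfl fun j _ => ?_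
    rw [map_rat_smul, mul_smul_comm, map_smul, smul_eq_mul, mul_comm]
  have h2 : ∀ x, Algebra.trace ℚ K (ξ * x * conjF K y) = 0 := by
    intro x
    rw [← b.sum_repr x, Finset.mul_sum, Finset.sum_mul, map_sum]
    refine Finset.sum_eq_zero fun i _ => ?_
    rw [mul_smul_comm, smul_mul_assoc, map_smul, h1, smul_zero]
  have hc : conjF K y ≠ 0 := (map_ne_zero _).2 hy0
  have h3 := h2 (ξ * conjF K y)⁻¹
  rw [show ξ * (ξ * conjF K y)⁻¹ * conjF K y = 1 by field_simp, ← map_one (algebraMap ℚ K),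
    Algebra.trace_algebraMap] at h3
  simp [Module.finrank_pos.ne'] at h3

/-- A lattice given by an invertible adelic matrix `B` (relative to a rational basis `b` of `K`)
contains a nonzero vector that is short for the form `tr(ξ x ȳ)`, with a bound that only depends on
the discriminant `D₀` of the form on the standard lattice. -/
theorem exists_short_integral_vector (K ι : Type*) [Field K] [NumberField K] [IsCMField K]
    [Fintype ι] [DecidableEq ι] (D₀ : ℚ) :
    ∃ C : ℝ, ∀ (ξ : K) (b : Module.Basis ι ℚ K) (B B' G : Matrix ι ι AQ) (u : AQ), ξ ≠ 0 →
      IsUnit u → u ∈ Zhat → B * B' = 1 →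
      (∀ i j, algebraMap ℚ AQ (Algebra.trace ℚ K (ξ * b i * conjF K (b j))) = (Bᵀ * G * B) i j) →
      u * G.det = algebraMap ℚ AQ D₀ →
      ∃ c : ι → ℚ, c ≠ 0 ∧ (∀ i, (B *ᵥ fun j => algebraMap ℚ AQ (c j)) i ∈ Zhat) ∧
        ∑ τ : K →+* ℂ, ‖τ ξ‖ * ‖τ (∑ i, c i • b i)‖ ^ 2 ≤ C := by
  rcases isEmpty_or_nonempty ι with hι | hι
  · refine ⟨0, fun ξ b => ?_⟩
    have := b.index_nonempty
    exact (not_isEmpty_iff.2 this hι).elim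
  obtain ⟨C, hC⟩ := exists_short_vector K ι |(D₀ : ℝ)|
  refine ⟨C, fun ξ b B B' G u hξ hu0 hu hB hS hdet => ?_⟩
  obtain ⟨g, k', hg, hBg, hk', hgk⟩ := exists_rat_matrix_mul_integral B B' hB
  set S : Matrix ι ι ℚ := Matrix.of fun i j => Algebra.trace ℚ K (ξ * b i * conjF K (b j))
    with hSdef
  have hS0 : S.det ≠ 0 := det_trace_mul_conj_ne_zero hξ b
  have hSm : S.map (algebraMap ℚ AQ) = Bᵀ * G * B :=
    Matrix.ext hS
  -- the `c j` form a `ℤ`-basis of the lattice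
  let c : ι → K := fun j => ∑ i, g i j • b i
  have hgram : (Matrix.of fun i j => Algebra.trace ℚ K (ξ * c i * conjF K (c j))) =
      gᵀ * S * g := by
    ext i j
    simp only [Matrix.of_apply, Matrix.mul_apply, Matrix.transpose_apply, c, hSdef, Finset.mul_sum,
      Finset.sum_mul, map_sum]
    refine Finset.sum_congr rfl fun k _ => Finset.sum_congr rfl fun l _ => ?_
    rw [map_rat_smul, mul_smul_comm, mul_smul_comm, smul_mul_assoc, map_smul, map_smul, smul_eq_mul,
      smul_eq_mul]
    ring
  have hD : (gᵀ * S * g).det ≠ 0 := by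
    rw [Matrix.det_mul, Matrix.det_mul, Matrix.det_transpose]
    exact mul_ne_zero (mul_ne_zero hg hS0) hg
  set Δ := (gᵀ * S * g).det with hΔ
  have hk : (B * g.map (algebraMap ℚ AQ)).det * k'.det = 1 := by
    rw [← Matrix.det_mul, hgk, Matrix.det_one]
  have hk'det : k'.det ∈ Zhat := by
    rw [Matrix.det_apply]
    exact Subring.sum_mem _ fun σ _ => by
      rw [Units.smul_def]
      exact Subring.zsmul_mem _ (Subring.prod_mem _ fun i _ => hk' _ _) _
  have hΔm : algebraMap ℚ AQ Δ = (B * g.map (algebraMap ℚ AQ)).det ^ 2 * G.det := by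
    have h1 : algebraMap ℚ AQ S.det = (Bᵀ * G * B).det := by
      rw [← hSm]; exact RingHom.map_det (algebraMap ℚ AQ) S
    have h2 : algebraMap ℚ AQ g.det = (g.map (algebraMap ℚ AQ)).det :=
      RingHom.map_det (algebraMap ℚ AQ) g
    rw [hΔ, Matrix.det_mul, Matrix.det_mul, Matrix.det_transpose, map_mul, map_mul, h1, h2]
    simp only [Matrix.det_mul, Matrix.det_transpose]
    ring
  have hD₀ : D₀ ≠ 0 := by
    intro h0
    rw [h0, map_zero, hu0.mul_right_eq_zero] at hdet
    rw [hdet, mul_zero, map_eq_zero_iff _ algebraMap_AQ_injective] at hΔm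
    exact hD hΔm
  -- the quotient of the discriminants is a nonzero integer
  have hq : algebraMap ℚ AQ (D₀ / Δ) ∈ Zhat := by
    have h1 : algebraMap ℚ AQ (D₀ / Δ) = u * k'.det ^ 2 := by
      have h2 : algebraMap ℚ AQ (D₀ / Δ) * algebraMap ℚ AQ Δ = algebraMap ℚ AQ D₀ := by
        rw [← map_mul, div_mul_cancel₀ _ hD]
      have h3 : algebraMap ℚ AQ Δ * algebraMap ℚ AQ Δ⁻¹ = 1 := by
        rw [← map_mul, mul_inv_cancel₀ hD, map_one]
      calc algebraMap ℚ AQ (D₀ / Δ)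
          = algebraMap ℚ AQ (D₀ / Δ) * algebraMap ℚ AQ Δ * algebraMap ℚ AQ Δ⁻¹ := by
            rw [mul_assoc, h3, mul_one]
        _ = u * (G.det * ((B * g.map (algebraMap ℚ AQ)).det * k'.det) ^ 2) *
              algebraMap ℚ AQ Δ⁻¹ := by rw [h2, hk, one_pow, mul_one, hdet]
        _ = u * k'.det ^ 2 * (algebraMap ℚ AQ Δ * algebraMap ℚ AQ Δ⁻¹) := by rw [hΔm]; ring
        _ = _ := by rw [h3, mul_one]
    rw [h1]
    exact Subring.mul_mem _ hu (Subring.pow_mem _ hk'det 2)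
  obtain ⟨m, hm⟩ := algebraMap_mem_Zhat hq
  have hle : |((Δ : ℚ) : ℝ)| ≤ |(D₀ : ℝ)| := by
    have h1 : D₀ = m * Δ := by rw [← hm, div_mul_cancel₀ _ hD]
    have h2 : m ≠ 0 := by rintro rfl; exact hD₀ (by rw [h1]; simp)
    have h3 : (1 : ℝ) ≤ |(m : ℝ)| := by exact_mod_cast Int.one_le_abs h2
    have h4 : (D₀ : ℝ) = m * Δ := by exact_mod_cast congrArg (fun q : ℚ => (q : ℝ)) h1
    rw [h4, abs_mul]
    exact le_mul_of_one_le_left (abs_nonneg _) h3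
  obtain ⟨t, ht0, ht⟩ := hC ξ c (Module.finrank_eq_card_basis b).symm (by rw [hgram]; exact hD)
    (by rw [hgram]; exact hle)
  refine ⟨g *ᵥ fun j => (t j : ℚ), fun h0 => ht0 ?_, fun i => ?_, ?_⟩
  · have := Matrix.eq_zero_of_mulVec_eq_zero hg h0
    funext j
    exact Int.cast_eq_zero.1 (congrFun this j)
  · have h1 : (fun j => algebraMap ℚ AQ ((g *ᵥ fun j => (t j : ℚ)) j)) =
        g.map (algebraMap ℚ AQ) *ᵥ fun j => (t j : AQ) := by
      funext j
      simp [Matrix.mulVec, dotProduct, map_sum]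
    rw [h1, Matrix.mulVec_mulVec]
    exact Subring.sum_mem _ fun j _ => Subring.mul_mem _ (hBg i j) (intCast_mem_Zhat _)
  · have h1 : ∑ i, (g *ᵥ fun j => (t j : ℚ)) i • b i = ∑ i, (t i : K) * c i := by
      simp only [Matrix.mulVec, dotProduct, c, Finset.mul_sum, Finset.sum_smul]
      rw [Finset.sum_comm]
      refine Finset.sum_congr rfl fun j _ => Finset.sum_congr rfl fun i _ => ?_
      rw [mul_comm, mul_smul, Algebra.smul_def (t j : ℚ), map_intCast]
    rw [h1]
    exact ht

/-- The same for a lattice given as the inverse image of the standard lattice under an automorphism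
`A` of an adelic module with a basis `e`. -/
theorem exists_short_vector_of_linearEquiv (K ι : Type*) [Field K] [NumberField K] [IsCMField K]
    [Fintype ι] [DecidableEq ι] (D₀ : ℚ) :
    ∃ C : ℝ, ∀ {M : Type*} [AddCommGroup M] [Module AQ M] (e : Module.Basis ι AQ M)
      (A : M ≃ₗ[AQ] M) (T : M →ₗ[AQ] M →ₗ[AQ] AQ) (ξ : K) (b : Module.Basis ι ℚ K) (u : AQ),
      ξ ≠ 0 → IsUnit u → u ∈ Zhat →
      (∀ i j, algebraMap ℚ AQ (Algebra.trace ℚ K (ξ * b i * conjF K (b j))) =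
        T (A (e i)) (A (e j))) →
      u * (Matrix.of fun i j => T (e i) (e j)).det = algebraMap ℚ AQ D₀ →
      ∃ c : ι → ℚ, c ≠ 0 ∧ (∀ i, e.repr (A (∑ j, algebraMap ℚ AQ (c j) • e j)) i ∈ Zhat) ∧
        ∑ τ : K →+* ℂ, ‖τ ξ‖ * ‖τ (∑ i, c i • b i)‖ ^ 2 ≤ C := by
  obtain ⟨C, hC⟩ := exists_short_integral_vector K ι D₀
  refine ⟨C, fun e A T ξ b u hξ hu0 hu hT hdet => ?_⟩
  have hG : (Matrix.of fun i j => T (e i) (e j)) = LinearMap.toMatrix₂ e e T := by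
    ext1 i j
    rw [Matrix.of_apply, LinearMap.toMatrix₂_apply]
  obtain ⟨c, hc0, hc, hle⟩ := hC ξ b (LinearMap.toMatrix e e A.toLinearMap)
    (LinearMap.toMatrix e e A.symm.toLinearMap) (LinearMap.toMatrix₂ e e T) u hξ hu0 hu
    (by rw [← LinearMap.toMatrix_comp, LinearEquiv.comp_symm, LinearMap.toMatrix_id])
    (fun i j => by
      rw [hT, ← LinearMap.toMatrix₂_compl₁₂ e e, LinearMap.toMatrix₂_apply]
      rfl) (by rw [← hG]; exact hdet)
  refine ⟨c, hc0, fun i => ?_, hle⟩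
  have h1 := hc i
  have h2 : (fun j => algebraMap ℚ AQ (c j)) = e.repr (∑ j, algebraMap ℚ AQ (c j) • e j) := by
    funext j
    rw [e.repr_sum_self]
  rw [h2, LinearMap.toMatrix_mulVec_repr] at h1
  exact h1

section Trace

variable (F : Type*) [Field F] [NumberField F]

/-- The trace `𝔸_f ⊗ F → 𝔸_f`. -/
def traceA : AdeleF F →ₗ[AQ] AQ :=
  (basisAdele (Module.finBasis ℚ F)).constr AQ fun i =>
    algebraMap ℚ AQ (Algebra.trace ℚ F (Module.finBasis ℚ F i))

variable {F}

theorem traceA_toAdele (x : F) : traceA F (toAdele F x) =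
    algebraMap ℚ AQ (Algebra.trace ℚ F x) := by
  rw [traceA, Module.Basis.constr_apply_fintype]
  conv_rhs => rw [← (Module.finBasis ℚ F).sum_repr x, map_sum, map_sum]
  refine Finset.sum_congr rfl fun i _ => ?_
  rw [map_smul, smul_eq_mul, smul_eq_mul, map_mul]
  congr 1
  exact basisAdele_repr_toAdele _ x i

theorem smul_toAdele (q : ℚ) (x : F) :
    algebraMap ℚ AQ q • toAdele F x = toAdele F (q • x) := by
  rw [Algebra.smul_def, algebraMap_toAdele, ← map_mul, ← Algebra.smul_def]

/-- The bilinear form `tr(a x ȳ)` on the adeles. -/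
def traceFormA (F : Type*) [Field F] [NumberField F] [IsCMField F] (a : AdeleF F) :
    AdeleF F →ₗ[AQ] AdeleF F →ₗ[AQ] AQ :=
  LinearMap.mk₂ AQ (fun x y => traceA F (a * x * conjA F y))
    (fun x x' y => by rw [mul_add, add_mul, map_add])
    (fun c x y => by rw [mul_smul_comm, smul_mul_assoc, map_smul])
    (fun x y y' => by rw [map_add, mul_add, map_add])
    (fun c x y => by
      rw [← conjALinear_apply, map_smul, mul_smul_comm, map_smul, conjALinear_apply])

end Trace

/-! ### Finiteness of `Z^ℚ(ℚ) \ Z^ℚ(𝔸_f) / K_Z` -/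

/-- `𝔸_fˣ = ℚ_{>0} Ẑˣ`, by the class number one of `GL_1`. -/
theorem exists_pos_rat_mul_unit (q : AQˣ) : ∃ (t : ℚ) (u u' : AQ), 0 < t ∧ u ∈ Zhat ∧ u' ∈ Zhat ∧
    u * u' = 1 ∧ (q : AQ) = algebraMap ℚ AQ t * u := by
  obtain ⟨g, k', hg, hBg, hk', h1⟩ := exists_rat_matrix_mul_integral
    (Matrix.of fun _ _ : Unit => ((q⁻¹ : AQˣ) : AQ)) (Matrix.of fun _ _ => (q : AQ)) (by
      ext1 i j
      simp [Matrix.mul_apply])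
  have h2 := congrFun (congrFun h1 ()) ()
  have h3 := hBg () ()
  have h4 := hk' () ()
  rw [Matrix.det_unique] at hg
  simp only [Matrix.mul_apply, Finset.univ_unique, Finset.sum_singleton, Matrix.of_apply,
    Matrix.map_apply, Matrix.one_apply_eq] at h2 h3
  set t := g () () with ht
  set k := k' () () with hk
  have ht0 : t ≠ 0 := hg
  have hq : (q : AQ) = algebraMap ℚ AQ t * k := by
    calc (q : AQ) = q * (((q⁻¹ : AQˣ) : AQ) * algebraMap ℚ AQ t * k) := by
          rw [show (((q⁻¹ : AQˣ) : AQ) * algebraMap ℚ AQ t * k) = 1 from h2, mul_one]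
      _ = (q * ((q⁻¹ : AQˣ) : AQ)) * (algebraMap ℚ AQ t * k) := by ring
      _ = _ := by rw [Units.mul_inv, one_mul]
  have h5 : k * (((q⁻¹ : AQˣ) : AQ) * algebraMap ℚ AQ t) = 1 := by rw [mul_comm]; exact h2
  rcases lt_or_gt_of_ne ht0 with hlt | hgt
  · refine ⟨-t, -k, -(((q⁻¹ : AQˣ) : AQ) * algebraMap ℚ AQ t), by linarith, neg_mem h4,
      neg_mem h3, by rw [neg_mul_neg]; exact h5, by rw [map_neg, neg_mul_neg]; exact hq⟩
  · exact ⟨t, k, _, hgt, h4, h3, h5, hq⟩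

variable {F : Type*} [Field F] [NumberField F] [IsCMField F]

/-- The standard lattice of `𝔸_f ⊗ F`. -/
def stdLattice (F : Type*) [Field F] [NumberField F] : Set (AdeleF F) :=
  {x | ∀ i, (basisAdele (Module.finBasis ℚ F)).repr x i ∈ Zhat}

omit [IsCMField F] in
theorem isCompact_stdLattice : IsCompact (stdLattice F) := isCompact_integral _

omit [IsCMField F] in
theorem continuous_algebraMap_AdeleF : Continuous (algebraMap AQ (AdeleF F)) :=
  IsModuleTopology.continuous_of_linearMap (Algebra.linearMap AQ (AdeleF F))

/-- Every `z ∈ Z^ℚ(𝔸_f)` can be written as `z = v y⁻¹` with `v ∈ F` and an integral `y`, such that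
`v v̄` is, up to a positive rational number, an element of `F` bounded at all places. -/
theorem ZA.exists_bounded_norm (F : Type*) [Field F] [NumberField F] [IsCMField F] :
    ∃ C : ℝ, ∀ z : ZA F, ∃ (v : F) (t : ℚ) (u : AQ), v ≠ 0 ∧ 0 < t ∧ u ∈ Zhat ∧
      ((z⁻¹ : (AdeleF F)ˣ) : AdeleF F) * toAdele F v ∈ stdLattice F ∧
      toAdele F (t⁻¹ • (v * conjF F v)) = u • ((((z⁻¹ : (AdeleF F)ˣ) : AdeleF F) * toAdele F v) *
        conjA F (((z⁻¹ : (AdeleF F)ˣ) : AdeleF F) * toAdele F v)) ∧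
      ∀ τ : F →+* ℂ, ‖τ (t⁻¹ • (v * conjF F v))‖ ≤ C := by
  set b := Module.finBasis ℚ F with hb
  set D₀ : ℚ := (Matrix.of fun i j => Algebra.trace ℚ F (1 * b i * conjF F (b j))).det with hD₀
  obtain ⟨C, hC⟩ := exists_short_vector_of_linearEquiv F (Fin (Module.finrank ℚ F)) D₀
  refine ⟨C, fun z => ?_⟩
  obtain ⟨q, hq⟩ := z.2
  obtain ⟨t, u, u', ht, hu, hu', huu', hqt⟩ := exists_pos_rat_mul_unit q
  set zi : AdeleF F := ((z⁻¹ : (AdeleF F)ˣ) : AdeleF F) with hzi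
  set za : AdeleF F := ((z : (AdeleF F)ˣ) : AdeleF F) with hza
  have hzz : za * zi = 1 := by rw [hzi, hza]; exact Units.mul_inv _
  -- the norm form on the lattice, divided by `t`
  have hnorm : ∀ x y : F, toAdele F (t⁻¹ • (x * conjF F y)) =
      u • ((zi * toAdele F x) * conjA F (zi * toAdele F y)) := by
    intro x y
    have h1 : conjA F za * conjA F zi = 1 := by rw [← map_mul, hzz, map_one]
    have h2 : algebraMap AQ (AdeleF F) (algebraMap ℚ AQ t⁻¹) *
        algebraMap AQ (AdeleF F) (algebraMap ℚ AQ t) = 1 := by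
      rw [← map_mul, ← map_mul, inv_mul_cancel₀ ht.ne', map_one, map_one]
    rw [← smul_toAdele, map_mul, toAdele_conj, Algebra.smul_def, Algebra.smul_def, map_mul]
    have h3 : za * conjA F za =
      algebraMap AQ (AdeleF F) (algebraMap ℚ AQ t) * algebraMap AQ (AdeleF F) u := by
      rw [hq, hqt, map_mul]
    calc _ = algebraMap AQ (AdeleF F) (algebraMap ℚ AQ t⁻¹) * ((za * zi) *
          (conjA F za * conjA F zi)) * (toAdele F x * conjA F (toAdele F y)) := by
          rw [hzz, h1]; ring
      _ = algebraMap AQ (AdeleF F) (algebraMap ℚ AQ t⁻¹) * (za *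
          conjA F za) * (zi * conjA F zi) *
          (toAdele F x * conjA F (toAdele F y)) := by ring
      _ = (algebraMap AQ (AdeleF F) (algebraMap ℚ AQ t⁻¹) *
          algebraMap AQ (AdeleF F) (algebraMap ℚ AQ t)) * algebraMap AQ (AdeleF F) u *
          (zi * conjA F zi) * (toAdele F x * conjA F (toAdele F y)) := by rw [h3]; ring
      _ = _ := by rw [h2]; ring
  -- the lattice is the inverse image of the standard one under multiplication by `z⁻¹`
  let A : AdeleF F ≃ₗ[AQ] AdeleF F := LinearEquiv.ofLinearMap (LinearMap.mulLeft AQ zi)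
    (LinearMap.mulLeft AQ za)
    (by
      ext x
      change zi * (za * x) = x
      rw [← mul_assoc, mul_comm zi, hzz, one_mul])
    (by
      ext x
      change za * (zi * x) = x
      rw [← mul_assoc, hzz, one_mul])
  have hA : ∀ x, A x = zi * x := fun _ => rfl
  obtain ⟨c, hc0, hc, hle⟩ := hC (basisAdele b) A (traceFormA F (algebraMap AQ _ u))
    (algebraMap ℚ F t⁻¹) b (u' ^ (Module.finrank ℚ F))
    ((map_ne_zero _).2 (inv_ne_zero ht.ne'))
    ((IsUnit.of_mul_eq_one u (by rw [mul_comm, huu'])).pow _) (pow_mem hu' _)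
    (fun i j => by
      rw [basisAdele_apply, basisAdele_apply, ← traceA_toAdele, mul_assoc, ← Algebra.smul_def,
        hnorm,
        hA, hA, Algebra.smul_def, ← mul_assoc]
      rfl)
    (by
      have h1 : (Matrix.of fun i j => traceFormA F (algebraMap AQ _ u) (basisAdele b i)
          (basisAdele b j)) = u • (Matrix.of fun i j => Algebra.trace ℚ F
            (1 * b i * conjF F (b j))).map (algebraMap ℚ AQ) := by
        ext1 i j
        change traceA F (algebraMap AQ (AdeleF F) u * basisAdele b i * conjA F (basisAdele b j)) =
          u * algebraMap ℚ AQ (Algebra.trace ℚ F (1 * b i * conjF F (b j)))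
        rw [basisAdele_apply, basisAdele_apply, ← toAdele_conj, mul_assoc, ← map_mul,
          ← Algebra.smul_def, map_smul, traceA_toAdele, one_mul, smul_eq_mul]
      rw [h1, Matrix.det_smul, Fintype.card_fin, ← mul_assoc, ← mul_pow, mul_comm u', huu',
        one_pow, one_mul]
      exact (RingHom.map_det (algebraMap ℚ AQ) _).symm)
  set v := ∑ i, c i • b i with hv
  have hvA : ∑ j, algebraMap ℚ AQ (c j) • basisAdele b j = toAdele F v := by
    rw [hv, map_sum]
    exact Finset.sum_congr rfl fun j _ => by rw [basisAdele_apply, smul_toAdele]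
  refine ⟨v, t, u, fun h0 => hc0 (funext
    (Fintype.linearIndependent_iff.1 b.linearIndependent c h0)), ht, hu, ?_, hnorm v v,
    fun τ => ?_⟩
  · intro i
    have := hc i
    rwa [hvA, hA] at this
  · have h1 : ‖τ (t⁻¹ • (v * conjF F v))‖ = ‖τ (algebraMap ℚ F t⁻¹)‖ * ‖τ v‖ ^ 2 := by
      rw [Algebra.smul_def, map_mul, map_mul, embedding_conj, norm_mul, norm_mul,
        Complex.norm_conj, sq]
    rw [h1]
    exact (Finset.single_le_sum (f := fun τ : F →+* ℂ => ‖τ (algebraMap ℚ F t⁻¹)‖ * ‖τ v‖ ^ 2)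
      (fun _ _ => by positivity) (Finset.mem_univ τ)).trans hle

/-- Two elements of `Z^ℚ(𝔸_f)` with the same normalized norm `v v̄ / t` differ by an element of
`Z^ℚ(ℚ)` and a compact set; there are only finitely many normalized norms. -/
theorem finite_doubleCoset_ZA (KZ : Subgroup (ZA F)) (hKZ : IsOpen (KZ : Set (ZA F))) :
    Finite (DoubleCoset.Quotient ((ZQ.toAdelic F).range : Set (ZA F)) (KZ : Set (ZA F))) := by
  obtain ⟨C, hC⟩ := ZA.exists_bounded_norm F
  choose v t u hv ht hu hint hnorm hbd using hC
  let m : ZA F → F := fun z => (t z)⁻¹ • (v z * conjF F (v z))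
  let y : ZA F → AdeleF F := fun z => ((z⁻¹ : (AdeleF F)ˣ) : AdeleF F) * toAdele F (v z)
  have hm : ∀ z, toAdele F (m z) = u z • (y z * conjA F (y z)) := hnorm
  have hm0 : ∀ z, m z ≠ 0 := fun z => by
    have := (ht z).ne'
    simp [m, this, hv]
  -- the normalized norms form a finite set
  have hfin : (Set.range m).Finite := by
    have hc : IsCompact ((fun p : AQ × AdeleF F => p.1 • (p.2 * conjA F p.2)) ''
        ((Zhat : Set AQ) ×ˢ stdLattice F)) := by
      refine (isCompact_Zhat.prod isCompact_stdLattice).image ?_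
      have := continuous_conjA (F := F)
      have := continuous_algebraMap_AdeleF (F := F)
      simp only [Algebra.smul_def]
      fun_prop
    refine (finite_toAdele_mem_of_norm_le hc C).subset ?_
    rintro _ ⟨z, rfl⟩
    exact ⟨⟨(u z, y z), ⟨hu z, hint z⟩, (hm z).symm⟩, hbd z⟩
  let π : ZA F → DoubleCoset.Quotient ((ZQ.toAdelic F).range : Set (ZA F)) (KZ : Set (ZA F)) :=
    DoubleCoset.mk _ _
  have hπ : ∀ z, π z = DoubleCoset.mk _ _ z := fun _ => rfl
  suffices h : ∀ m₀ ∈ Set.range m, (π '' {z | m z = m₀}).Finite by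
    refine Set.finite_univ_iff.1 ((hfin.biUnion h).subset fun x _ => ?_)
    obtain ⟨z, rfl⟩ := Quotient.exists_rep x
    exact Set.mem_biUnion ⟨z, rfl⟩ ⟨z, rfl, rfl⟩
  rintro _ ⟨z₁, rfl⟩
  -- these compact sets contain `a⁻¹ z` and its inverse, where `a = v z / v z₁`
  have hc₁ : IsCompact ((fun p : AQ × AdeleF F =>
      toAdele F (v z₁) * (toAdele F (m z₁)⁻¹ * (p.1 • conjA F p.2))) ''
        ((Zhat : Set AQ) ×ˢ stdLattice F)) := by
    refine (isCompact_Zhat.prod isCompact_stdLattice).image ?_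
    have := continuous_conjA (F := F)
    have := continuous_algebraMap_AdeleF (F := F)
    simp only [Algebra.smul_def]
    fun_prop
  have hc₂ : IsCompact ((fun p : AdeleF F => toAdele F (v z₁)⁻¹ * p) '' stdLattice F) := by
    refine isCompact_stdLattice.image ?_
    fun_prop
  refine ((finite_cosets_of_isCompact (ZA F) KZ hKZ (isCompact_units_of_mem hc₁ hc₂)).image
    (Quotient.lift π fun a b hab => ?_)).subset ?_
  · rw [hπ, hπ, DoubleCoset.eq]
    exact ⟨1, one_mem _, a⁻¹ * b, QuotientGroup.leftRel_apply.1 hab, by simp⟩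
  · rintro _ ⟨z, hz, rfl⟩
    have hz' : m z = m z₁ := hz
    -- `a = v z / v z₁` is an element of `Z^ℚ(ℚ)`
    set a : F := v z / v z₁ with ha
    have ha0 : a ≠ 0 := div_ne_zero (hv z) (hv z₁)
    have haa : a * conjF F a = algebraMap ℚ F (t z / t z₁) := by
      have h1 : algebraMap ℚ F (t z) ≠ 0 := (map_ne_zero _).2 (ht z).ne'
      have h2 : algebraMap ℚ F (t z₁) ≠ 0 := (map_ne_zero _).2 (ht z₁).ne'
      have h3 : conjF F (v z₁) ≠ 0 := (map_ne_zero _).2 (hv z₁)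
      have h4 := hv z₁
      simp only [m, Algebra.smul_def, map_inv₀] at hz'
      rw [ha, map_div₀, map_div₀]
      field_simp at hz' ⊢
      linear_combination hz'
    let A : ZQ F := ⟨Units.mk0 a ha0, Units.mk0 (t z / t z₁)
      (div_ne_zero (ht z).ne' (ht z₁).ne'), haa⟩
    have hAinv : ((((ZQ.toAdelic F A)⁻¹ : ZA F) : (AdeleF F)ˣ) : AdeleF F) = toAdele F a⁻¹ := by
      rw [← map_inv]
      change toAdele F ((A⁻¹ : ZQ F) : Fˣ) = _
      rw [Subgroup.coe_inv, Units.val_inv_eq_inv_val]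
      rfl
    have hzy : ((z : (AdeleF F)ˣ) : AdeleF F) * y z = toAdele F (v z) := by
      change ((z : (AdeleF F)ˣ) : AdeleF F) * (((z⁻¹ : (AdeleF F)ˣ) : AdeleF F) * _) = _
      rw [← mul_assoc, Units.mul_inv, one_mul]
    refine ⟨((((ZQ.toAdelic F A)⁻¹ * z : ZA F)) : ZA F ⧸ KZ),
      ⟨(ZQ.toAdelic F A)⁻¹ * z, ⟨?_, ?_⟩, rfl⟩,
      ?_⟩
    · refine ⟨(u z, y z), ⟨hu z, hint z⟩, ?_⟩
      change toAdele F (v z₁) * (toAdele F (m z₁)⁻¹ * (u z • conjA F (y z))) =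
        ((((ZQ.toAdelic F A)⁻¹ : ZA F) : (AdeleF F)ˣ) : AdeleF F) * ((z : (AdeleF F)ˣ) : AdeleF F)
      rw [hAinv]
      have h1 : toAdele F (m z₁)⁻¹ * (u z • (y z * conjA F (y z))) = 1 := by
        rw [← hm, hz', ← map_mul, inv_mul_cancel₀ (hm0 z₁), map_one]
      calc _ = toAdele F (v z₁ / v z) * (toAdele F (v z)) *
            (toAdele F (m z₁)⁻¹ * (u z • conjA F (y z))) := by
            rw [← map_mul, div_mul_cancel₀ _ (hv z)]
        _ = toAdele F (v z₁ / v z) * (((z : (AdeleF F)ˣ) : AdeleF F) * y z) *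
            (toAdele F (m z₁)⁻¹ * (u z • conjA F (y z))) := by rw [hzy]
        _ = toAdele F (v z₁ / v z) * ((z : (AdeleF F)ˣ) : AdeleF F) *
            (toAdele F (m z₁)⁻¹ * (u z • (y z * conjA F (y z)))) := by
            simp only [Algebra.smul_def]; ring
        _ = _ := by rw [h1, mul_one, ha, inv_div]
    · refine ⟨y z, hint z, ?_⟩
      change toAdele F (v z₁)⁻¹ * (((z⁻¹ : (AdeleF F)ˣ) : AdeleF F) * toAdele F (v z)) = _
      rw [show (((((ZQ.toAdelic F A)⁻¹ * z : ZA F) : (AdeleF F)ˣ))⁻¹ : (AdeleF F)ˣ) =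
        (z : (AdeleF F)ˣ)⁻¹ * (ZQ.toAdelic F A : (AdeleF F)ˣ) by
          rw [Subgroup.coe_mul, mul_inv_rev, Subgroup.coe_inv, inv_inv]]
      change _ = ((z⁻¹ : (AdeleF F)ˣ) : AdeleF F) * toAdele F a
      rw [ha, div_eq_mul_inv, map_mul]
      ring
    · change π _ = π _
      rw [hπ, hπ, DoubleCoset.eq]
      exact ⟨ZQ.toAdelic F A, ⟨A, rfl⟩, 1, KZ.one_mem, by simp⟩

/-! ### Rational vectors and cosets of the adelic unitary group -/

theorem toAdele_injective (F : Type*) [Field F] [NumberField F] :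
    Function.Injective (toAdele F) := by
  intro x y hxy
  apply (Module.finBasis ℚ F).repr.injective
  ext i
  apply algebraMap_AQ_injective
  rw [← basisAdele_repr_toAdele, ← basisAdele_repr_toAdele, hxy]

instance (F : Type*) [Field F] [NumberField F] : Nontrivial (AdeleF F) :=
  (toAdele_injective F).nontrivial

theorem conjA_conjA {F : Type*} [Field F] [NumberField F] [IsCMField F] (x : AdeleF F) :
    conjA F (conjA F x) = x := by
  have h : conjALinear F ∘ₗ conjALinear F = LinearMap.id := by
    refine (basisAdele (Module.finBasis ℚ F)).ext fun i => ?_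
    rw [LinearMap.comp_apply, conjALinear_apply, conjALinear_apply, basisAdele_apply,
      ← toAdele_conj, ← toAdele_conj]
    exact congrArg _ (IsCMField.complexConj_apply_apply F _)
  exact congrArg (fun f : AdeleF F →ₗ[AQ] AdeleF F => f x) h

theorem herm_mulVec {n : ℕ} {R : Type*} [CommRing R] (c : R →+* R) (J g : Matrix (Fin n) (Fin n) R)
    (x y : Fin n → R) : herm c J (g *ᵥ x) (g *ᵥ y) = herm c (gᵀ * J * g.map c) x y := by
  have hm : (fun i => c ((g *ᵥ y) i)) = g.map c *ᵥ (fun i => c (y i)) := by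
    funext i
    simp [Matrix.mulVec, dotProduct, map_sum, map_mul]
  unfold herm
  rw [hm, ← Matrix.vecMul_transpose, ← Matrix.dotProduct_mulVec, Matrix.mulVec_mulVec,
    Matrix.mulVec_mulVec]

namespace HermPair

variable {F : Type*} [Field F] [NumberField F] [IsCMField F] {n : ℕ}
  {α : Polynomial F} [Fact (Irreducible α)]
  (D : HermPair F n)

section Cyclic

variable (δ : D.GQ) (h : δ.val.val.charpoly = α) {u : Fin n → F} (hu : u ≠ 0)

theorem vecEquiv_root_pow (i : ℕ) :
    D.vecEquiv δ h hu (AdjoinRoot.root α ^ i) = (δ ^ i).val.val *ᵥ u := by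
  rw [vecEquiv_apply, map_pow, actF'_root]
  rfl

include h hu in
/-- The vectors `u, δ u, …, δⁿ⁻¹ u` form a basis. -/
theorem isUnit_cyclic : IsUnit (Matrix.of fun j i : Fin n => ((δ ^ (i : ℕ)).val.val *ᵥ u) j) := by
  have h0 : α ≠ 0 := (Fact.out : Irreducible α).ne_zero
  have hdim : (AdjoinRoot.powerBasis h0).dim = n := by
    rw [AdjoinRoot.powerBasis_dim, ← h, Matrix.charpoly_natDegree_eq_dim, Fintype.card_fin]
  let B := ((AdjoinRoot.powerBasis h0).basis.reindex (finCongr hdim)).map (D.vecEquiv δ h hu)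
  have hB : ∀ i, B i = (δ ^ (i : ℕ)).val.val *ᵥ u := by
    intro i
    simp only [B, Module.Basis.map_apply, Module.Basis.reindex_apply, PowerBasis.coe_basis,
      AdjoinRoot.powerBasis_gen]
    exact D.vecEquiv_root_pow δ h hu i
  have h1 : (Matrix.of fun j i : Fin n => ((δ ^ (i : ℕ)).val.val *ᵥ u) j) =
      (Pi.basisFun F (Fin n)).toMatrix B := by
    ext1 j i
    rw [Matrix.of_apply, Module.Basis.toMatrix_apply, hB]
    rfl
  rw [h1]
  have := (Pi.basisFun F (Fin n)).invertibleToMatrix B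
  exact isUnit_of_invertible _

include h hu in
/-- An isometry commuting with `δ` and fixing a nonzero vector is trivial. -/
theorem eq_one_of_commute_of_fixed (γ : D.GQ) (hγ : γ * δ * γ⁻¹ = δ) (hγu : γ.val.val *ᵥ u = u) :
    γ = 1 := by
  have hc : ∀ i : ℕ, γ.val.val *ᵥ ((δ ^ i).val.val *ᵥ u) = (δ ^ i).val.val *ᵥ u := by
    intro i
    have h1 : γ * δ ^ i = δ ^ i * γ := by
      have h2 : Commute γ δ := by
        rw [commute_iff_eq]
        exact mul_inv_eq_iff_eq_mul.1 hγ
      exact h2.pow_right i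
    have h3 : (γ * δ ^ i).val.val *ᵥ u = (δ ^ i * γ).val.val *ᵥ u := by rw [h1]
    change (γ.val.val * (δ ^ i).val.val) *ᵥ u = ((δ ^ i).val.val * γ.val.val) *ᵥ u at h3
    rw [← Matrix.mulVec_mulVec, ← Matrix.mulVec_mulVec, hγu] at h3
    exact h3
  have h1 : γ.val.val * (Matrix.of fun j i : Fin n => ((δ ^ (i : ℕ)).val.val *ᵥ u) j) =
      Matrix.of fun j i : Fin n => ((δ ^ (i : ℕ)).val.val *ᵥ u) j := by
    ext1 j i
    exact congrFun (hc i) j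
  have h2 := (D.isUnit_cyclic δ h hu).mul_eq_right.1 h1
  exact Subtype.ext (Units.ext h2)

end Cyclic

/-- Pairs with the same refined invariant are conjugate under `G'(F₀)`: both identify `V'` with the
same hermitian line over `F'`, in such a way that `u` and `u₁` correspond to `1`. -/
theorem exists_conj_of_refinedForm_eq [IsCMField (AdjoinRoot α)]
    (hroot : conjF (AdjoinRoot α) (AdjoinRoot.root α) = (AdjoinRoot.root α)⁻¹)
    {δ δ₁ : D.GQ} (h : δ.val.val.charpoly = α) (h₁ : δ₁.val.val.charpoly = α)
    {u u₁ : Fin n → F} (hu : u ≠ 0) (hu₁ : u₁ ≠ 0)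
    (heq : D.refinedForm δ h u u = D.refinedForm δ₁ h₁ u₁ u₁) :
    ∃ γ : D.GQ, γ * δ * γ⁻¹ = δ₁ ∧ γ.val.val *ᵥ u = u₁ := by
  let e : (Fin n → F) ≃ₗ[F] (Fin n → F) := (D.vecEquiv δ h hu).symm.trans (D.vecEquiv δ₁ h₁ hu₁)
  let g : GL (Fin n) F := ⟨LinearMap.toMatrix' e.toLinearMap,
    LinearMap.toMatrix' e.symm.toLinearMap,
    by rw [← LinearMap.toMatrix'_comp, LinearEquiv.comp_symm, LinearMap.toMatrix'_id],
    by rw [← LinearMap.toMatrix'_comp, LinearEquiv.symm_comp, LinearMap.toMatrix'_id]⟩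
  have hg : ∀ a, g.val *ᵥ D.vecEquiv δ h hu a = D.vecEquiv δ₁ h₁ hu₁ a := by
    intro a
    rw [LinearMap.toMatrix'_mulVec]
    simp [e]
  have hmem : (g.val)ᵀ * D.J' * g.val.map (conjF F) = D.J' := by
    ext1 i j
    rw [← herm_single (conjF F) ((g.val)ᵀ * D.J' * g.val.map (conjF F)) i j, ← herm_mulVec,
      ← herm_single (conjF F) D.J' i j]
    obtain ⟨a, ha⟩ := (D.vecEquiv δ h hu).surjective (Pi.single i 1)
    obtain ⟨b, hb⟩ := (D.vecEquiv δ h hu).surjective (Pi.single j 1)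
    rw [← ha, ← hb, hg, hg, D.herm_vecEquiv δ h hroot, D.herm_vecEquiv δ₁ h₁ hroot, heq]
  refine ⟨⟨g, hmem⟩, ?_, ?_⟩
  · rw [mul_inv_eq_iff_eq_mul]
    apply Subtype.ext
    apply Units.ext
    change g.val * δ.val.val = δ₁.val.val * g.val
    apply Matrix.toLin'.injective
    refine LinearMap.ext fun x => ?_
    obtain ⟨a, rfl⟩ := (D.vecEquiv δ h hu).surjective x
    rw [Matrix.toLin'_apply, Matrix.toLin'_apply, ← Matrix.mulVec_mulVec, ← Matrix.mulVec_mulVec,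
      ← vecEquiv_root_mul, hg, hg, vecEquiv_root_mul]
  · have h2 := hg 1
    rw [vecEquiv_apply, vecEquiv_apply, map_one, map_one, Matrix.one_mulVec,
      Matrix.one_mulVec] at h2
    exact h2

theorem det_J_ne_zero (hJ' : D.J'.det ≠ 0) : D.J.det ≠ 0 := by
  intro h0
  apply hJ'
  have h1 := congrArg Matrix.det D.iso_spec
  have h2 : ∀ M : Matrix (Fin n) (Fin n) F, (M.map (toAdele F)).det = toAdele F M.det :=
    fun M => (RingHom.map_det (toAdele F) M).symm
  rw [Matrix.det_mul, Matrix.det_mul, h2, h2, h0, map_zero, mul_zero, zero_mul] at h1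
  exact (map_eq_zero_iff _ (toAdele F).injective).1 h1.symm

/-- Only finitely many cosets `h K_G` are such that `h⁻¹` maps the cyclic vectors `δ^i u` into a
given compact set: the images of these vectors determine `h⁻¹`, and unitarity bounds `h` itself. -/
theorem finite_cosets_of_cyclic (hJ' : D.J'.det ≠ 0) {KG : Subgroup D.GA}
    (hKG : IsOpen (KG : Set D.GA)) (δ : D.GQ) (h : δ.val.val.charpoly = α) {u : Fin n → F}
    (hu : u ≠ 0) {C : Set (Fin n → AdeleF F)} (hC : IsCompact C) :
    {q : D.GA ⧸ KG | ∃ g : D.GA, (g : D.GA ⧸ KG) = q ∧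
      ∀ i : Fin n, (g⁻¹).val.val *ᵥ D.vecA ((δ ^ (i : ℕ)).val.val *ᵥ u) ∈ C}.Finite := by
  obtain ⟨Y, hY⟩ := D.isUnit_cyclic δ h hu
  let Yi : Matrix (Fin n) (Fin n) (AdeleF F) := (Y⁻¹).val.map (toAdele F)
  let J : Matrix (Fin n) (Fin n) (AdeleF F) := D.J.map (toAdele F)
  let Ji : Matrix (Fin n) (Fin n) (AdeleF F) := D.J⁻¹.map (toAdele F)
  have hJ : Ji * J = 1 := by
    rw [← Matrix.map_mul, Matrix.nonsing_inv_mul _ (D.det_J_ne_zero hJ').isUnit,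
      Matrix.map_one _ (map_zero _) (map_one _)]
  -- the matrices with columns in `C`
  have hC₁ : IsCompact ((fun M : Fin n → Fin n → AdeleF F =>
      (Matrix.of M)ᵀ * (Yi * (D.iso⁻¹).val)) '' (Set.univ.pi fun _ => C)) := by
    refine (isCompact_univ_pi fun _ => hC).image ?_
    have : Continuous fun M : Fin n → Fin n → AdeleF F => (Matrix.of M)ᵀ :=
      continuous_id.matrix_transpose
    fun_prop
  -- `h = J⁻¹ (h⁻¹)ᵀ J`, conjugated, for unitary `h`
  have hC₂ := hC₁.image (f := fun M : Matrix (Fin n) (Fin n) (AdeleF F) =>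
      (Ji * Mᵀ * J).map (conjA F)) (by
    have h1 : Continuous fun M : Matrix (Fin n) (Fin n) (AdeleF F) => Ji * Mᵀ * J :=
      (continuous_const.matrix_mul continuous_id.matrix_transpose).matrix_mul continuous_const
    exact h1.matrix_map continuous_conjA)
  refine (finite_cosets_of_isCompact _ KG hKG (isCompact_units_of_mem hC₂ hC₁)).subset ?_
  rintro _ ⟨g, rfl, hg⟩
  have h1 : (g⁻¹).val.val ∈ ((fun M : Fin n → Fin n → AdeleF F =>
      (Matrix.of M)ᵀ * (Yi * (D.iso⁻¹).val)) '' (Set.univ.pi fun _ => C)) := by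
    refine ⟨fun i => (g⁻¹).val.val *ᵥ D.vecA ((δ ^ (i : ℕ)).val.val *ᵥ u), fun i _ => hg i, ?_⟩
    have h2 : (Matrix.of fun i : Fin n =>
        (g⁻¹).val.val *ᵥ D.vecA ((δ ^ (i : ℕ)).val.val *ᵥ u))ᵀ =
        (g⁻¹).val.val * (D.iso.val * Y.val.map (toAdele F)) := by
      rw [hY]
      ext1 j i
      rfl
    have h3 : Y.val.map (toAdele F) * Yi = 1 := by
      rw [← Matrix.map_mul, Units.mul_inv, Matrix.map_one _ (map_zero _) (map_one _)]
    have h4 : D.iso.val * (D.iso⁻¹).val = 1 := Units.mul_inv _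
    change _ * _ = _
    rw [h2]
    calc _ = (g⁻¹).val.val * (D.iso.val * (Y.val.map (toAdele F) * Yi) * (D.iso⁻¹).val) := by
          simp only [Matrix.mul_assoc]
      _ = _ := by rw [h3, Matrix.mul_one, h4, Matrix.mul_one]
  refine ⟨g, ⟨⟨_, h1, ?_⟩, ?_⟩, rfl⟩
  · have h2 : ((g⁻¹).val.val)ᵀ * J * (g⁻¹).val.val.map (conjA F) = J := (g⁻¹).2
    have h3 : (Ji * ((g⁻¹).val.val)ᵀ * J) * (g⁻¹).val.val.map (conjA F) = 1 := by
      rw [Matrix.mul_assoc Ji, Matrix.mul_assoc, h2, hJ]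
    have h4 : (Ji * ((g⁻¹).val.val)ᵀ * J).map (conjA F) * (g⁻¹).val.val = 1 := by
      have h5 := congrArg (fun M => M.map (conjA F)) h3
      rw [Matrix.map_mul, Matrix.map_one _ (map_zero _) (map_one _), Matrix.map_map] at h5
      rw [show (conjA F ∘ conjA F : AdeleF F → AdeleF F) = id from funext conjA_conjA,
      Matrix.map_id] at h5
      exact h5
    have h5 : (g⁻¹).val.val * g.val.val = 1 := Units.inv_mul g.val
    change (Ji * ((g⁻¹).val.val)ᵀ * J).map (conjA F) = g.val.val
    rw [← Matrix.mul_one ((Ji * ((g⁻¹).val.val)ᵀ * J).map (conjA F)), ← h5, ← Matrix.mul_assoc, h4,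
      Matrix.one_mul]
  · exact h1

end HermPair

namespace HermPair

variable {F : Type*} [Field F] [NumberField F] [IsCMField F] {n : ℕ}
  {α : Polynomial F} [Fact (Irreducible α)] [IsCMField (AdjoinRoot α)]
  (hroot : conjF (AdjoinRoot α) (AdjoinRoot.root α) = (AdjoinRoot.root α)⁻¹)
  (D : HermPair F n)

/-! ### Reduction theory: finiteness of the CM cycle -/

/-- The bilinear form `tr ⟨x, y⟩` on the adelic hermitian space `V(𝔸_{0,f})`. -/
def hermFormA : (Fin n → AdeleF F) →ₗ[AQ] (Fin n → AdeleF F) →ₗ[AQ] AQ :=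
  LinearMap.mk₂ AQ (fun x y => traceA F (herm (conjA F) (D.J.map (toAdele F)) x y))
    (fun x x' y => by rw [herm, add_dotProduct, map_add]; rfl)
    (fun c x y => by rw [herm, smul_dotProduct, map_smul]; rfl)
    (fun x y y' => by
      have h : (fun i => conjA F ((y + y') i)) =
          (fun i => conjA F (y i)) + fun i => conjA F (y' i) := by
        funext i; simp
      rw [herm, h, Matrix.mulVec_add, dotProduct_add, map_add]
      rfl)
    (fun c x y => by
      have h : (fun i => conjA F ((c • y) i)) = c • fun i => conjA F (y i) := by
        funext i
        rw [Pi.smul_apply, Pi.smul_apply, ← conjALinear_apply, map_smul, conjALinear_apply]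
      rw [herm, h, Matrix.mulVec_smul, dotProduct_smul, map_smul]
      rfl)

theorem hermFormA_apply (x y : Fin n → AdeleF F) :
    D.hermFormA x y = traceA F (herm (conjA F) (D.J.map (toAdele F)) x y) := rfl

theorem herm_toAdele (J : Matrix (Fin n) (Fin n) F) (x y : Fin n → F) :
    herm (conjA F) (J.map (toAdele F)) (fun i => toAdele F (x i)) (fun i => toAdele F (y i)) =
      toAdele F (herm (conjF F) J x y) := by
  simp [herm, Matrix.mulVec, dotProduct, map_sum, map_mul, toAdele_conj]

theorem herm_vecA (x y : Fin n → F) :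
    herm (conjA F) (D.J.map (toAdele F)) (D.vecA x) (D.vecA y) =
      toAdele F (herm (conjF F) D.J' x y) := by
  rw [vecA, vecA, herm_mulVec, D.iso_spec, herm_toAdele]

include hroot in
/-- The lattice of all `x ∈ V'(F₀)` such that `g⁻¹ x` is integral contains a nonzero vector whose
refined invariant is bounded at all archimedean places, with a bound independent of `g ∈ G(𝔸_{0,f})`
and of `δ`. -/
theorem exists_bounded_vector (hn : 0 < n) (hJ' : D.J'.det ≠ 0) :
    ∃ C : ℝ, ∀ (δ : D.GQ) (h : δ.val.val.charpoly = α) (g : D.GA), ∃ v : Fin n → F, v ≠ 0 ∧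
      (∀ i, ((g⁻¹).val.val *ᵥ D.vecA v) i ∈ stdLattice F) ∧
      ∀ τ : AdjoinRoot α →+* ℂ, ‖τ (D.refinedForm δ h v v)‖ ≤ C := by
  set b := Module.finBasis ℚ F with hb
  let bV : Module.Basis (Σ _ : Fin n, Fin (Module.finrank ℚ F)) ℚ (Fin n → F) := Pi.basis fun _ => b
  let e : Module.Basis (Σ _ : Fin n, Fin (Module.finrank ℚ F)) AQ (Fin n → AdeleF F) :=
    Pi.basis fun _ => basisAdele b
  have hbV : ∀ k, bV k = Pi.single k.1 (b k.2) := fun k => by simp [bV, Pi.basis_apply]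
  have he : ∀ k, e k = fun i => toAdele F (bV k i) := fun k => by
    rw [hbV]
    simp only [e, Pi.basis_apply]
    funext i
    rw [Pi.single_apply, Pi.single_apply, basisAdele_apply]
    split_ifs with hi
    · rfl
    · rw [map_zero]
  -- the discriminant of the standard lattice, computed in `V`, does not depend on `g` and `δ`
  obtain ⟨C, hC⟩ := exists_short_vector_of_linearEquiv (AdjoinRoot α)
    (Σ _ : Fin n, Fin (Module.finrank ℚ F))
    (Matrix.of fun k l => Algebra.trace ℚ F (herm (conjF F) D.J (bV k) (bV l))).det
  refine ⟨C, fun δ h g => ?_⟩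
  have hx₀ : (Pi.single ⟨0, hn⟩ 1 : Fin n → F) ≠ 0 := by simp
  set x₀ := (Pi.single ⟨0, hn⟩ 1 : Fin n → F)
  let ve := D.vecEquiv δ h hx₀
  have hξ : D.refinedForm δ h x₀ x₀ ≠ 0 := by
    obtain ⟨w⟩ : Nonempty (F →+* ℂ) := inferInstance
    refine D.refinedForm_self_ne_zero hroot δ h hx₀ (w := w) ?_
    rw [← RingHom.mapMatrix_apply, ← RingHom.map_det]
    exact (map_ne_zero w).2 hJ'
  -- the automorphism `g⁻¹ ∘ iso` of the adelic space
  let P : GL (Fin n) (AdeleF F) := (g⁻¹).val * D.iso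
  let A : (Fin n → AdeleF F) ≃ₗ[AQ] (Fin n → AdeleF F) :=
    LinearEquiv.ofLinearMap ((Matrix.mulVecLin P.val).restrictScalars AQ)
      ((Matrix.mulVecLin (P⁻¹).val).restrictScalars AQ)
      (LinearMap.ext fun x => by
        change P.val *ᵥ ((P⁻¹).val *ᵥ x) = x
        rw [Matrix.mulVec_mulVec, Units.mul_inv, Matrix.one_mulVec])
      (LinearMap.ext fun x => by
        change (P⁻¹).val *ᵥ (P.val *ᵥ x) = x
        rw [Matrix.mulVec_mulVec, Units.inv_mul, Matrix.one_mulVec])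
  have hA : ∀ x : Fin n → F, A (fun i => toAdele F (x i)) = (g⁻¹).val.val *ᵥ D.vecA x := by
    intro x
    change ((g⁻¹).val.val * D.iso.val) *ᵥ _ = _
    rw [← Matrix.mulVec_mulVec]
    rfl
  obtain ⟨c, hc0, hc, hle⟩ := hC e A D.hermFormA (D.refinedForm δ h x₀ x₀)
    (bV.map (ve.symm.restrictScalars ℚ)) 1 hξ isUnit_one (one_mem _)
    (fun k l => by
      rw [he, he, hA, hA, hermFormA_apply, herm_unitary, herm_vecA, traceA_toAdele]
      congr 1
      have h1 := D.herm_vecEquiv δ h hroot hx₀ (ve.symm (bV k)) (ve.symm (bV l))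
      rw [show D.vecEquiv δ h hx₀ = ve from rfl, ve.apply_symm_apply, ve.apply_symm_apply] at h1
      rw [h1, Algebra.trace_trace]
      congr 1
      change _ * ve.symm (bV k) * conjF _ (ve.symm (bV l)) = _
      ring)
    (by
      rw [one_mul]
      refine Eq.trans ?_ (RingHom.map_det (algebraMap ℚ AQ) _).symm
      congr 1
      ext1 k l
      rw [Matrix.of_apply, he, he, hermFormA_apply, herm_toAdele, traceA_toAdele]
      rfl)
  set v := ∑ k, c k • bV k with hv
  have hvA : ∑ k, algebraMap ℚ AQ (c k) • e k = fun i => toAdele F (v i) := by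
    funext i
    rw [Finset.sum_apply, hv, Finset.sum_apply, map_sum]
    exact Finset.sum_congr rfl fun k _ => by
      rw [he, Pi.smul_apply, Pi.smul_apply, smul_toAdele]
  have hsum : ∑ k, c k • (bV.map (ve.symm.restrictScalars ℚ)) k = ve.symm v := by
    rw [hv, map_sum]
    refine Finset.sum_congr rfl fun k _ => ?_
    rw [Module.Basis.map_apply]
    exact ((ve.symm.restrictScalars ℚ).map_smul (c k) (bV k)).symm
  rw [hsum] at hle
  refine ⟨v, fun h0 => hc0 (funext
    (Fintype.linearIndependent_iff.1 bV.linearIndependent c h0)), fun i j => ?_, fun τ => ?_⟩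
  · have h1 := hc ⟨i, j⟩
    rw [hvA, hA] at h1
    simpa [e, Pi.basis_repr] using h1
  · have h1 : D.refinedForm δ h v v =
        ve.symm v * conjF _ (ve.symm v) * D.refinedForm δ h x₀ x₀ := by
      rw [← D.refinedForm_vecEquiv δ h hroot hx₀, show D.vecEquiv δ h hx₀ = ve from rfl,
        ve.apply_symm_apply]
    have h2 : ‖τ (D.refinedForm δ h v v)‖ =
        ‖τ (D.refinedForm δ h x₀ x₀)‖ * ‖τ (ve.symm v)‖ ^ 2 := by
      rw [h1, map_mul, map_mul, embedding_conj, norm_mul, norm_mul, Complex.norm_conj]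
      ring
    rw [h2]
    exact (Finset.single_le_sum (f := fun τ : AdjoinRoot α →+* ℂ =>
      ‖τ (D.refinedForm δ h x₀ x₀)‖ * ‖τ (ve.symm v)‖ ^ 2)
      (fun _ _ => by positivity) (Finset.mem_univ τ)).trans hle

omit [IsCMField F] [IsCMField (AdjoinRoot α)] in
/-- An element of `F'` is determined by the traces of its products with the powers of `T`. -/
theorem eq_of_trace_root_pow_eq {x y : AdjoinRoot α} (hα : α.natDegree = n)
    (hxy : ∀ i : Fin n, Algebra.trace F (AdjoinRoot α) (AdjoinRoot.root α ^ (i : ℕ) * x) =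
      Algebra.trace F (AdjoinRoot α) (AdjoinRoot.root α ^ (i : ℕ) * y)) : x = y := by
  have h0 : α ≠ 0 := (Fact.out : Irreducible α).ne_zero
  apply ((Algebra.traceForm F (AdjoinRoot α)).toDual
    (traceForm_nondegenerate F (AdjoinRoot α))).injective
  refine (AdjoinRoot.powerBasis h0).basis.ext fun i => ?_
  change Algebra.trace F (AdjoinRoot α) (x * _) = Algebra.trace F (AdjoinRoot α) (y * _)
  have hi : (i : ℕ) < n := by rw [← hα]; exact i.2
  rw [PowerBasis.coe_basis, mul_comm x, mul_comm y]
  exact hxy ⟨i, hi⟩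

theorem toGA_inv_mulVec_vecA (δ : D.GQ) (g : D.GA) (v : Fin n → F) (i : ℕ) :
    (g⁻¹).val.val *ᵥ D.vecA ((δ ^ i).val.val *ᵥ v) =
      (g⁻¹ * D.toGA δ * g).val.val ^ i *ᵥ ((g⁻¹).val.val *ᵥ D.vecA v) := by
  have h1 : (g⁻¹ * D.toGA δ * g) ^ i * g⁻¹ = g⁻¹ * D.toGA (δ ^ i) := by
    have := conj_pow (a := g⁻¹) (b := D.toGA δ) (i := i)
    rw [inv_inv] at this
    rw [this, map_pow]
    group
  have h2 := congrArg (fun x : D.GA => x.val.val *ᵥ D.vecA v) h1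
  change ((g⁻¹ * D.toGA δ * g).val.val ^ i * (g⁻¹).val.val) *ᵥ D.vecA v =
    ((g⁻¹).val.val * (D.toGA (δ ^ i)).val.val) *ᵥ D.vecA v at h2
  rw [← Matrix.mulVec_mulVec, ← Matrix.mulVec_mulVec, toGA_vecA] at h2
  exact h2.symm

include hroot in
/-- Up to `G'(F₀)`, there are only finitely many `(δ, h K_G)` with `φ₀(h⁻¹ δ h) ≠ 0`: a short vector
`v` of the lattice attached to `h` has one of finitely many refined invariants, so that `(δ, v)` is
conjugate to one of finitely many pairs, and then `h K_G` lies in a finite set. -/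
theorem finite_orbits_heckeFun (hn : 0 < n) (hα : α.natDegree = n) (hJ' : D.J'.det ≠ 0)
    {KG : Subgroup D.GA}
    (hKG : IsOpen (KG : Set D.GA)) (f₀ : D.HeckeFun KG) :
    ∃ S : Set (D.GQ × (D.GA ⧸ KG)), S.Finite ∧ ∀ (δ : D.GQ) (q : D.GA ⧸ KG),
      δ.val.val.charpoly = α → f₀.atCoset (D.toGA δ) q ≠ 0 →
        ∃ γ : D.GQ, (γ * δ * γ⁻¹, D.toGA γ • q) ∈ S := by
  obtain ⟨C, hC⟩ := D.exists_bounded_vector hroot hn hJ'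
  -- the compact set containing the vectors `g⁻¹ δ^i v`
  let S₀ : Set (Matrix (Fin n) (Fin n) (AdeleF F)) :=
    (fun g : D.GA => g.val.val) '' tsupport f₀.toFun
  have hS₀ : IsCompact S₀ :=
    f₀.compactSupp.isCompact.image (Units.continuous_val.comp continuous_subtype_val)
  let Λ : Set (Fin n → AdeleF F) := Set.univ.pi fun _ => stdLattice F
  have hΛ : IsCompact Λ := isCompact_univ_pi fun _ => isCompact_stdLattice
  let N : Set (Fin n → AdeleF F) := ⋃ i : Fin n,
    (fun p : Matrix (Fin n) (Fin n) (AdeleF F) × (Fin n → AdeleF F) => p.1 ^ (i : ℕ) *ᵥ p.2) ''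
      (S₀ ×ˢ Λ)
  have hN : IsCompact N := isCompact_iUnion fun i => (hS₀.prod hΛ).image (by fun_prop)
  -- the refined invariants lie in a finite set
  let T : Set (AdjoinRoot α) := {x | ∃ (δ : D.GQ) (h : δ.val.val.charpoly = α) (g : D.GA)
    (v : Fin n → F), v ≠ 0 ∧ (∀ i : Fin n,
      (g⁻¹).val.val *ᵥ D.vecA ((δ ^ (i : ℕ)).val.val *ᵥ v) ∈ N) ∧
      (∀ τ : AdjoinRoot α →+* ℂ, ‖τ (D.refinedForm δ h v v)‖ ≤ C) ∧ D.refinedForm δ h v v = x}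
  have hT : T.Finite := by
    let R : Set F := {y | toAdele F y ∈ (fun p : (Fin n → AdeleF F) × (Fin n → AdeleF F) =>
      herm (conjA F) (D.J.map (toAdele F)) p.1 p.2) '' (N ×ˢ N) ∧ ∀ w : F →+* ℂ, ‖w y‖ ≤ n * C}
    have hR : R.Finite := by
      refine finite_toAdele_mem_of_norm_le ((hN.prod hN).image ?_) _
      have := continuous_conjA (F := F)
      simp only [herm, dotProduct, Matrix.mulVec]
      fun_prop
    have hinj : Function.Injective fun (x : AdjoinRoot α) (i : Fin n) =>
        Algebra.trace F (AdjoinRoot α) (AdjoinRoot.root α ^ (i : ℕ) * x) :=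
      fun x y hxy => eq_of_trace_root_pow_eq hα (congrFun hxy)
    refine Set.Finite.of_finite_image ((Set.Finite.pi' fun _ : Fin n => hR).subset ?_)
      (hinj.injOn (s := T))
    rintro _ ⟨_, ⟨δ, h, g, v, -, hmem, hbd, rfl⟩, rfl⟩ i
    have hval : herm (conjA F) (D.J.map (toAdele F))
        ((g⁻¹).val.val *ᵥ D.vecA ((δ ^ (i : ℕ)).val.val *ᵥ v))
        ((g⁻¹).val.val *ᵥ D.vecA ((δ ^ ((⟨0, hn⟩ : Fin n) : ℕ)).val.val *ᵥ v)) =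
        toAdele F (Algebra.trace F (AdjoinRoot α)
          (AdjoinRoot.root α ^ (i : ℕ) * D.refinedForm δ h v v)) := by
      rw [herm_unitary, herm_vecA, trace_mul_refinedForm, map_pow, actF'_root, pow_zero]
      congr 2
      exact Matrix.one_mulVec v
    refine ⟨⟨((g⁻¹).val.val *ᵥ D.vecA ((δ ^ (i : ℕ)).val.val *ᵥ v),
      (g⁻¹).val.val *ᵥ D.vecA ((δ ^ ((⟨0, hn⟩ : Fin n) : ℕ)).val.val *ᵥ v)),
      ⟨hmem i, hmem ⟨0, hn⟩⟩, hval⟩, fun w => ?_⟩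
    · rw [map_trace_eq_sum]
      refine (norm_sum_le_of_le _ (f := fun τ : EmbOver α w =>
        τ.1 (AdjoinRoot.root α ^ (i : ℕ) * D.refinedForm δ h v v)) (n := fun _ => C)
        fun τ _ => ?_).trans ?_
      · have hr0 : AdjoinRoot.root α * (AdjoinRoot.root α)⁻¹ = 1 := by
          refine mul_inv_cancel₀ fun h0 => ?_
          have h1 := D.actF'_root δ h
          rw [h0, map_zero] at h1
          have : Nonempty (Fin n) := ⟨⟨0, hn⟩⟩
          exact δ.val.ne_zero h1.symm
        -- the involution inverts `T`
        have hr : ‖τ.1 (AdjoinRoot.root α)‖ = 1 := by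
          rw [← hroot] at hr0
          have h1 := congrArg τ.1 hr0
          rw [map_mul, map_one, embedding_conj, Complex.mul_conj, Complex.normSq_eq_norm_sq] at h1
          have h2 : ‖τ.1 (AdjoinRoot.root α)‖ ^ 2 = 1 := by exact_mod_cast h1
          exact (pow_eq_one_iff_of_nonneg (norm_nonneg _) two_ne_zero).1 h2
        rw [map_mul, map_pow, norm_mul, norm_pow, hr, one_pow, one_mul]
        exact hbd τ.1
      · rw [Finset.sum_const, Finset.card_univ, card_embOver D δ h w, nsmul_eq_mul]
  -- a representative `(δ₁, v₁)` for each of the finitely many refined invariants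
  have hT' : ∀ x : T, ∃ (δ : D.GQ) (v : Fin n → F), ∃ h : δ.val.val.charpoly = α, v ≠ 0 ∧
      D.refinedForm δ h v v = x := by
    rintro ⟨x, δ, h, g, v, hv, -, -, hx⟩
    exact ⟨δ, v, h, hv, hx⟩
  choose δ₁ v₁ h₁ hv₁ hx₁ using hT'
  have := hT.to_subtype
  refine ⟨⋃ x : T, {δ₁ x} ×ˢ {q : D.GA ⧸ KG | ∃ g : D.GA, (g : D.GA ⧸ KG) = q ∧
      ∀ i : Fin n, (g⁻¹).val.val *ᵥ D.vecA ((δ₁ x ^ (i : ℕ)).val.val *ᵥ v₁ x) ∈ N},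
    Set.finite_iUnion fun x => (Set.finite_singleton _).prod
      (D.finite_cosets_of_cyclic hJ' hKG (δ₁ x) (h₁ x) (hv₁ x) hN), fun δ q h hq => ?_⟩
  obtain ⟨g, rfl⟩ := QuotientGroup.mk_surjective q
  obtain ⟨v, hv, hint, hbd⟩ := hC δ h g
  have hmem : ∀ i : Fin n, (g⁻¹).val.val *ᵥ D.vecA ((δ ^ (i : ℕ)).val.val *ᵥ v) ∈ N := by
    intro i
    rw [toGA_inv_mulVec_vecA]
    exact Set.mem_iUnion.2 ⟨i, (_, _), ⟨⟨_, subset_tsupport _ hq, rfl⟩, fun j _ => hint j⟩, rfl⟩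
  let x : T := ⟨D.refinedForm δ h v v, δ, h, g, v, hv, hmem, hbd, rfl⟩
  -- `γ` moves `(δ, v)` to the chosen representative with the same refined invariant
  obtain ⟨γ, hγ, hγv⟩ := D.exists_conj_of_refinedForm_eq hroot h (h₁ x) hv (hv₁ x) (hx₁ x).symm
  refine ⟨γ, Set.mem_iUnion.2 ⟨x, hγ, D.toGA γ * g, rfl, fun i => ?_⟩⟩
  have h2 : (D.toGA γ * g)⁻¹ * D.toGA γ = g⁻¹ := by group
  have h3 : δ₁ x ^ (i : ℕ) * γ = γ * δ ^ (i : ℕ) := by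
    rw [← hγ, conj_pow]; group
  have h4 : (δ₁ x ^ (i : ℕ)).val.val *ᵥ v₁ x = γ.val.val *ᵥ ((δ ^ (i : ℕ)).val.val *ᵥ v) := by
    rw [← hγv, Matrix.mulVec_mulVec, Matrix.mulVec_mulVec]
    exact congrArg (fun y : D.GQ => y.val.val *ᵥ v) h3
  rw [h4, ← toGA_vecA, Matrix.mulVec_mulVec]
  change ((D.toGA γ * g)⁻¹ * D.toGA γ).val.val *ᵥ _ ∈ N
  rw [h2]
  exact hmem i

end HermPair

/-! ### Convergence of the Green function -/

theorem abs_Ei_neg_le {s : ℝ} (hs : 1 ≤ s) : |Ei (-s)| ≤ Real.exp (-s) := by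
  rw [Ei, neg_neg, abs_neg, ← integral_exp_neg_Ioi s, ← Real.norm_eq_abs]
  refine norm_integral_le_of_norm_le (integrableOn_exp_neg_Ioi s) ?_
  filter_upwards [ae_restrict_mem measurableSet_Ioi] with t ht
  have ht1 : 1 ≤ t := hs.trans (le_of_lt ht)
  rw [Real.norm_eq_abs, abs_of_nonneg (by positivity)]
  exact div_le_self (Real.exp_pos _).le ht1

/-- A large power of the norm is summable over the integral vectors. The exponent is even, to match
bounds in terms of `‖m‖ ^ 2`. -/
theorem exists_summable_norm_inv_pow (ι : Type*) [Fintype ι] :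
    ∃ k : ℕ, Summable fun m : ι → ℤ => ‖m‖⁻¹ ^ (2 * k) := by
  let L := Submodule.span ℤ (Set.range (Pi.basisFun ℝ ι))
  have hmem : ∀ m : ι → ℤ, (fun i => (m i : ℝ)) ∈ L := by
    intro m
    have : (fun i => (m i : ℝ)) = ∑ i, m i • Pi.basisFun ℝ ι i := by
      classical
      funext j
      simp [Finset.sum_apply, Pi.single_apply]
    rw [this]
    exact Submodule.sum_mem _ fun i _ => Submodule.smul_mem _ _ (Submodule.subset_span ⟨i, rfl⟩)
  refine ⟨Module.finrank ℤ L + 1, ?_⟩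
  have h1 := ZLattice.summable_norm_pow_inv L (2 * (Module.finrank ℤ L + 1)) (by omega)
  have h2 : Function.Injective fun m : ι → ℤ => (⟨fun i => (m i : ℝ), hmem m⟩ : L) := by
    intro m m' hmm
    funext i
    exact Int.cast_injective (α := ℝ) (congrFun (congrArg Subtype.val hmm) i)
  refine (h1.comp_injective h2).congr fun m => ?_
  congr 2

/-- A family of values of `Ei`, indexed by integral vectors, at arguments of quadratic growth is
summable. -/
theorem summable_of_quadratic_growth {S ι : Type*} [Fintype ι] [Nonempty ι] {m : S → ι → ℤ}
    (hm : Function.Injective m) {R : S → ℝ} {A t c M : ℝ} (hA : 0 < A) (hc : 0 < c)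
    (hR : ∀ s i, (m s i : ℝ) ^ 2 ≤ A * (t + |R s|)) {g : S → ℝ}
    (hg : ∀ s, ‖g s‖ ≤ M * |Ei (-(c * |R s|))|) : Summable g := by
  obtain ⟨k, hk⟩ := exists_summable_norm_inv_pow ι
  have hM : ∀ s, ‖g s‖ ≤ |M| * |Ei (-(c * |R s|))| := fun s =>
    (hg s).trans (mul_le_mul_of_nonneg_right (le_abs_self M) (abs_nonneg _))
  have hN : ∀ s, ‖m s‖ ^ 2 ≤ A * (t + |R s|) := by
    intro s
    have h0 : 0 ≤ A * (t + |R s|) := (sq_nonneg _).trans (hR s (Classical.arbitrary ι))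
    have h1 : ‖m s‖ ≤ √(A * (t + |R s|)) := by
      rw [pi_norm_le_iff_of_nonneg (Real.sqrt_nonneg _)]
      intro i
      rw [Int.norm_eq_abs]
      exact Real.abs_le_sqrt (hR s i)
    calc ‖m s‖ ^ 2 ≤ √(A * (t + |R s|)) ^ 2 := pow_le_pow_left₀ (norm_nonneg _) h1 2
      _ = _ := Real.sq_sqrt h0
  have htend : Filter.Tendsto (fun s => ‖m s‖) Filter.cofinite Filter.atTop := by
    have h1 := tendsto_norm_cocompact_atTop (E := ι → ℤ)
    rw [Filter.cocompact_eq_cofinite] at h1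
    exact h1.comp hm.tendsto_cofinite
  refine Summable.of_norm_bounded_eventually
    (g := fun s => |M| * (k.factorial * (2 * A / c) ^ k) * ‖m s‖⁻¹ ^ (2 * k))
    ((hk.comp_injective hm).mul_left _) ?_
  filter_upwards [htend.eventually_ge_atTop (2 * A * |t| + 2 * A / c + 1)] with s hs
  -- for large `m s`, the additive constant `t` is negligible and the argument of `Ei` is at most
  -- `-1`
  set N := ‖m s‖ with hNdef
  have hAc : 0 < 2 * A / c := by positivity
  have hAt : 0 ≤ 2 * A * |t| := by positivity
  have hN1 : 1 ≤ N := by linarith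
  have hN2 : N ≤ N ^ 2 := by nlinarith
  have h1 := hN s
  have h2 : A * t ≤ A * |t| := mul_le_mul_of_nonneg_left (le_abs_self t) hA.le
  have h3 : N ^ 2 / 2 ≤ A * |R s| := by nlinarith
  have h4 : N ^ 2 / (2 * A / c) ≤ c * |R s| := by
    rw [div_div_eq_mul_div, div_le_iff₀ (by positivity)]
    nlinarith
  have h5 : 1 ≤ N ^ 2 / (2 * A / c) := by
    rw [one_le_div hAc]; linarith
  have h6 : |Ei (-(c * |R s|))| ≤ k.factorial * (2 * A / c) ^ k * N⁻¹ ^ (2 * k) := by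
    have hs0 : 0 < N ^ 2 / (2 * A / c) := by linarith
    calc |Ei (-(c * |R s|))| ≤ Real.exp (-(c * |R s|)) := abs_Ei_neg_le (h5.trans h4)
      _ ≤ Real.exp (-(N ^ 2 / (2 * A / c))) := Real.exp_le_exp.2 (neg_le_neg h4)
      _ = (Real.exp (N ^ 2 / (2 * A / c)))⁻¹ := Real.exp_neg _
      _ ≤ ((N ^ 2 / (2 * A / c)) ^ k / k.factorial)⁻¹ := by
          have := Real.pow_div_factorial_le_exp (N ^ 2 / (2 * A / c)) hs0.le k
          exact inv_anti₀ (by positivity) this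
      _ = _ := by
          rw [inv_div, div_pow, div_div_eq_mul_div, inv_pow, ← pow_mul, div_eq_mul_inv]
  rw [mul_assoc]
  exact (hM s).trans (mul_le_mul_of_nonneg_left h6 (abs_nonneg M))

/-- A rational linear form on a number field is bounded in terms of the archimedean absolute
values. -/
theorem exists_abs_linear_le {K : Type*} [Field K] [NumberField K] (l : K →ₗ[ℚ] ℚ) :
    ∃ C : ℝ, 0 ≤ C ∧ ∀ (x : K) (B : ℝ), (∀ τ : K →+* ℂ, ‖τ x‖ ≤ B) → |((l x : ℚ) : ℝ)| ≤ C * B := by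
  obtain ⟨g, rfl⟩ := ((Algebra.traceForm ℚ K).toDual (traceForm_nondegenerate ℚ K)).surjective l
  refine ⟨∑ τ : K →+* ℂ, ‖τ g‖, Finset.sum_nonneg fun _ _ => norm_nonneg _, fun x B hB => ?_⟩
  have h1 : ((((Algebra.traceForm ℚ K).toDual (traceForm_nondegenerate ℚ K)) g x : ℚ) : ℂ) =
      ∑ τ : K →+* ℂ, τ (g * x) := trace_eq_sum_complexEmbeddings K (g * x)
  have h2 : |((((Algebra.traceForm ℚ K).toDual (traceForm_nondegenerate ℚ K)) g x : ℚ) : ℝ)| =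
      ‖∑ τ : K →+* ℂ, τ (g * x)‖ := by
    rw [← h1, ← Complex.ofReal_ratCast, Complex.norm_real, Real.norm_eq_abs]
  rw [h2, Finset.sum_mul]
  refine norm_sum_le_of_le _ fun τ _ => ?_
  rw [map_mul, norm_mul]
  exact mul_le_mul_of_nonneg_left (hB τ) (norm_nonneg _)

namespace HermPair

variable {F : Type*} [Field F] [NumberField F] [IsCMField F] {n : ℕ}
  {α : Polynomial F} [Fact (Irreducible α)] [IsCMField (AdjoinRoot α)]
  (hroot : conjF (AdjoinRoot α) (AdjoinRoot.root α) = (AdjoinRoot.root α)⁻¹)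
  (D : HermPair F n) (hn : 0 < n) {v₀ : maximalRealSubfield F →+* ℝ}
  (hV'₀ : ∀ w : F →+* ℂ, (∀ x : maximalRealSubfield F, w (x : F) = (v₀ x : ℂ)) →
    HasSignature (D.J'.map w) (n - 1))
  (hV' : ∀ w : F →+* ℂ, ¬ (∀ x : maximalRealSubfield F, w (x : F) = (v₀ x : ℂ)) →
    HasSignature (D.J'.map w) n)
  {w₀ : F →+* ℂ} (hw₀ : ∀ x : maximalRealSubfield F, w₀ (x : F) = (v₀ x : ℂ))
  (δ : D.GQ) (h : δ.val.val.charpoly = α)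
  {z : NegLine (D.J'.map w₀)} (hz : D.actLine w₀ δ z = z)

include hroot hn hV'₀ hV' hw₀ h hz

theorem RFun_fixed_neg {u : Fin n → F} (hu : u ≠ 0) : RFun (fun i => w₀ (u i)) z < 0 := by
  obtain ⟨τ₀, hneg, hpos, -⟩ := D.exists_negative_embedding hroot hn hV'₀ hV' hw₀ δ h hu
  rw [D.RFun_eq_re_refinedForm hroot δ h hu hneg hpos (hV'₀ w₀ hw₀).det_ne_zero z hz]
  exact hneg

/-- The majorant `∑_τ |τ(ξ')|` of the trace form is `tr ⟨u, u⟩ + 4 |R(u, z_δ)|`, since the refined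
invariant is negative at two embeddings only. -/
theorem sum_norm_refinedForm_le {u : Fin n → F} (hu : u ≠ 0) :
    ∑ τ : AdjoinRoot α →+* ℂ, ‖τ (D.refinedForm δ h u u)‖ ≤
      (Algebra.trace ℚ F (herm (conjF F) D.J' u u) : ℝ) + 4 * |RFun (fun i => w₀ (u i)) z| := by
  classical
  obtain ⟨τ₀, hneg, hpos, huniq⟩ := D.exists_negative_embedding hroot hn hV'₀ hV' hw₀ δ h hu
  have hR := D.RFun_eq_re_refinedForm hroot δ h hu hneg hpos (hV'₀ w₀ hw₀).det_ne_zero z hz u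
  set R := RFun (fun i => w₀ (u i)) z with hRdef
  have htr : ((Algebra.trace ℚ F (herm (conjF F) D.J' u u) : ℚ) : ℝ) =
      ∑ τ : AdjoinRoot α →+* ℂ, (τ (D.refinedForm δ h u u)).re := by
    have h1 := D.trace_mul_refinedForm δ h u u 1
    rw [one_mul, map_one, Matrix.one_mulVec] at h1
    have h2 := trace_eq_sum_complexEmbeddings (AdjoinRoot α) (D.refinedForm δ h u u)
    rw [← Complex.re_sum, ← h2, ← h1, Algebra.trace_trace, ← Complex.ofReal_ratCast,
      Complex.ofReal_re]
  have hterm : ∀ τ : AdjoinRoot α →+* ℂ, ‖τ (D.refinedForm δ h u u)‖ ≤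
      (τ (D.refinedForm δ h u u)).re + ((if τ = τ₀.1 then 2 * |R| else 0) +
        (if τ = ComplexEmbedding.conjugate τ₀.1 then 2 * |R| else 0)) := by
    intro τ
    have h0 : (0 : ℝ) ≤ if τ = τ₀.1 then 2 * |R| else 0 := by split_ifs <;> positivity
    have h0' : (0 : ℝ) ≤ if τ = ComplexEmbedding.conjugate τ₀.1 then 2 * |R| else 0 := by
      split_ifs <;> positivity
    rw [D.embedding_refinedForm hroot δ h τ u, Complex.norm_real, Complex.ofReal_re,
      Real.norm_eq_abs]
    rcases lt_or_ge 0 (τ (D.refinedForm δ h u u)).re with h1 | h1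
    · rw [abs_of_pos h1]
      linarith
    · rcases huniq τ h1 with h2 | h2
      · have h3 : (τ (D.refinedForm δ h u u)).re = R := by rw [h2, hR]
        rw [if_pos h2, h3]
        linarith [neg_abs_le R]
      · rw [if_pos h2]
        have h3 : (τ (D.refinedForm δ h u u)).re = R := by
          rw [h2, ComplexEmbedding.conjugate_coe_eq, Complex.conj_re, hR]
        rw [h3]
        linarith [neg_abs_le R]
  refine (Finset.sum_le_sum fun τ _ => hterm τ).trans ?_
  rw [Finset.sum_add_distrib, Finset.sum_add_distrib, Finset.sum_ite_eq', Finset.sum_ite_eq',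
    htr, if_pos (Finset.mem_univ _), if_pos (Finset.mem_univ _)]
  linarith

omit hroot hn hV'₀ hV' hw₀ h hz [IsCMField (AdjoinRoot α)] [Fact (Irreducible α)] in
/-- The rational vectors in the support of a translate of `φ` lie in a lattice. -/
theorem exists_denominator {KG : Subgroup D.GA} (f : D.VecFun KG) (g : D.GA) :
    ∃ N : ℕ, 0 < N ∧ ∀ u : Fin n → F, f.toFun ((g⁻¹).val.val *ᵥ D.vecA u) ≠ 0 →
      ∀ i j, ∃ m : ℤ, (N : ℚ) * (Module.finBasis ℚ F).repr (u i) j = m := by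
  have hc : IsCompact ((fun y : Fin n → AdeleF F => (D.iso⁻¹).val *ᵥ (g.val.val *ᵥ y)) ''
      tsupport f.toFun) := f.compactSupp.isCompact.image (by fun_prop)
  have h1 : ∀ i j, ∃ N : ℕ, 0 < N ∧ ∀ y ∈ (fun y : Fin n → AdeleF F =>
      (D.iso⁻¹).val *ᵥ (g.val.val *ᵥ y)) '' tsupport f.toFun,
      (N : AQ) * (basisAdele (Module.finBasis ℚ F)).repr (y i) j ∈ Zhat := by
    intro i j
    obtain ⟨N, hN, hC⟩ := exists_nat_mul_mem_Zhat_of_isCompact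
      (hc.image ((continuous_repr (Module.finBasis ℚ F) j).comp (continuous_apply i)))
    exact ⟨N, hN, fun y hy => hC _ ⟨y, hy, rfl⟩⟩
  choose N hN hNC using h1
  refine ⟨∏ i, ∏ j, N i j, Finset.prod_pos fun i _ => Finset.prod_pos fun j _ => hN i j,
    fun u hu i j => ?_⟩
  have hmem : (fun i => toAdele F (u i)) ∈ (fun y : Fin n → AdeleF F =>
      (D.iso⁻¹).val *ᵥ (g.val.val *ᵥ y)) '' tsupport f.toFun := by
    refine ⟨_, subset_tsupport _ hu, ?_⟩
    change (D.iso⁻¹).val *ᵥ (g.val.val *ᵥ ((g⁻¹).val.val *ᵥ (D.iso.val *ᵥ _))) = _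
    have h2 : g.val.val * (g⁻¹).val.val = 1 := Units.mul_inv g.val
    rw [Matrix.mulVec_mulVec _ g.val.val, h2, Matrix.one_mulVec, Matrix.mulVec_mulVec,
      Units.inv_mul, Matrix.one_mulVec]
  have h2 := hNC i j _ hmem
  rw [basisAdele_repr_toAdele, ← map_natCast (algebraMap ℚ AQ), ← map_mul] at h2
  obtain ⟨m, hm⟩ := algebraMap_mem_Zhat h2
  obtain ⟨c, hc⟩ : N i j ∣ ∏ i, ∏ j, N i j :=
    (Finset.dvd_prod_of_mem (N i) (Finset.mem_univ j)).trans
      (Finset.dvd_prod_of_mem (fun i => ∏ j, N i j) (Finset.mem_univ i))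
  refine ⟨c * m, ?_⟩
  rw [hc]
  push_cast
  rw [← hm]
  ring

/-- The coordinates of `u` are bounded by `R(u, z_δ)`: for fixed `⟨u, u⟩`, the function `|R(u,
z_δ)|` grows quadratically on lattices. -/
theorem exists_coordinate_bound : ∃ A : ℝ, 0 < A ∧ ∀ u : Fin n → F, u ≠ 0 → ∀ i j,
    (((Module.finBasis ℚ F).repr (u i) j : ℚ) : ℝ) ^ 2 ≤
      A * ((Algebra.trace ℚ F (herm (conjF F) D.J' u u) : ℝ) +
        4 * |RFun (fun i => w₀ (u i)) z|) := by
  have hx₀ : (Pi.single ⟨0, hn⟩ 1 : Fin n → F) ≠ 0 := by simp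
  set x₀ := (Pi.single ⟨0, hn⟩ 1 : Fin n → F)
  let ve := D.vecEquiv δ h hx₀
  have hξ : D.refinedForm δ h x₀ x₀ ≠ 0 :=
    D.refinedForm_self_ne_zero hroot δ h hx₀ (hV'₀ w₀ hw₀).det_ne_zero
  have hl : ∀ i j, ∃ C : ℝ, 0 ≤ C ∧ ∀ (x : AdjoinRoot α) (B : ℝ),
      (∀ τ : AdjoinRoot α →+* ℂ, ‖τ x‖ ≤ B) →
        |(((Module.finBasis ℚ F).repr (ve x i) j : ℚ) : ℝ)| ≤ C * B := fun i j =>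
    exists_abs_linear_le (((Module.finBasis ℚ F).coord j).comp
      ((LinearMap.proj i).comp (ve.toLinearMap.restrictScalars ℚ)))
  choose C hC0 hC using hl
  set c₁ : ℝ := ∑ τ : AdjoinRoot α →+* ℂ, ‖τ (D.refinedForm δ h x₀ x₀)‖⁻¹ with hc₁
  have hc₁0 : 0 ≤ c₁ := Finset.sum_nonneg fun _ _ => by positivity
  set C₁ : ℝ := ∑ i, ∑ j, C i j ^ 2 with hC₁
  have hC₁0 : 0 ≤ C₁ := Finset.sum_nonneg fun _ _ => Finset.sum_nonneg fun _ _ => by positivity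
  refine ⟨C₁ * c₁ + 1, by positivity, fun u hu i j => ?_⟩
  have hle := D.sum_norm_refinedForm_le hroot hn hV'₀ hV' hw₀ δ h hz hu
  set Q := (Algebra.trace ℚ F (herm (conjF F) D.J' u u) : ℝ) + 4 * |RFun (fun i => w₀ (u i)) z|
  have hQ0 : 0 ≤ Q := (Finset.sum_nonneg fun _ _ => norm_nonneg _).trans hle
  set a := ve.symm u with ha
  have h1 : D.refinedForm δ h u u = a * conjF _ a * D.refinedForm δ h x₀ x₀ := by
    rw [← D.refinedForm_vecEquiv δ h hroot hx₀, show D.vecEquiv δ h hx₀ = ve from rfl, ha,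
      ve.apply_symm_apply]
  have h2 : ∀ τ : AdjoinRoot α →+* ℂ, ‖τ a‖ ≤ √(c₁ * Q) := by
    intro τ
    apply Real.le_sqrt_of_sq_le
    have h3 : ‖τ (D.refinedForm δ h u u)‖ = ‖τ a‖ ^ 2 * ‖τ (D.refinedForm δ h x₀ x₀)‖ := by
      rw [h1, map_mul, map_mul, embedding_conj, norm_mul, norm_mul, Complex.norm_conj]
      ring
    have h4 : 0 < ‖τ (D.refinedForm δ h x₀ x₀)‖ := norm_pos_iff.2 ((map_ne_zero τ).2 hξ)
    have h5 : ‖τ (D.refinedForm δ h u u)‖ ≤ Q :=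
      (Finset.single_le_sum (f := fun τ : AdjoinRoot α →+* ℂ => ‖τ (D.refinedForm δ h u u)‖)
        (fun _ _ => norm_nonneg _) (Finset.mem_univ τ)).trans hle
    have h6 : ‖τ (D.refinedForm δ h x₀ x₀)‖⁻¹ ≤ c₁ :=
      Finset.single_le_sum (f := fun τ : AdjoinRoot α →+* ℂ =>
        ‖τ (D.refinedForm δ h x₀ x₀)‖⁻¹) (fun _ _ => by positivity) (Finset.mem_univ τ)
    calc ‖τ a‖ ^ 2 = ‖τ (D.refinedForm δ h x₀ x₀)‖⁻¹ * ‖τ (D.refinedForm δ h u u)‖ := by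
          rw [h3]; field_simp
      _ ≤ c₁ * Q := mul_le_mul h6 h5 (norm_nonneg _) hc₁0
  have h3 := hC i j a _ h2
  rw [ha, ve.apply_symm_apply] at h3
  have h4 : C i j ^ 2 ≤ C₁ :=
    (Finset.single_le_sum (f := fun j => C i j ^ 2) (fun _ _ => by positivity)
      (Finset.mem_univ j)).trans (Finset.single_le_sum (f := fun i => ∑ j, C i j ^ 2)
        (fun _ _ => Finset.sum_nonneg fun _ _ => by positivity) (Finset.mem_univ i))
  calc (((Module.finBasis ℚ F).repr (u i) j : ℚ) : ℝ) ^ 2 ≤ (C i j * √(c₁ * Q)) ^ 2 := by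
        rw [← sq_abs]
        exact pow_le_pow_left₀ (abs_nonneg _) h3 2
    _ = C i j ^ 2 * (c₁ * Q) := by rw [mul_pow, Real.sq_sqrt (by positivity)]
    _ ≤ C₁ * (c₁ * Q) := mul_le_mul_of_nonneg_right h4 (by positivity)
    _ ≤ (C₁ * c₁ + 1) * Q := by nlinarith

/-- The series defining the Green function converges at the points of the CM cycle. -/
theorem summable_greenTerm {KZ : Subgroup (ZA F)} {KG : Subgroup D.GA} (f : D.VecFun KG) {a : ℝ}
    (ha : 0 < a) {ξ : maximalRealSubfield F} (hξ : ξ ≠ 0) (x : D.Cover w₀ KZ KG)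
    (hx : x.line = z) : Summable fun u : D.VecNorm ξ => greenTerm f a x u.1 := by
  obtain ⟨g, hg⟩ := QuotientGroup.mk_surjective x.gc
  obtain ⟨N, hN, hNint⟩ := D.exists_denominator f g
  obtain ⟨A, hA, hAle⟩ := D.exists_coordinate_bound hroot hn hV'₀ hV' hw₀ δ h hz
  obtain ⟨M, hM⟩ := f.compactSupp.exists_bound_of_continuous f.locConst.continuous
  have hterm : ∀ u : Fin n → F, greenTerm f a x u =
      f.toFun ((g⁻¹).val.val *ᵥ D.vecA u) * D.kudlaGreen w₀ a u z := by
    intro u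
    rw [greenTerm, ← hg, hx]
    rfl
  have hu0 : ∀ u : D.VecNorm ξ, u.1 ≠ 0 := by
    rintro ⟨u, hu⟩ rfl
    simp only [herm, zero_dotProduct] at hu
    exact hξ (Subtype.ext hu.symm)
  -- only the vectors in the support of `φ` contribute
  let S := {u : D.VecNorm ξ // f.toFun ((g⁻¹).val.val *ᵥ D.vecA u.1) ≠ 0}
  rw [← Function.Injective.summable_iff (g := (Subtype.val : S → D.VecNorm ξ))
    Subtype.val_injective (fun u hu => by
      rw [hterm]
      by_contra hne
      exact hu ⟨⟨u, left_ne_zero_of_mul hne⟩, rfl⟩)]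
  have hint : ∀ (u : S) (k : Fin n × Fin (Module.finrank ℚ F)), ∃ m : ℤ,
      (N : ℚ) * (Module.finBasis ℚ F).repr (u.1.1 k.1) k.2 = m :=
    fun u k => hNint u.1.1 u.2 k.1 k.2
  choose m hm using hint
  have hinj : Function.Injective m := by
    intro u u' huu
    apply Subtype.ext
    apply Subtype.ext
    funext i
    apply (Module.finBasis ℚ F).repr.injective
    ext j
    have h1 := hm u (i, j)
    rw [huu, ← hm u' (i, j)] at h1
    exact mul_left_cancel₀ (by positivity) h1
  have : Nonempty (Fin n × Fin (Module.finrank ℚ F)) :=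
    ⟨⟨⟨0, hn⟩, ⟨0, Module.finrank_pos⟩⟩⟩
  -- the integral vectors are the coordinates of `N u`, whose squares are at most
  -- `N² A (tr ξ + 4 |R(u, z)|) = 4 N² A (tr ξ / 4 + |R(u, z)|)`
  refine summable_of_quadratic_growth (M := M) (t := (Algebra.trace ℚ F (ξ : F) : ℝ) / 4)
    (A := N ^ 2 * A * 4) (c := 2 * Real.pi * a)
    (R := fun u : S => RFun (fun i => w₀ (u.1.1 i)) z) hinj (by positivity) (by positivity)
    (fun u k => ?_) (fun u => ?_)
  · have h1 := hAle u.1.1 (hu0 u.1) k.1 k.2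
    rw [u.1.2] at h1
    have h2 : (m u k : ℝ) = N * (((Module.finBasis ℚ F).repr (u.1.1 k.1) k.2 : ℚ) : ℝ) := by
      exact_mod_cast congrArg (fun q : ℚ => (q : ℝ)) (hm u k).symm
    rw [h2, mul_pow]
    calc _ ≤ (N : ℝ) ^ 2 * (A * ((Algebra.trace ℚ F (ξ : F) : ℝ) +
          4 * |RFun (fun i => w₀ (u.1.1 i)) z|)) := mul_le_mul_of_nonneg_left h1 (by positivity)
      _ = _ := by ring
  · have h1 := D.RFun_fixed_neg hroot hn hV'₀ hV' hw₀ δ h hz (hu0 u.1)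
    rw [Function.comp_apply, hterm, norm_mul, kudlaGreen, norm_neg, abs_of_neg h1, mul_neg,
      neg_neg, Real.norm_eq_abs (Ei _)]
    exact mul_le_mul_of_nonneg_right (hM _) (abs_nonneg _)

end HermPair

/-! ### Orbital integrals as sums over cosets -/

/-- The integral of a function on `G / K` with finite support is the sum of its values, if the open
subgroup `K` has volume one. -/
theorem integral_comp_mk {G : Type*} [Group G] [TopologicalSpace G] [IsTopologicalGroup G]
    [MeasurableSpace G] [BorelSpace G] (μ : Measure G) [μ.IsMulLeftInvariant] {K : Subgroup G}
    (hK : IsOpen (K : Set G)) (hμ : μ (K : Set G) = 1) {ψ : G ⧸ K → ℝ}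
    (hψ : (Function.support ψ).Finite) :
    Integrable (fun g : G => ψ g) μ ∧ ∫ g, ψ (g : G ⧸ K) ∂μ = ∑' q, ψ q := by
  classical
  let B : G ⧸ K → Set G := fun q => (fun g : G => (g : G ⧸ K)) ⁻¹' {q}
  have hB : ∀ q, MeasurableSet (B q) ∧ μ (B q) = 1 := by
    intro q
    obtain ⟨g, rfl⟩ := QuotientGroup.mk_surjective q
    have h1 : B g = (fun x => g⁻¹ * x) ⁻¹' (K : Set G) := by
      ext x
      simp only [B, Set.mem_preimage, Set.mem_singleton_iff, SetLike.mem_coe]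
      rw [eq_comm, QuotientGroup.eq]
    rw [h1]
    exact ⟨(hK.preimage (continuous_const_mul _)).measurableSet, by
      rw [measure_preimage_mul, hμ]⟩
  have h1 : (fun g : G => ψ g) =
      fun g => ∑ q ∈ hψ.toFinset, (B q).indicator (fun _ => ψ q) g := by
    funext g
    by_cases hg : ψ g = 0
    · rw [hg, Finset.sum_eq_zero]
      intro q hq
      apply Set.indicator_of_notMem
      intro hmem
      have h2 : (g : G ⧸ K) = q := hmem
      rw [Set.Finite.mem_toFinset, Function.mem_support, ← h2] at hq
      exact hq hg
    · rw [Finset.sum_eq_single (g : G ⧸ K)]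
      · have hg' : g ∈ B g := rfl
        exact (Set.indicator_of_mem hg' fun _ => ψ (g : G ⧸ K)).symm
      · intro q _ hq
        have hg' : g ∉ B q := fun hmem => hq (Eq.symm hmem)
        exact Set.indicator_of_notMem hg' fun _ => ψ q
      · intro hmem
        exact absurd (hψ.mem_toFinset.2 hg) hmem
  have hint : ∀ q, Integrable ((B q).indicator fun _ => ψ q) μ := fun q =>
    (integrable_indicator_iff (hB q).1).2 (integrableOn_const (by rw [(hB q).2]; simp))
  refine ⟨?_, ?_⟩
  · rw [h1]
    exact integrable_finsetSum _ fun q _ => hint q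
  · rw [h1, integral_finsetSum _ fun q _ => hint q,
      tsum_eq_sum (s := hψ.toFinset) fun q hq => by
        by_contra hne
        exact hq (hψ.mem_toFinset.2 hne)]
    refine Finset.sum_congr rfl fun q _ => ?_
    rw [integral_indicator_const _ (hB q).1, measureReal_def, (hB q).2]
    simp

namespace HermPair

variable {F : Type*} [Field F] [NumberField F] [IsCMField F] {n : ℕ}
  {α : Polynomial F} [Fact (Irreducible α)]
  (D : HermPair F n) {KG : Subgroup D.GA} (f₀ : D.HeckeFun KG) (f : D.VecFun KG)
  {ξ : maximalRealSubfield F}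

omit [Fact (Irreducible α)] in
theorem Pair.u_ne_zero {D : HermPair F n} (hξ : ξ ≠ 0) (x : D.Pair α ξ) : x.u ≠ 0 := by
  intro h0
  have h1 := x.norm_eq
  rw [h0] at h1
  simp only [herm, zero_dotProduct] at h1
  exact hξ (Subtype.ext h1.symm)

/-- In the support, `h⁻¹` maps `u` into the support of `φ` and `h⁻¹ δ h` lies in that of `φ₀`; hence
the vectors `h⁻¹ δ^i u` lie in a fixed compact set. -/
theorem finite_support_orbit (hJ' : D.J'.det ≠ 0) (hKG : IsOpen (KG : Set D.GA)) (hξ : ξ ≠ 0)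
    (x : D.Pair α ξ) : (Function.support fun q : D.GA ⧸ KG =>
      f₀.atCoset (D.toGA x.δ) q * f.atCoset (D.vecA x.u) q).Finite := by
  let S₀ : Set (Matrix (Fin n) (Fin n) (AdeleF F)) :=
    (fun g : D.GA => g.val.val) '' tsupport f₀.toFun
  have hS₀ : IsCompact S₀ :=
    f₀.compactSupp.isCompact.image (Units.continuous_val.comp continuous_subtype_val)
  let N : Set (Fin n → AdeleF F) := ⋃ i : Fin n,
    (fun p : Matrix (Fin n) (Fin n) (AdeleF F) × (Fin n → AdeleF F) => p.1 ^ (i : ℕ) *ᵥ p.2) ''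
      (S₀ ×ˢ tsupport f.toFun)
  have hN : IsCompact N :=
    isCompact_iUnion fun i => (hS₀.prod f.compactSupp.isCompact).image (by fun_prop)
  refine (D.finite_cosets_of_cyclic hJ' hKG x.δ x.charpoly_eq (x.u_ne_zero hξ) hN).subset
    fun q hq => ?_
  obtain ⟨g, rfl⟩ := QuotientGroup.mk_surjective q
  refine ⟨g, rfl, fun i => ?_⟩
  rw [toGA_inv_mulVec_vecA]
  exact Set.mem_iUnion.2 ⟨i, (_, _), ⟨⟨_, subset_tsupport _ (left_ne_zero_of_mul hq), rfl⟩,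
    subset_tsupport _ (right_ne_zero_of_mul hq)⟩, rfl⟩

theorem orb_eq_tsum [MeasurableSpace D.GA] [BorelSpace D.GA] (μ : Measure D.GA)
    [μ.IsHaarMeasure] (hμ : μ (KG : Set D.GA) = 1) (hJ' : D.J'.det ≠ 0)
    (hKG : IsOpen (KG : Set D.GA)) (hξ : ξ ≠ 0) (x : D.Pair α ξ) :
    Integrable (orbIntegrand f₀ f x) μ ∧ orb μ f₀ f x =
      ∑' q : D.GA ⧸ KG, f₀.atCoset (D.toGA x.δ) q * f.atCoset (D.vecA x.u) q :=
  integral_comp_mk μ hKG hμ (D.finite_support_orbit f₀ f hJ' hKG hξ x)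

/-! ### Unfolding the sum over the CM cycle -/

variable {D} (w : F →+* ℂ) (KZ : Subgroup (ZA F))

/-- The double coset space `Z^ℚ(ℚ) \ Z^ℚ(𝔸_f) / K_Z`. -/
abbrev ZDouble (KZ : Subgroup (ZA F)) : Type _ :=
  DoubleCoset.Quotient ((ZQ.toAdelic F).range : Set (ZA F)) (KZ : Set (ZA F))

/-- The representative in `Z^ℚ(𝔸_f) / K_Z` of a double coset. -/
def ZDouble.rep {KZ : Subgroup (ZA F)} (d : ZDouble KZ) : ZA F ⧸ KZ :=
  ((Quotient.out d : ZA F) : ZA F ⧸ KZ)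

/-- Every coset of `K_Z` can be moved by `Z^ℚ(ℚ)` to the representative of its double coset. -/
theorem ZDouble.exists_smul_eq_rep {KZ : Subgroup (ZA F)} (c : ZA F ⧸ KZ) :
    ∃ (a : ZQ F) (d : ZDouble KZ), ZQ.toAdelic F a • c = d.rep := by
  obtain ⟨x, rfl⟩ := QuotientGroup.mk_surjective c
  have h1 := DoubleCoset.out_eq' _ _ (DoubleCoset.mk (ZQ.toAdelic F).range KZ x)
  obtain ⟨_, ⟨a, rfl⟩, k, hk, h2⟩ := (DoubleCoset.eq _ _ _ _).1 h1
  refine ⟨a⁻¹, DoubleCoset.mk (ZQ.toAdelic F).range KZ x, ?_⟩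
  change ((ZQ.toAdelic F a⁻¹ * x : ZA F) : ZA F ⧸ KZ) = _
  rw [ZDouble.rep, QuotientGroup.eq]
  nth_rw 1 [h2]
  rw [map_inv]
  have : ((ZQ.toAdelic F a)⁻¹ * (ZQ.toAdelic F a * Quotient.out
      (DoubleCoset.mk (ZQ.toAdelic F).range KZ x) * k))⁻¹ *
      Quotient.out (DoubleCoset.mk (ZQ.toAdelic F).range KZ x) = k⁻¹ := by group
  rw [this]
  exact KZ.inv_mem hk

theorem ZDouble.eq_of_smul_rep {KZ : Subgroup (ZA F)} {d d' : ZDouble KZ} {a : ZQ F}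
    (h : ZQ.toAdelic F a • d.rep = d'.rep) : d = d' := by
  rw [← DoubleCoset.out_eq' _ _ d, ← DoubleCoset.out_eq' _ _ d', DoubleCoset.eq]
  have h1 : ((ZQ.toAdelic F a * Quotient.out d : ZA F) : ZA F ⧸ KZ) =
    (Quotient.out d' : ZA F) := h
  rw [QuotientGroup.eq] at h1
  exact ⟨_, ⟨a, rfl⟩, _, h1, by group⟩

variable {w KZ} (hfix : ∀ δ : D.GQ, δ.val.val.charpoly = α →
    ∃! z : NegLine (D.J'.map w), D.actLine w δ z = z)

omit [Fact (Irreducible α)] in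
include hfix in
/-- A point of the cover of the CM cycle is determined by its rational and its adelic components. -/
theorem CMCover.ext_of_fixed {c c' : D.CMCover w KZ KG α} (hδ : c.δ = c'.δ)
    (hz : c.pt.zc = c'.pt.zc) (hg : c.pt.gc = c'.pt.gc) : c = c' := by
  refine CMCover.ext hδ (Cover.ext ?_ hz hg)
  exact (hfix c.δ c.charpoly_eq).unique c.fixed (by rw [hδ]; exact c'.fixed)

omit [Fact (Irreducible α)] in
include hfix in
/-- The CM cycle has finite support. -/
theorem finite_mult_ne_zero (hKZ : IsOpen (KZ : Set (ZA F)))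
    (hfin : ∃ S : Set (D.GQ × (D.GA ⧸ KG)), S.Finite ∧ ∀ (δ : D.GQ) (q : D.GA ⧸ KG),
      δ.val.val.charpoly = α → f₀.atCoset (D.toGA δ) q ≠ 0 →
        ∃ γ : D.GQ, (γ * δ * γ⁻¹, D.toGA γ • q) ∈ S) :
    {P : D.CMPoints w KZ KG α | P.mult f₀ ≠ 0}.Finite := by
  obtain ⟨S, hS, hγ⟩ := hfin
  have := finite_doubleCoset_ZA KZ hKZ
  have h1 : ∀ P : {P : D.CMPoints w KZ KG α | P.mult f₀ ≠ 0}, ∃ s : S × ZDouble KZ,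
      ∃ c : D.CMCover w KZ KG α, (⟦c⟧ : D.CMPoints w KZ KG α) = P.1 ∧ c.δ = s.1.1.1 ∧
        c.pt.zc = s.2.rep ∧ c.pt.gc = s.1.1.2 := by
    rintro ⟨P, hP⟩
    obtain ⟨c, rfl⟩ := Quotient.exists_rep P
    obtain ⟨γ, hmem⟩ := hγ c.δ c.pt.gc c.charpoly_eq hP
    obtain ⟨a, d, hd⟩ := ZDouble.exists_smul_eq_rep c.pt.zc
    exact ⟨⟨⟨_, hmem⟩, d⟩, (a, γ) • c, Quotient.sound ⟨(a, γ), rfl⟩, rfl, hd, rfl⟩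
  choose s c hc hδ hzc hgc using h1
  have := hS.to_subtype
  rw [← Set.finite_coe_iff]
  refine Finite.of_injective s fun P P' h => Subtype.ext ?_
  rw [← hc P, ← hc P']
  congr 1
  apply CMCover.ext_of_fixed hfix
  · rw [hδ, hδ, h]
  · rw [hzc, hzc, h]
  · rw [hgc, hgc, h]

end HermPair

namespace HermPair

variable {F : Type*} [Field F] [NumberField F] [IsCMField F] {n : ℕ}
  {α : Polynomial F} [Fact (Irreducible α)]
  {D : HermPair F n} {KG : Subgroup D.GA} (f₀ : D.HeckeFun KG) (f : D.VecFun KG)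
  {ξ : maximalRealSubfield F} {w : F →+* ℂ} {KZ : Subgroup (ZA F)}
  (hfix : ∀ δ : D.GQ, δ.val.val.charpoly = α →
    ∃! z : NegLine (D.J'.map w), D.actLine w δ z = z)
  (hfree : ∀ (p : ZQ F × D.GQ) (x : D.Cover w KZ KG), p • x = x → p = 1)
  (rep : D.PairOrbits α ξ → D.Pair α ξ) (hrep : ∀ o, (⟦rep o⟧ : D.PairOrbits α ξ) = o)
  (z : D.PairOrbits α ξ → NegLine (D.J'.map w)) (hz : ∀ o, D.actLine w (rep o).δ (z o) = z o)

/-- The point of the cover of the CM cycle attached to an orbit of pairs, a double coset of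
`Z^ℚ(𝔸_f)` and a coset of `G(𝔸_{0,f})`. -/
def orbitPoint (x : D.PairOrbits α ξ × ZDouble KZ × (D.GA ⧸ KG)) : D.CMCover w KZ KG α where
  δ := (rep x.1).δ
  pt := ⟨z x.1, x.2.1.rep, x.2.2⟩
  charpoly_eq := (rep x.1).charpoly_eq
  fixed := hz x.1

omit [Fact (Irreducible α)] in
theorem exists_smul_eq_out (c : D.CMCover w KZ KG α) :
    ∃ p : ZQ F × D.GQ, p • c = (Quotient.out (⟦c⟧ : D.CMPoints w KZ KG α)) :=
  Quotient.exact (Quotient.out_eq (⟦c⟧ : D.CMPoints w KZ KG α))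

/-- The element that moves a point of the cover to the chosen representative of its orbit. -/
def moveOut (c : D.CMCover w KZ KG α) : ZQ F × D.GQ := (exists_smul_eq_out c).choose

omit [Fact (Irreducible α)] in
theorem moveOut_smul (c : D.CMCover w KZ KG α) :
    moveOut c • c = (Quotient.out (⟦c⟧ : D.CMPoints w KZ KG α)) :=
  (exists_smul_eq_out c).choose_spec

/-- The orbits of pairs, together with a double coset of `Z^ℚ(𝔸_f)` and a coset of `G(𝔸_{0,f})`,
parametrize the pairs of a point `P` of the CM cycle and a vector `u` in the sum that defines the
Green function at `P`. This sum refers to the chosen representative of `P`, to which the vector has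
to be moved. -/
def unfold (x : D.PairOrbits α ξ × ZDouble KZ × (D.GA ⧸ KG)) :
    D.CMPoints w KZ KG α × D.VecNorm ξ :=
  (⟦orbitPoint rep z hz x⟧,
    D.vecPerm (moveOut (orbitPoint rep z hz x)).2 ξ ⟨(rep x.1).u, (rep x.1).norm_eq⟩)

include hrep in
/-- An element that identifies two points with their vectors stabilizes a pair `(δ, u)`, so that its
component in `G'(F₀)` is trivial. -/
theorem unfold_injective (hξ : ξ ≠ 0) :
    Function.Injective (unfold (KZ := KZ) (KG := KG) rep z hz) := by
  intro x x' h
  set c := orbitPoint rep z hz x with hc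
  set c' := orbitPoint rep z hz x' with hc'
  have h1 : (⟦c⟧ : D.CMPoints w KZ KG α) = ⟦c'⟧ := congrArg Prod.fst h
  have h2 : (moveOut c).2.val.val *ᵥ (rep x.1).u = (moveOut c').2.val.val *ᵥ (rep x'.1).u :=
    congrArg Subtype.val (congrArg Prod.snd h)
  obtain ⟨p, hp⟩ : ∃ p, p = (moveOut c')⁻¹ * moveOut c := ⟨_, rfl⟩
  have h3 : p • c = c' := by
    rw [hp, mul_smul, moveOut_smul, h1, ← moveOut_smul, inv_smul_smul]
  have h4 : p.2.val.val *ᵥ (rep x.1).u = (rep x'.1).u := by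
    have h5 : (((moveOut c').2)⁻¹ * (moveOut c).2).val.val *ᵥ (rep x.1).u =
        (((moveOut c').2)⁻¹).val.val *ᵥ ((moveOut c).2.val.val *ᵥ (rep x.1).u) :=
      (Matrix.mulVec_mulVec _ _ _).symm
    have h6 : (((moveOut c').2)⁻¹).val.val * (moveOut c').2.val.val = 1 :=
      Units.inv_mul (moveOut c').2.val
    rw [hp]
    change (((moveOut c').2)⁻¹ * (moveOut c).2).val.val *ᵥ (rep x.1).u = _
    rw [h5, h2, Matrix.mulVec_mulVec, h6, Matrix.one_mulVec]
  have h5 : p.2 • rep x.1 = rep x'.1 :=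
    Pair.ext (congrArg CMCover.δ h3) h4
  have h6 : x.1 = x'.1 := by
    rw [← hrep x.1, ← hrep x'.1]
    exact (Quotient.sound ⟨p.2, h5⟩ : (⟦rep x'.1⟧ : D.PairOrbits α ξ) = ⟦rep x.1⟧).symm
  have h7 : p.2 = 1 := by
    rw [← h6] at h5
    exact D.eq_one_of_commute_of_fixed (rep x.1).δ (rep x.1).charpoly_eq ((rep x.1).u_ne_zero hξ)
      p.2 (congrArg Pair.δ h5) (congrArg Pair.u h5)
  have h8 : ZQ.toAdelic F p.1 • x.2.1.rep = x'.2.1.rep :=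
    congrArg (fun y : D.CMCover w KZ KG α => y.pt.zc) h3
  have h9 : D.toGA p.2 • x.2.2 = x'.2.2 :=
    congrArg (fun y : D.CMCover w KZ KG α => y.pt.gc) h3
  rw [h7, map_one, one_smul] at h9
  exact Prod.ext h6 (Prod.ext (ZDouble.eq_of_smul_rep h8) h9)

omit [Fact (Irreducible α)] in
include hrep hfix hfree in
/-- Given `P` and `u`, the pair `(δ, u)` and the component in `Z^ℚ(𝔸_f)` can be moved to their
representatives; since the action is free, the element that moves the point back is the inverse. -/
theorem unfold_surjective :
    Function.Surjective (unfold (KZ := KZ) (KG := KG) rep z hz) := by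
  rintro ⟨P, u⟩
  let y : D.Pair α ξ := ⟨P.out.δ, u.1, P.out.charpoly_eq, u.2⟩
  obtain ⟨γ, hγ⟩ : ∃ γ : D.GQ, γ • y = rep ⟦y⟧ :=
    Quotient.exact (hrep ⟦y⟧)
  obtain ⟨a, d, hd⟩ := ZDouble.exists_smul_eq_rep P.out.pt.zc
  let x : D.PairOrbits α ξ × ZDouble KZ × (D.GA ⧸ KG) := (⟦y⟧, d, D.toGA γ • P.out.pt.gc)
  have hc : ((a, γ) : ZQ F × D.GQ) • P.out = orbitPoint rep z hz x :=
    CMCover.ext_of_fixed hfix (congrArg Pair.δ hγ) hd rfl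
  have hP : (⟦orbitPoint rep z hz x⟧ : D.CMPoints w KZ KG α) = P := by
    rw [← hc]
    exact (Quotient.sound ⟨(a, γ), rfl⟩ : (⟦((a, γ) : ZQ F × D.GQ) • P.out⟧ :
      D.CMPoints w KZ KG α) = ⟦P.out⟧).trans (Quotient.out_eq P)
  have h1 : (moveOut (orbitPoint rep z hz x) * (a, γ)) • P.out = P.out := by
    rw [mul_smul, hc, moveOut_smul, hP]
  have h2 : moveOut (orbitPoint rep z hz x) * (a, γ) = 1 :=
    hfree _ P.out.pt (congrArg CMCover.pt h1)
  refine ⟨x, Prod.ext hP (Subtype.ext ?_)⟩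
  change (moveOut (orbitPoint rep z hz x)).2.val.val *ᵥ (rep ⟦y⟧).u = u.1
  have h3 : (rep ⟦y⟧).u = γ.val.val *ᵥ u.1 := (congrArg Pair.u hγ).symm
  rw [h3, Matrix.mulVec_mulVec]
  change ((moveOut (orbitPoint rep z hz x)).2 * γ).val.val *ᵥ u.1 = u.1
  rw [show (moveOut (orbitPoint rep z hz x)).2 * γ = 1 from congrArg Prod.snd h2]
  exact Matrix.one_mulVec _

/-- The contribution of a point `P` of the CM cycle and a vector `u` to the sum of the values of the
Green function. -/
def pointTerm (a : ℝ) (y : D.CMPoints w KZ KG α × D.VecNorm ξ) : ℝ :=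
  y.1.mult f₀ * greenTerm f a y.1.out.pt y.2.1

omit [Fact (Irreducible α)] in
theorem pointTerm_unfold (a : ℝ) (x : D.PairOrbits α ξ × ZDouble KZ × (D.GA ⧸ KG)) :
    pointTerm f₀ f a (unfold rep z hz x) = D.kudlaGreen w a (rep x.1).u (z x.1) *
      (f₀.atCoset (D.toGA (rep x.1).δ) x.2.2 * f.atCoset (D.vecA (rep x.1).u) x.2.2) := by
  have h1 : greenTerm f a (Quotient.out (⟦orbitPoint rep z hz x⟧ : D.CMPoints w KZ KG α)).pt
      ((moveOut (orbitPoint rep z hz x)).2.val.val *ᵥ (rep x.1).u) =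
      greenTerm f a (orbitPoint rep z hz x).pt (rep x.1).u := by
    rw [← moveOut_smul]
    exact greenTerm_smul f a (moveOut (orbitPoint rep z hz x)) (orbitPoint rep z hz x).pt _
  change f₀.atCoset (D.toGA (rep x.1).δ) x.2.2 * greenTerm f a _ _ = _
  rw [show ((unfold rep z hz x).2 : Fin n → F) =
    (moveOut (orbitPoint rep z hz x)).2.val.val *ᵥ (rep x.1).u from rfl]
  refine (congrArg _ h1).trans ?_
  change _ * (f.atCoset (D.vecA (rep x.1).u) x.2.2 * D.kudlaGreen w a (rep x.1).u (z x.1)) = _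
  ring

omit [Fact (Irreducible α)] in
theorem summable_pointTerm {a : ℝ}
    (hsum : ∀ P : D.CMCover w KZ KG α, Summable fun u : D.VecNorm ξ => greenTerm f a P.pt u.1)
    (hfin : {P : D.CMPoints w KZ KG α | P.mult f₀ ≠ 0}.Finite) :
    Summable (pointTerm (ξ := ξ) (w := w) (KZ := KZ) (α := α) f₀ f a) := by
  classical
  have h1 : pointTerm (ξ := ξ) (w := w) (KZ := KZ) (α := α) f₀ f a = fun y =>
      ∑ P ∈ hfin.toFinset, if y.1 = P then pointTerm f₀ f a (P, y.2) else 0 := by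
    funext y
    rw [Finset.sum_ite_eq]
    split_ifs with h
    · rfl
    · rw [hfin.mem_toFinset, Set.mem_ofPred_eq, not_not] at h
      rw [pointTerm, h, zero_mul]
  rw [h1]
  refine summable_sum fun P _ => ?_
  have hinj : Function.Injective fun u : D.VecNorm ξ => (P, u) := fun u u' h => congrArg Prod.snd h
  rw [← hinj.summable_iff]
  · refine ((hsum P.out).mul_left (P.mult f₀)).congr fun u => ?_
    simp [pointTerm]
  · rintro ⟨P', u⟩ h
    rw [if_neg]
    rintro rfl
    exact h ⟨u, rfl⟩

omit [Fact (Irreducible α)] in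
theorem green_toSh (a : ℝ) (P : D.CMPoints w KZ KG α) :
    green f a ξ P.toSh = greenCover f a ξ P.out.pt := by
  conv_lhs => rw [← Quotient.out_eq P]
  rfl

include hfix hfree hrep hz in
/-- The sum of the values of the Green function over the CM cycle, as a sum over orbits. -/
theorem hasSum_kudlaGreen_mul_orb [MeasurableSpace D.GA] [BorelSpace D.GA] (μ : Measure D.GA)
    [μ.IsHaarMeasure] (hμ : μ (KG : Set D.GA) = 1) (hJ' : D.J'.det ≠ 0)
    (hKG : IsOpen (KG : Set D.GA)) (hKZ : IsOpen (KZ : Set (ZA F))) (hξ : ξ ≠ 0) {a : ℝ}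
    (hsum : ∀ P : D.CMCover w KZ KG α, Summable fun u : D.VecNorm ξ => greenTerm f a P.pt u.1)
    (hfin : {P : D.CMPoints w KZ KG α | P.mult f₀ ≠ 0}.Finite) :
    HasSum (fun o => D.kudlaGreen w a (rep o).u (z o) * orb μ f₀ f (rep o))
      (1 / tau KZ * greenSum w KZ α ξ a f₀ f) := by
  have hfinZ := finite_doubleCoset_ZA KZ hKZ
  have := Fintype.ofFinite (ZDouble KZ)
  have hs := summable_pointTerm (ξ := ξ) f₀ f hsum hfin
  have hgreen : greenSum w KZ α ξ a f₀ f = ∑' y, pointTerm (ξ := ξ) (w := w) (KZ := KZ) (α := α)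
      f₀ f a y := by
    rw [hs.tsum_prod]
    refine tsum_congr fun P => ?_
    rw [green_toSh, greenCover, ← tsum_mul_left]
    rfl
  let e := Equiv.ofBijective (unfold (KZ := KZ) (KG := KG) rep z hz)
    ⟨unfold_injective rep hrep z hz hξ, unfold_surjective hfix hfree rep hrep z hz⟩
  have h1 : HasSum (fun x : D.PairOrbits α ξ × ZDouble KZ × (D.GA ⧸ KG) =>
      D.kudlaGreen w a (rep x.1).u (z x.1) *
      (f₀.atCoset (D.toGA (rep x.1).δ) x.2.2 * f.atCoset (D.vecA (rep x.1).u) x.2.2))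
      (greenSum w KZ α ξ a f₀ f) := by
    rw [hgreen]
    refine HasSum.congr_fun ((e.hasSum_iff).2 hs.hasSum) fun x => ?_
    exact (pointTerm_unfold f₀ f rep z hz a x).symm
  -- for a fixed orbit, the double cosets contribute the factor `τ(Z^ℚ)` and the cosets of `K_G` the
  -- orbital integral
  have h2 : ∀ o : D.PairOrbits α ξ, HasSum (fun y : ZDouble KZ × (D.GA ⧸ KG) =>
      D.kudlaGreen w a (rep o).u (z o) *
      (f₀.atCoset (D.toGA (rep o).δ) y.2 * f.atCoset (D.vecA (rep o).u) y.2))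
      (tau KZ * (D.kudlaGreen w a (rep o).u (z o) * orb μ f₀ f (rep o))) := by
    intro o
    have hsupp := D.finite_support_orbit f₀ f hJ' hKG hξ (rep o)
    have h3 : Summable fun y : ZDouble KZ × (D.GA ⧸ KG) => D.kudlaGreen w a (rep o).u (z o) *
        (f₀.atCoset (D.toGA (rep o).δ) y.2 * f.atCoset (D.vecA (rep o).u) y.2) := by
      refine summable_of_hasFiniteSupport ((Set.finite_univ.prod hsupp).subset ?_)
      rintro y hy
      exact ⟨Set.mem_univ _, right_ne_zero_of_mul hy⟩
    rw [(D.orb_eq_tsum f₀ f μ hμ hJ' hKG hξ (rep o)).2]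
    have h4 := h3.hasSum
    rw [h3.tsum_prod, tsum_fintype] at h4
    simp only [Finset.sum_const, Finset.card_univ, tsum_mul_left, nsmul_eq_mul] at h4
    rw [← Nat.card_eq_fintype_card] at h4
    exact h4
  have h3 := (h1.prod_fiberwise h2).mul_left (1 / (tau KZ : ℝ))
  have hne : Nonempty (ZDouble KZ) := ⟨DoubleCoset.mk _ _ 1⟩
  have hτ : (tau KZ : ℝ) ≠ 0 := by
    have : Nat.card (ZDouble KZ) ≠ 0 := Nat.card_pos.ne'
    exact_mod_cast this
  refine HasSum.congr_fun h3 fun o => ?_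
  field_simp

end HermPair

/-! ### The places of the reflex field -/

section Places

variable {F : Type*} [Field F] [NumberField F]

/-- The reflex field is contained in the Galois closure of `F`, since automorphisms that fix the
latter preserve every function of the embeddings. -/
instance finiteDimensional_reflexField (r : (F →+* QBar) → ℕ) :
    FiniteDimensional ℚ (reflexField r) := by
  let L : IntermediateField ℚ QBar := ⨆ φ : F →ₐ[ℚ] QBar, φ.fieldRange
  have : FiniteDimensional ℚ L := by
    have : ∀ φ : F →ₐ[ℚ] QBar, FiniteDimensional ℚ φ.fieldRange := fun φ =>
      LinearMap.finiteDimensional_range φ.toLinearMap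
    exact IntermediateField.finiteDimensional_iSup_of_finite
  have hle : L.fixingSubgroup ≤ typeStab r := by
    intro σ hσ φ
    congr 1
    ext x
    have hx : φ x ∈ L :=
      (le_iSup (fun φ : F →ₐ[ℚ] QBar => φ.fieldRange) φ.toRatAlgHom) ⟨x, rfl⟩
    exact (IntermediateField.mem_fixingSubgroup_iff _ _).1 hσ _ hx
  have h2 : reflexField r ≤ L := by
    rw [← InfiniteGalois.fixedField_fixingSubgroup L]
    exact IntermediateField.fixedField_le hle
  exact Module.Finite.of_injective (IntermediateField.inclusion h2).toLinearMap
    (IntermediateField.inclusion_injective h2)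

variable [IsCMField F] {n : ℕ} (hn : 0 < n) {Φ : Set (F →+* QBar)} (hΦ : IsCMType Φ)
  {φ₀ : F →+* QBar} (h₀ : φ₀ ∈ Φ)

theorem conjugate_ne (w : F →+* ℂ) : ComplexEmbedding.conjugate w ≠ w := by
  have h1 := IsTotallyComplex.isComplex (InfinitePlace.mk w)
  rw [InfinitePlace.isComplex_mk_iff] at h1
  exact h1

/-- The places of `E` are complex, since `E` contains the totally complex field `F`. -/
theorem mult_eq_two (ν : InfinitePlace (reflexE n Φ φ₀)) (hn : 0 < n) (hΦ : IsCMType Φ)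
    (h₀ : φ₀ ∈ Φ) : ν.mult = 2 := by
  rw [InfinitePlace.mult, if_neg]
  intro hreal
  rw [InfinitePlace.isReal_iff] at hreal
  refine conjugate_ne (ν.embedding.comp (toReflex hn hΦ h₀)) ?_
  ext x
  exact congrArg (fun f : reflexE n Φ φ₀ →+* ℂ => f (toReflex hn hΦ h₀ x)) hreal

variable {v₀ : maximalRealSubfield F →+* ℝ} {w₀ : F →+* ℂ}
  (hw₀ : ∀ x : maximalRealSubfield F, w₀ (x : F) = (v₀ x : ℂ))

include hw₀ in
/-- There are `[E : F]` places of `E` over `v₀`: each contains exactly one embedding that extends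
`w₀`. -/
theorem ncard_placesOver : (placesOver hn hΦ h₀ v₀).ncard = degE hn hΦ h₀ := by
  let := (toReflex hn hΦ h₀).toAlgebra
  let := w₀.toAlgebra
  have : FiniteDimensional ℚ (reflexE n Φ φ₀) :=
    IntermediateField.finiteDimensional_sup _ _
  have : IsScalarTower ℚ F (reflexE n Φ φ₀) :=
    IsScalarTower.of_algebraMap_eq' (Subsingleton.elim _ _)
  have : FiniteDimensional F (reflexE n Φ φ₀) := Module.Finite.right ℚ F _
  have hover : ∀ ψ : reflexE n Φ φ₀ →ₐ[F] ℂ,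
      (ψ : reflexE n Φ φ₀ →+* ℂ).comp (toReflex hn hΦ h₀) = w₀ := fun ψ =>
    RingHom.ext fun x => ψ.commutes x
  let g : (reflexE n Φ φ₀ →ₐ[F] ℂ) → InfinitePlace (reflexE n Φ φ₀) := fun ψ =>
    InfinitePlace.mk (ψ : reflexE n Φ φ₀ →+* ℂ)
  have hinj : Function.Injective g := by
    intro ψ ψ' h
    rcases InfinitePlace.mk_eq_iff.1 h with h1 | h1
    · exact AlgHom.ext fun x => congrArg (fun f : reflexE n Φ φ₀ →+* ℂ => f x) h1
    · refine absurd ?_ (conjugate_ne w₀)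
      calc ComplexEmbedding.conjugate w₀
          = ComplexEmbedding.conjugate ((ψ : reflexE n Φ φ₀ →+* ℂ).comp (toReflex hn hΦ h₀)) := by
            rw [hover ψ]
        _ = (ComplexEmbedding.conjugate (ψ : reflexE n Φ φ₀ →+* ℂ)).comp
            (toReflex hn hΦ h₀) := rfl
        _ = w₀ := by rw [h1, hover ψ']
  have hrange : Set.range g = placesOver hn hΦ h₀ v₀ := by
    ext ν
    constructor
    · rintro ⟨ψ, rfl⟩ x
      rcases InfinitePlace.embedding_mk_eq (ψ : reflexE n Φ φ₀ →+* ℂ) with h1 | h1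
      · rw [h1, ← hw₀, ← hover ψ]
        rfl
      · rw [h1, ← conjugate_over hw₀, ← hover ψ]
        rfl
    · intro hν
      have h2 : ∀ x : maximalRealSubfield F,
          (ν.embedding.comp (toReflex hn hΦ h₀)) (x : F) = (v₀ x : ℂ) := hν
      rcases embedding_eq_or_conj h2 hw₀ with h1 | h1
      · exact ⟨⟨ν.embedding, fun x => congrArg (fun f : F →+* ℂ => f x) h1⟩, ν.mk_embedding⟩
      · refine ⟨⟨ComplexEmbedding.conjugate ν.embedding,
          fun x => congrArg (fun f : F →+* ℂ => f x) h1⟩, ?_⟩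
        exact (InfinitePlace.mk_conjugate_eq _).trans ν.mk_embedding
  rw [← hrange, ← Set.image_univ, Set.ncard_image_of_injective _ hinj, Set.ncard_univ,
    Nat.card_eq_fintype_card, AlgHom.card]
  rfl

end Places

namespace HermPair

variable {F : Type*} [Field F] [NumberField F] [IsCMField F] {n : ℕ} (hn : 0 < n)
  {Φ : Set (F →+* QBar)} (hΦ : IsCMType Φ) {φ₀ : F →+* QBar} (h₀ : φ₀ ∈ Φ)
  {v₀ : maximalRealSubfield F →+* ℝ} {w₀ : F →+* ℂ}
  (hw₀ : ∀ x : maximalRealSubfield F, w₀ (x : F) = (v₀ x : ℂ))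
  {D : HermPair F n} {KZ : Subgroup (ZA F)} {KG : Subgroup D.GA} {α : Polynomial F}
  {ξ : maximalRealSubfield F} {a : ℝ} (f₀ : D.HeckeFun KG) (f : D.VecFun KG)

include hw₀ in
/-- If the sum over the CM cycle is the same at all places over `v₀`, then their average is `1 /
τ(Z^ℚ)` times it: the factor `½` of the pairing cancels against `log q_ν = 2`, and `[E : F]` against
the number of places. -/
theorem intK_eq {s : ℝ} (hs : ∀ w : F →+* ℂ, (∀ x : maximalRealSubfield F, w (x : F) = (v₀ x : ℂ)) →
    greenSum w KZ α ξ a f₀ f = s) : intK hn hΦ h₀ KZ α ξ a f₀ f v₀ = 1 / tau KZ * s := by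
  have h1 := ncard_placesOver hn hΦ h₀ hw₀
  have hdeg : degE hn hΦ h₀ ≠ 0 := by
    let := (toReflex hn hΦ h₀).toAlgebra
    have : FiniteDimensional ℚ (reflexE n Φ φ₀) :=
      IntermediateField.finiteDimensional_sup _ _
    have : IsScalarTower ℚ F (reflexE n Φ φ₀) :=
      IsScalarTower.of_algebraMap_eq' (Subsingleton.elim _ _)
    have : FiniteDimensional F (reflexE n Φ φ₀) := Module.Finite.right ℚ F _
    exact (Module.finrank_pos (R := F) (M := reflexE n Φ φ₀)).ne'
  have hfin : (placesOver hn hΦ h₀ v₀).Finite := Set.finite_of_ncard_ne_zero (h1 ▸ hdeg)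
  have h2 : ∑ᶠ ν ∈ placesOver hn hΦ h₀ v₀, intNatural hn hΦ h₀ KZ α ξ a f₀ f ν =
      ∑ᶠ ν ∈ placesOver hn hΦ h₀ v₀, s := by
    refine finsum_mem_congr rfl fun ν hν => ?_
    rw [intNatural, mult_eq_two ν hn hΦ h₀, hs (ν.embedding.comp (toReflex hn hΦ h₀)) hν]
    push_cast
    ring
  rw [intK, h2, finsum_mem_eq_finite_toFinset_sum _ hfin, Finset.sum_const,
    ← Set.ncard_eq_toFinset_card _ hfin, h1, nsmul_eq_mul]
  have h3 : (degE hn hΦ h₀ : ℝ) ≠ 0 := by exact_mod_cast hdeg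
  rw [one_div, mul_inv, one_div, mul_assoc, inv_mul_cancel_left₀ h3]

end HermPair

theorem iwasawaA_pos (h : SL(2, ℝ)) : 0 < iwasawaA h := by
  have h1 := Matrix.det_fin_two (h : Matrix (Fin 2) (Fin 2) ℝ)
  rw [h.det_coe] at h1
  rw [iwasawaA, inv_pos]
  by_contra hneg
  have h2 : (h 1 0) ^ 2 + (h 1 1) ^ 2 = 0 := le_antisymm (not_lt.1 hneg) (by positivity)
  have h3 : h 1 0 = 0 := by nlinarith [sq_nonneg (h 1 0), sq_nonneg (h 1 1)]
  have h4 : h 1 1 = 0 := by nlinarith [sq_nonneg (h 1 0), sq_nonneg (h 1 1)]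
  rw [h3, h4] at h1
  simp at h1

namespace HermPair

variable {F : Type*} [Field F] [NumberField F] [IsCMField F] {n : ℕ}
  {α : Polynomial F} [Fact (Irreducible α)] [IsCMField (AdjoinRoot α)]
  (hroot : conjF (AdjoinRoot α) (AdjoinRoot.root α) = (AdjoinRoot.root α)⁻¹)
  (D : HermPair F n) (hn : 0 < n) {v₀ : maximalRealSubfield F →+* ℝ}
  (hV'₀ : ∀ w : F →+* ℂ, (∀ x : maximalRealSubfield F, w (x : F) = (v₀ x : ℂ)) →
    HasSignature (D.J'.map w) (n - 1))
  (hV' : ∀ w : F →+* ℂ, ¬ (∀ x : maximalRealSubfield F, w (x : F) = (v₀ x : ℂ)) →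
    HasSignature (D.J'.map w) n)
  {w : F →+* ℂ} (hw : ∀ x : maximalRealSubfield F, w (x : F) = (v₀ x : ℂ))

/-! ### The sum over orbits of pairs -/

include hV'₀ hw in
omit [Fact (Irreducible α)] [IsCMField (AdjoinRoot α)] in
theorem det_ne_zero : D.J'.det ≠ 0 := by
  intro h0
  apply (hV'₀ w hw).det_ne_zero
  rw [← RingHom.mapMatrix_apply, ← RingHom.map_det, h0, map_zero]

include hroot hn hV'₀ hV' hw in
/-- The value of the Green function of `u` at the fixed line of `δ`, in terms of the negative place
of the refined invariant. The right hand side does not involve the embedding `w` over `v₀`. -/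
theorem kudlaGreen_fixed {ξ : maximalRealSubfield F} (hξ : ξ ≠ 0) (x : D.Pair α ξ) (a : ℝ)
    (z : NegLine (D.J'.map w)) (hz : D.actLine w x.δ z = z)
    (v' : maximalRealSubfield (AdjoinRoot α) →+* ℝ)
    (hv' : v' (D.refinedInv x.δ x.charpoly_eq hroot x.u) < 0) :
    D.kudlaGreen w a x.u z =
      -Ei (-(2 * Real.pi * a * |v' (D.refinedInv x.δ x.charpoly_eq hroot x.u)|)) := by
  rw [kudlaGreen, ((D.existsUnique_negative_place hroot hn hV'₀ hV' hw x.δ x.charpoly_eq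
    (Pair.u_ne_zero hξ x)).2 v' hv').2 z hz, mul_neg]

include hroot hn hV'₀ hV' hw in
theorem summable_greenTerm_cmCover {KZ : Subgroup (ZA F)} {KG : Subgroup D.GA} (f : D.VecFun KG)
    {a : ℝ} (ha : 0 < a) {ξ : maximalRealSubfield F} (hξ : ξ ≠ 0) (P : D.CMCover w KZ KG α) :
    Summable fun u : D.VecNorm ξ => greenTerm f a P.pt u.1 :=
  D.summable_greenTerm hroot hn hV'₀ hV' hw P.δ P.charpoly_eq P.fixed f ha hξ P.pt rfl

end HermPair

end KudlaGreen

end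

theorem mainTheorem9 {F : Type*} [Field F] [NumberField F] [IsCMField F] (n : ℕ) (hn : 0 < n)
    -- the CM type, its distinguished element, and the hermitian spaces `V` and `V'`
    (Φ : Set (F →+* KudlaGreen.QBar)) (hΦ : KudlaGreen.IsCMType Φ)
    (φ₀ : F →+* KudlaGreen.QBar) (h₀ : φ₀ ∈ Φ) (ι : KudlaGreen.QBar →+* ℂ)
    (D : KudlaGreen.HermPair F n)
    (hV : ∀ φ ∈ Φ, KudlaGreen.HasSignature (D.J.map (ι.comp φ))
      (KudlaGreen.drinfeldType n Φ φ₀ φ))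
    (v₀ : maximalRealSubfield F →+* ℝ)
    (hV'₀ : ∀ w : F →+* ℂ, (∀ x : maximalRealSubfield F, w (x : F) = (v₀ x : ℂ)) →
      KudlaGreen.HasSignature (D.J'.map w) (n - 1))
    (hV' : ∀ w : F →+* ℂ, ¬ (∀ x : maximalRealSubfield F, w (x : F) = (v₀ x : ℂ)) →
      KudlaGreen.HasSignature (D.J'.map w) n)
    -- the level
    (KZ : Subgroup (KudlaGreen.ZA F)) (hKZ : IsOpen (KZ : Set (KudlaGreen.ZA F)))
    (hKZc : IsCompact (KZ : Set (KudlaGreen.ZA F)))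
    (KG : Subgroup D.GA) (hKG : IsOpen (KG : Set D.GA)) (hKGc : IsCompact (KG : Set D.GA))
    (hsmall : ∀ w : F →+* ℂ, (∀ x : maximalRealSubfield F, w (x : F) = (v₀ x : ℂ)) →
      ∀ (p : KudlaGreen.ZQ F × D.GQ) (x : D.Cover w KZ KG), p • x = x → p = 1)
    -- the Haar measure giving volume one to the level subgroup
    [MeasurableSpace D.GA] [BorelSpace D.GA] (μ : Measure D.GA) [μ.IsHaarMeasure]
    (hμ : μ (KG : Set D.GA) = 1)
    -- the polynomial
    (α : Polynomial F) (hα : α.Monic) (hdeg : α.natDegree = n)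
    (hself : α.reverse = Polynomial.C (α.coeff 0) * α.map (KudlaGreen.conjF F))
    [Fact (Irreducible α)] [IsCMField (AdjoinRoot α)]
    (hroot : KudlaGreen.conjF (AdjoinRoot α) (AdjoinRoot.root α) = (AdjoinRoot.root α)⁻¹)
    -- the test functions and the parameters
    (f₀ : D.HeckeFun KG) (f : D.VecFun KG) (ξ : maximalRealSubfield F) (hξ : ξ ≠ 0)
    (h : (maximalRealSubfield F →+* ℝ) → SL(2, ℝ))
    (w₀ : F →+* ℂ) (hw₀ : ∀ x : maximalRealSubfield F, w₀ (x : F) = (v₀ x : ℂ)) :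
    -- the fixed point
    (∀ δ : D.GQ, δ.val.val.charpoly = α →
      ∃! z : KudlaGreen.NegLine (D.J'.map w₀), D.actLine w₀ δ z = z) ∧
    (∀ δ : D.GQ, δ.val.val.charpoly = α →
      ∀ z : KudlaGreen.NegLine (D.J'.map w₀), D.actLine w₀ δ z = z →
        ∀ u : Fin n → F, u ≠ 0 → ¬ z.Perp (fun i => w₀ (u i))) ∧
    -- the refined invariant
    (∀ x : D.Pair α ξ,
      KudlaGreen.HermPair.traceReal α (D.refinedInv x.δ x.charpoly_eq hroot x.u) = ξ ∧
      (∃! v' : maximalRealSubfield (AdjoinRoot α) →+* ℝ,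
        v' (D.refinedInv x.δ x.charpoly_eq hroot x.u) < 0) ∧
      ∀ v' : maximalRealSubfield (AdjoinRoot α) →+* ℝ,
        v' (D.refinedInv x.δ x.charpoly_eq hroot x.u) < 0 →
        v'.comp (KudlaGreen.HermPair.realMap α) = v₀ ∧
        ∀ z : KudlaGreen.NegLine (D.J'.map w₀), D.actLine w₀ x.δ z = z →
          KudlaGreen.RFun (fun i => w₀ (x.u i)) z =
            -|v' (D.refinedInv x.δ x.charpoly_eq hroot x.u)|) ∧
    -- convergence
    (∀ x : D.Pair α ξ, Integrable (KudlaGreen.HermPair.orbIntegrand f₀ f x) μ) ∧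
    (∀ w : F →+* ℂ, (∀ x : maximalRealSubfield F, w (x : F) = (v₀ x : ℂ)) →
      (∀ P : D.CMCover w KZ KG α, Summable fun u : D.VecNorm ξ =>
        KudlaGreen.HermPair.greenTerm f (KudlaGreen.iwasawaA (h v₀)) P.pt u.1) ∧
      {P : D.CMPoints w KZ KG α | P.mult f₀ ≠ 0}.Finite) ∧
    -- the formulas, for any choice of representatives of the orbits
    (∀ rep : D.PairOrbits α ξ → D.Pair α ξ, (∀ o, (⟦rep o⟧ : D.PairOrbits α ξ) = o) →
      (∀ z : D.PairOrbits α ξ → KudlaGreen.NegLine (D.J'.map w₀),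
        (∀ o, D.actLine w₀ (rep o).δ (z o) = z o) →
        HasSum (fun o => D.kudlaGreen w₀ (KudlaGreen.iwasawaA (h v₀)) (rep o).u (z o) *
            KudlaGreen.HermPair.orb μ f₀ f (rep o))
          (KudlaGreen.HermPair.intK hn hΦ h₀ KZ α ξ (KudlaGreen.iwasawaA (h v₀)) f₀ f v₀) ∧
        HasSum (fun o => D.kudlaGreen w₀ (KudlaGreen.iwasawaA (h v₀)) (rep o).u (z o) *
            KudlaGreen.HermPair.orb μ f₀ f (rep o))
          (1 / KudlaGreen.HermPair.tau KZ *
            KudlaGreen.HermPair.greenSum w₀ KZ α ξ (KudlaGreen.iwasawaA (h v₀)) f₀ f)) ∧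
      ∀ v₀' : D.PairOrbits α ξ → maximalRealSubfield (AdjoinRoot α) →+* ℝ,
        (∀ o, v₀' o (D.refinedInv (rep o).δ (rep o).charpoly_eq hroot (rep o).u) < 0) →
        HasSum (fun o => -(KudlaGreen.Ei (-(2 * Real.pi * KudlaGreen.iwasawaA (h v₀) *
              |v₀' o (D.refinedInv (rep o).δ (rep o).charpoly_eq hroot (rep o).u)|)) *
            KudlaGreen.HermPair.orb μ f₀ f (rep o)))
          (KudlaGreen.HermPair.intK hn hΦ h₀ KZ α ξ (KudlaGreen.iwasawaA (h v₀)) f₀ f v₀)) := by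
  have ha := KudlaGreen.iwasawaA_pos (h v₀)
  have hJ' : D.J'.det ≠ 0 := D.det_ne_zero hV'₀ hw₀
  have hfix : ∀ w : F →+* ℂ, (∀ x : maximalRealSubfield F, w (x : F) = (v₀ x : ℂ)) →
      ∀ δ : D.GQ, δ.val.val.charpoly = α →
      ∃! z : KudlaGreen.NegLine (D.J'.map w), D.actLine w δ z = z := fun w hw δ hδ =>
    D.existsUnique_fixed_line hroot δ hδ hn (hV'₀ w hw)
  have hplace := fun x : D.Pair α ξ => D.existsUnique_negative_place hroot hn hV'₀ hV' hw₀ x.δ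
    x.charpoly_eq (KudlaGreen.HermPair.Pair.u_ne_zero hξ x)
  have hgreen := fun (w : F →+* ℂ)
      (hw : ∀ x : maximalRealSubfield F, w (x : F) = (v₀ x : ℂ)) (P : D.CMCover w KZ KG α) =>
    D.summable_greenTerm_cmCover hroot hn hV'₀ hV' hw f ha hξ P
  have hmult := fun (w : F →+* ℂ)
      (hw : ∀ x : maximalRealSubfield F, w (x : F) = (v₀ x : ℂ)) =>
    KudlaGreen.HermPair.finite_mult_ne_zero f₀ (hfix w hw) hKZ
      (D.finite_orbits_heckeFun hroot hn hdeg hJ' hKG f₀)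
  refine ⟨hfix w₀ hw₀, fun δ hδ z hz u hu =>
    D.not_perp_of_fixed hroot δ hδ hn (hV'₀ w₀ hw₀) z hz u hu,
    fun x => ⟨D.traceReal_refinedInv hroot x.δ x.charpoly_eq x.norm_eq, hplace x⟩,
    fun x => (D.orb_eq_tsum f₀ f μ hμ hJ' hKG hξ x).1,
    fun w hw => ⟨hgreen w hw, hmult w hw⟩, fun rep hrep => ?_⟩
  -- the expression through the refined invariants shows that the sum over the CM cycle does not
  -- depend on the embedding over `v₀`
  have key : ∀ (v' : D.PairOrbits α ξ → maximalRealSubfield (AdjoinRoot α) →+* ℝ),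
      (∀ o, v' o (D.refinedInv (rep o).δ (rep o).charpoly_eq hroot (rep o).u) < 0) →
      ∀ w : F →+* ℂ, (∀ x : maximalRealSubfield F, w (x : F) = (v₀ x : ℂ)) →
      HasSum (fun o => -(KudlaGreen.Ei (-(2 * Real.pi * KudlaGreen.iwasawaA (h v₀) *
            |v' o (D.refinedInv (rep o).δ (rep o).charpoly_eq hroot (rep o).u)|)) *
          KudlaGreen.HermPair.orb μ f₀ f (rep o)))
        (1 / KudlaGreen.HermPair.tau KZ *
          KudlaGreen.HermPair.greenSum w KZ α ξ (KudlaGreen.iwasawaA (h v₀)) f₀ f) := by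
    intro v' hv' w hw
    choose z hz using fun o => (hfix w hw (rep o).δ (rep o).charpoly_eq).exists
    refine (KudlaGreen.HermPair.hasSum_kudlaGreen_mul_orb f₀ f (hfix w hw) (hsmall w hw) rep hrep
      z hz μ hμ hJ' hKG hKZ hξ (hgreen w hw) (hmult w hw)).congr_fun fun o => ?_
    rw [D.kudlaGreen_fixed hroot hn hV'₀ hV' hw hξ (rep o) _ (z o) (hz o) (v' o) (hv' o), neg_mul]
  choose v' hv' using fun o => (hplace (rep o)).1.exists
  have hint : KudlaGreen.HermPair.intK hn hΦ h₀ KZ α ξ (KudlaGreen.iwasawaA (h v₀)) f₀ f v₀ =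
      1 / KudlaGreen.HermPair.tau KZ *
        KudlaGreen.HermPair.greenSum w₀ KZ α ξ (KudlaGreen.iwasawaA (h v₀)) f₀ f := by
    refine KudlaGreen.HermPair.intK_eq hn hΦ h₀ hw₀ f₀ f fun w hw => ?_
    have hτ : (1 / KudlaGreen.HermPair.tau KZ : ℝ) ≠ 0 := by
      have := KudlaGreen.finite_doubleCoset_ZA KZ hKZ
      exact one_div_ne_zero (Nat.cast_ne_zero.2 Nat.card_pos.ne')
    exact mul_left_cancel₀ hτ ((key v' hv' w hw).unique (key v' hv' w₀ hw₀))
  rw [hint]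
  refine ⟨fun z hz => ?_, fun v' hv' => key v' hv' w₀ hw₀⟩
  have := KudlaGreen.HermPair.hasSum_kudlaGreen_mul_orb f₀ f (hfix w₀ hw₀) (hsmall w₀ hw₀) rep hrep
    z hz μ hμ hJ' hKG hKZ hξ (hgreen w₀ hw₀) (hmult w₀ hw₀)
  exact ⟨this, this⟩
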